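/- **Setting.** Let $P$ be a probability distribution on a measurable space $\mathcal Z$, and let $\rho(\theta,z)$, $\theta\in\mathbb R^p$, $z\in\mathcal Z$, be a loss that is measurable in $z$, $P$-integrable for each $\theta$, and twice differentiable in $\theta$. Write $\Psi=\nabla_\theta\rho$, $L(\theta)=E\rho(\theta,z)$ with $z\sim P$. Let $\theta_0\in\Theta\subseteq\mathbb R^p$ minimize $L$ over $\mathbb R^p$, and put $A=\nabla^2L(\theta_0)$, $S=E\{\Psi(\theta_0,z)\Psi(\theta_0,z)^\top\}$, $\tilde S=S+(4B_0^2/\mu^2)I$. Let $z_1,z_2,\dots$ be i.i.d. from $P$, $\xi_1,\xi_2,\dots$ i.i.d. standard Gaussian vectors in $\mathbb R^p$, and $M_1,M_2$ i.i.d. symmetric random matrices whose upper-triangular entries (with the diagonal) are i.i.d. $N(0,1)$, all jointly independent. For $\mu>0$, a fixed $\hat\theta_0\in\mathbb R^p$ and step sizes $\gamma_i=\gamma i^{-\alpha}$ with $\gamma>0$, $\alpha\in(1/2,1)$, let $$\hat\theta_i=\hat\theta_{i-1}-\gamma_i\Big\{\Psi(\hat\theta_{i-1},z_i)+\frac{2B_0}{\mu}\xi_i\Big\},\qquad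 i\ge1,$$ $$\hat A_n=\frac1n\sum_{i=1}^n\nabla^2\rho(\hat\theta_{i-1},z_i)+\frac{2B_1}{n\mu}M_1,\qquad \hat S_n=\frac1n\sum_{i=1}^n\Psi(\hat\theta_{i-1},z_i)\Psi(\hat\theta_{i-1},z_i)^\top+\frac{4B_0^2}{\mu^2}I+\frac{2B_0^2}{n\mu}M_2 .$$ Let $\hat A_n^*$ and $\hat S_n^*$ arise from the spectral decompositions of $\hat A_n$ and $\hat S_n$ by replacing each eigenvalue $d$ by $\max\{\kappa_1,d\}$ and $\max\{\kappa_2,d\}$ respectively, and put $\widehat\Sigma_n=\hat A_n^{*-1}\hat S_n^*\hat A_n^{*-1}$. Below, $\|\cdot\|$ of a matrix is the operator norm and $\Lambda_{\min}$ the smallest eigenvalue. **Assumptions**, with positive constants $B_0,\zeta,\lambda,C_1,C_2,C_3,K$ and a constant $B_1$: 1. $\|\Psi(\theta,z)\|_2\le B_0$ for all $\theta\in\mathbb R^p$, $z\in\mathcal Z$. 2. $L$ is differentiable, and for all $\theta_1,\theta_2\in\Theta$ one has $\frac\lambda2\|\theta_1-\theta_2\|_2^2\le L(\theta_1)-L(\theta_2)-\langle\nabla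 L(\theta_2),\theta_1-\theta_2\rangle\le\frac\zeta2\|\theta_1-\theta_2\|_2^2$. 3. For all $n\ge1$, with $\eta_n=\nabla L(\hat\theta_{n-1})-\Psi(\hat\theta_{n-1},z_n)$, $\hat\delta_n=\hat\theta_n-\theta_0$ and $\mathcal F_{n-1}=\sigma(z_1,\xi_1,\dots,z_{n-1},\xi_{n-1})$, almost surely: both $\|E(\eta_n\eta_n^\top|\mathcal F_{n-1})-S\|$ and $|\mathrm{tr}\{E(\eta_n\eta_n^\top|\mathcal F_{n-1})-S\}|$ are at most $C_1(\|\hat\delta_{n-1}\|_2+\|\hat\delta_{n-1}\|_2^2)$, and $E(\|\eta_n\|_2^4|\mathcal F_{n-1})\le C_2(1+\|\hat\delta_{n-1}\|_2^4)$. 4. $\nabla^2\rho(\theta,z)=m(\theta,z)m(\theta,z)^\top$ with $m(\theta,z)\in\mathbb R^p$ and $\|m(\theta,z)\|_2^2\le B_1$, for all $\theta\in\mathbb R^p$, $z\in\mathcal Z$. 5. $E\|\nabla^2\rho(\theta,z)-\nabla^2\rho(\theta_0,z)\|\le K\|\theta-\theta_0\|_2$ for all $\theta\in\mathbb R^p$,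 and $\|E\{\nabla^2\rho(\theta_0,z)\}^2-A^2\|\le C_3$. 6. $0<\kappa_1\le\Lambda_{\min}(A)$, $0\le\kappa_2\le\Lambda_{\min}(\tilde S)$, and $S\ne0$. **Theorem (error rate of the private plug-in estimator).** For every $n\ge1$, the mechanism that maps the data $(z_1,\dots,z_n)$ to $\widehat\Sigma_n$ is $\sqrt3\mu$-GDP: for any two data sets that differ in one entry, the trade-off function between the two laws of $\widehat\Sigma_n$ (over the noises $\xi_i,M_1,M_2$) is at least that between $N(0,1)$ and $N(\sqrt3\mu,1)$, the trade-off function of two laws being the least type II error of a test of the first against the second, as a function of the bound on its type I error. Moreover $\widehat\Sigma_n$ converges in mean to $A^{-1}\tilde SA^{-1}$: for every constant $c_p>0$ (in particular, one that depends on $p$ only) there is a constant $C>0$, independent of $n$, such that for all $n\ge1$ $$E\|\widehat\Sigma_n-A^{-1}\tilde SA^{-1}\|\le C\,\|S\|\,\frac{\sqrt{\gamma c_p}B_0^2K}{\mu}\Big(1+\Lambda_{\min}(S)+\frac{4B_0^2}{\mu^2}\Big)\Big(n^{-\alpha/2}+\frac{\sqrt{\gamma c_p}K}{\mu}n^{-\alpha}\Big).$$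 -/

import Mathlib

open MeasureTheory ProbabilityTheory Filter Topology
open scoped Matrix Matrix.Norms.L2Operator

noncomputable section

namespace PrivateSGD

/-! ### Gaussian differential privacy -/

/-- The trade-off function of two distributions: the least type II error of a randomized test `φ`
of `P` against `Q` whose type I error is at most `a`. -/
def tradeoff {X : Type*} [MeasurableSpace X] (P Q : Measure X) (a : ℝ) : ℝ :=
  sInf {b : ℝ | ∃ φ : X → ℝ, Measurable φ ∧ (∀ x, φ x ∈ Set.Icc (0 : ℝ) 1) ∧
    ∫ x, φ x ∂P ≤ a ∧ b = 1 - ∫ x, φ x ∂Q}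

/-- Two data streams are neighbours if they differ in at most one entry. -/
def Neighbours {Z : Type*} (D D' : ℕ → Z) : Prop :=
  ∃ k, ∀ i, i ≠ k → D i = D' i

/-- A mechanism sends a data stream to the law of its random output. It is `μ`-GDP if, for all
neighbouring inputs, telling the two outputs apart is at least as hard as telling `N(0,1)` from
`N(μ,1)`. -/
def IsGDP {Z X : Type*} [MeasurableSpace X] (μ : ℝ) (mech : (ℕ → Z) → Measure X) : Prop :=
  (∀ D, IsProbabilityMeasure (mech D)) ∧
  ∀ D D', Neighbours D D' → ∀ a ∈ Set.Icc (0 : ℝ) 1,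
    tradeoff (gaussianReal 0 1) (gaussianReal μ 1) a ≤ tradeoff (mech D) (mech D') a

/-! ### Matrices -/

/-- The smallest eigenvalue of a real symmetric matrix of positive size. -/
def lambdaMin {p : ℕ} (M : Matrix (Fin p) (Fin p) ℝ) : ℝ :=
  sInf (spectrum ℝ M)

open Classical in
/-- Eigenvalue truncation `Γ diag(max(κ, dᵢ)) Γᵀ` of a symmetric matrix `M = Γ diag(dᵢ) Γᵀ`
(it is only ever applied to symmetric matrices). -/
def truncate {p : ℕ} (κ : ℝ) (M : Matrix (Fin p) (Fin p) ℝ) : Matrix (Fin p) (Fin p) ℝ :=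
  if h : M.IsHermitian then
    (h.eigenvectorUnitary : Matrix (Fin p) (Fin p) ℝ) *
      Matrix.diagonal (fun i => max κ (h.eigenvalues i)) *
      (h.eigenvectorUnitary : Matrix (Fin p) (Fin p) ℝ)ᵀ
  else 0

/-- The Hessian matrix `(∂ⱼ ∂ᵢ f)(θ)`, as the derivative of the gradient. -/
def hessian {p : ℕ} (f : EuclideanSpace ℝ (Fin p) → ℝ) (θ : EuclideanSpace ℝ (Fin p)) :
    Matrix (Fin p) (Fin p) ℝ :=
  Matrix.of fun i j => (fderiv ℝ (gradient f) θ (EuclideanSpace.single j 1)) i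

/-- The outer product `v vᵀ`. -/
def outer {p : ℕ} (v : EuclideanSpace ℝ (Fin p)) : Matrix (Fin p) (Fin p) ℝ :=
  Matrix.of fun i j => v i * v j

/-! ### The optimization problem -/

section Problem

variable {p : ℕ} {Z : Type*}

/-- `Ψ(θ, z) = ∇ρ(θ, z)`, the gradient in the first argument. -/
def Psi (ρ : EuclideanSpace ℝ (Fin p) → Z → ℝ) (θ : EuclideanSpace ℝ (Fin p)) (z : Z) :
    EuclideanSpace ℝ (Fin p) :=
  gradient (fun t => ρ t z) θ

/-- `∇²ρ(θ, z)`, the Hessian in the first argument. -/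
def hessRho (ρ : EuclideanSpace ℝ (Fin p) → Z → ℝ) (θ : EuclideanSpace ℝ (Fin p)) (z : Z) :
    Matrix (Fin p) (Fin p) ℝ :=
  hessian (fun t => ρ t z) θ

variable [MeasurableSpace Z]

/-- The population loss `L(θ) = E ρ(θ, z)`. -/
def popLoss (ρ : EuclideanSpace ℝ (Fin p) → Z → ℝ) (P : Measure Z)
    (θ : EuclideanSpace ℝ (Fin p)) : ℝ :=
  ∫ z, ρ θ z ∂P

/-- `A = ∇²L(θ₀)`. -/
def matA (ρ : EuclideanSpace ℝ (Fin p) → Z → ℝ) (P : Measure Z)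
    (θ₀ : EuclideanSpace ℝ (Fin p)) : Matrix (Fin p) (Fin p) ℝ :=
  hessian (popLoss ρ P) θ₀

/-- `S = E[∇ρ(θ₀, z) ∇ρ(θ₀, z)ᵀ]`. -/
def matS (ρ : EuclideanSpace ℝ (Fin p) → Z → ℝ) (P : Measure Z)
    (θ₀ : EuclideanSpace ℝ (Fin p)) : Matrix (Fin p) (Fin p) ℝ :=
  Matrix.of fun i j => ∫ z, outer (Psi ρ θ₀ z) i j ∂P

/-- `S̃ = S + (4 B₀² / μ²) I`. -/
def matStilde (ρ : EuclideanSpace ℝ (Fin p) → Z → ℝ) (P : Measure Z)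
    (θ₀ : EuclideanSpace ℝ (Fin p)) (B₀ μ : ℝ) : Matrix (Fin p) (Fin p) ℝ :=
  matS ρ P θ₀ + (4 * B₀ ^ 2 / μ ^ 2) • (1 : Matrix (Fin p) (Fin p) ℝ)

/-- The standing setting: the loss is measurable in the observation, integrable, and twice
differentiable in the parameter, and `θ₀` minimizes the population loss. -/
structure IsProblem (ρ : EuclideanSpace ℝ (Fin p) → Z → ℝ) (P : Measure Z)
    (θ₀ : EuclideanSpace ℝ (Fin p)) : Prop where
  measurable : ∀ θ, Measurable (ρ θ)
  integrable : ∀ θ, Integrable (ρ θ) P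
  differentiable : ∀ z, Differentiable ℝ (fun θ => ρ θ z)
  differentiable_grad : ∀ z, Differentiable ℝ (fun θ => Psi ρ θ z)
  isMin : ∀ θ, popLoss ρ P θ₀ ≤ popLoss ρ P θ

/-- The population loss is differentiable, and `ζ`-smooth and `lam`-strongly convex on `Θ`. -/
structure SmoothStronglyConvex (ρ : EuclideanSpace ℝ (Fin p) → Z → ℝ) (P : Measure Z)
    (Θ : Set (EuclideanSpace ℝ (Fin p))) (ζ lam : ℝ) : Prop where
  differentiable : Differentiable ℝ (popLoss ρ P)
  smooth : ∀ θ₁ ∈ Θ, ∀ θ₂ ∈ Θ, popLoss ρ P θ₁ - popLoss ρ P θ₂ ≤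
    inner ℝ (gradient (popLoss ρ P) θ₂) (θ₁ - θ₂) + ζ / 2 * ‖θ₁ - θ₂‖ ^ 2
  strong : ∀ θ₁ ∈ Θ, ∀ θ₂ ∈ Θ,
    inner ℝ (gradient (popLoss ρ P) θ₂) (θ₁ - θ₂) + lam / 2 * ‖θ₁ - θ₂‖ ^ 2 ≤
      popLoss ρ P θ₁ - popLoss ρ P θ₂

/-- The Hessian has the form `m mᵀ` with `‖m‖² ≤ B₁` uniformly. -/
def HessianFactorizes (ρ : EuclideanSpace ℝ (Fin p) → Z → ℝ) (B₁ : ℝ) : Prop :=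
  ∃ m : EuclideanSpace ℝ (Fin p) → Z → EuclideanSpace ℝ (Fin p),
    ∀ θ z, hessRho ρ θ z = outer (m θ z) ∧ ‖m θ z‖ ^ 2 ≤ B₁

/-- The Hessian is Lipschitz at `θ₀` in mean, and its second moment at `θ₀` is close to `A²`. -/
structure HessianLipschitz (ρ : EuclideanSpace ℝ (Fin p) → Z → ℝ) (P : Measure Z)
    (θ₀ : EuclideanSpace ℝ (Fin p)) (K C₃ : ℝ) : Prop where
  lipschitz : ∀ θ, ∫ z, ‖hessRho ρ θ z - hessRho ρ θ₀ z‖ ∂P ≤ K * ‖θ - θ₀‖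
  second_moment :
    ‖(Matrix.of fun i j => ∫ z, (hessRho ρ θ₀ z ^ 2) i j ∂P) - matA ρ P θ₀ ^ 2‖ ≤ C₃

end Problem

/-! ### The algorithm and the estimator -/

section Algorithm

variable {p : ℕ} {Z : Type*}

/-- The noisy SGD iterates with step sizes `γᵢ = γ i^{-a}`. Observations and noises are numbered
from `0`, so that the step from `θ̂ᵢ` to `θ̂ᵢ₊₁` uses `z i` and `ξ i`. -/
def iterate (ρ : EuclideanSpace ℝ (Fin p) → Z → ℝ) (γ a B₀ μ : ℝ)
    (θinit : EuclideanSpace ℝ (Fin p)) (z : ℕ → Z) (ξ : ℕ → EuclideanSpace ℝ (Fin p)) :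
    ℕ → EuclideanSpace ℝ (Fin p)
  | 0 => θinit
  | i + 1 => iterate ρ γ a B₀ μ θinit z ξ i - (γ * ((i + 1 : ℕ) : ℝ) ^ (-a)) •
      (Psi ρ (iterate ρ γ a B₀ μ θinit z ξ i) (z i) + (2 * B₀ / μ) • ξ i)

/-- `Â_n`, computed from the first `n` observations. -/
def Ahat (ρ : EuclideanSpace ℝ (Fin p) → Z → ℝ) (γ a B₀ B₁ μ : ℝ)
    (θinit : EuclideanSpace ℝ (Fin p)) (n : ℕ) (z : ℕ → Z) (ξ : ℕ → EuclideanSpace ℝ (Fin p))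
    (M₁ : Matrix (Fin p) (Fin p) ℝ) : Matrix (Fin p) (Fin p) ℝ :=
  (1 / (n : ℝ)) • ∑ i ∈ Finset.range n, hessRho ρ (iterate ρ γ a B₀ μ θinit z ξ i) (z i) +
    (2 * B₁ / (n * μ)) • M₁

/-- `Ŝ_n`, computed from the first `n` observations. -/
def Shat (ρ : EuclideanSpace ℝ (Fin p) → Z → ℝ) (γ a B₀ μ : ℝ)
    (θinit : EuclideanSpace ℝ (Fin p)) (n : ℕ) (z : ℕ → Z) (ξ : ℕ → EuclideanSpace ℝ (Fin p))
    (M₂ : Matrix (Fin p) (Fin p) ℝ) : Matrix (Fin p) (Fin p) ℝ :=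
  (1 / (n : ℝ)) • ∑ i ∈ Finset.range n,
      outer (Psi ρ (iterate ρ γ a B₀ μ θinit z ξ i) (z i)) +
    (4 * B₀ ^ 2 / μ ^ 2) • (1 : Matrix (Fin p) (Fin p) ℝ) + (2 * B₀ ^ 2 / (n * μ)) • M₂

/-- The private sandwich estimator `Σ̂_n = Â*⁻¹ Ŝ* Â*⁻¹`. -/
def sigmaHat (ρ : EuclideanSpace ℝ (Fin p) → Z → ℝ) (γ a B₀ B₁ μ κ₁ κ₂ : ℝ)
    (θinit : EuclideanSpace ℝ (Fin p)) (n : ℕ) (z : ℕ → Z) (ξ : ℕ → EuclideanSpace ℝ (Fin p))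
    (M₁ M₂ : Matrix (Fin p) (Fin p) ℝ) : Matrix (Fin p) (Fin p) ℝ :=
  (truncate κ₁ (Ahat ρ γ a B₀ B₁ μ θinit n z ξ M₁))⁻¹ *
    truncate κ₂ (Shat ρ γ a B₀ μ θinit n z ξ M₂) *
    (truncate κ₁ (Ahat ρ γ a B₀ B₁ μ θinit n z ξ M₁))⁻¹

end Algorithm

/-! ### Randomness -/

section Randomness

variable {p : ℕ} {Z Ω : Type*} [MeasurableSpace Z] [MeasurableSpace Ω]

/-- The product σ-algebra on matrices. -/
instance matrixMeasurableSpace : MeasurableSpace (Matrix (Fin p) (Fin p) ℝ) :=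
  inferInstanceAs (MeasurableSpace (Fin p → Fin p → ℝ))

/-- A symmetric random matrix whose upper-triangular entries, including the diagonal, are
i.i.d. standard normal. -/
structure IsSymmGaussian (M : Ω → Matrix (Fin p) (Fin p) ℝ) (Q : Measure Ω) : Prop where
  measurable : Measurable M
  symm : ∀ ω, (M ω).IsSymm
  law : ∀ i j, i ≤ j → Q.map (fun ω => M ω i j) = gaussianReal 0 1
  indep : iIndepFun
    (fun (ij : {ij : Fin p × Fin p // ij.1 ≤ ij.2}) ω => M ω ij.1.1 ij.1.2) Q

/-- The observations are i.i.d. with law `P`, the `ξ i` are i.i.d. standard Gaussian vectors, `M₁`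
and `M₂` are symmetric Gaussian matrices, and all of these are jointly independent. -/
structure IsSampling (P : Measure Z) (Q : Measure Ω) (z : ℕ → Ω → Z)
    (ξ : ℕ → Ω → EuclideanSpace ℝ (Fin p)) (M₁ M₂ : Ω → Matrix (Fin p) (Fin p) ℝ) : Prop where
  z_measurable : ∀ i, Measurable (z i)
  z_law : ∀ i, Q.map (z i) = P
  z_indep : iIndepFun z Q
  ξ_measurable : ∀ i, Measurable (ξ i)
  ξ_law : ∀ i, Q.map (ξ i) = stdGaussian (EuclideanSpace ℝ (Fin p))
  ξ_indep : iIndepFun ξ Q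
  M₁_gaussian : IsSymmGaussian M₁ Q
  M₂_gaussian : IsSymmGaussian M₂ Q
  indep_data : IndepFun (fun ω i => z i ω) (fun ω => ((fun i => ξ i ω), M₁ ω, M₂ ω)) Q
  indep_noise : IndepFun (fun ω i => ξ i ω) (fun ω => (M₁ ω, M₂ ω)) Q
  indep_matrices : IndepFun M₁ M₂ Q

/-- The σ-algebra of the first `n` steps, generated by `z i` and `ξ i` for `i < n`. -/
abbrev past (z : ℕ → Ω → Z) (ξ : ℕ → Ω → EuclideanSpace ℝ (Fin p)) (n : ℕ) : MeasurableSpace Ω :=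
  ⨆ i : Fin n, (MeasurableSpace.comap (z i) inferInstance ⊔
    MeasurableSpace.comap (ξ i) inferInstance)

/-- The gradient noise `∇L(θ̂_n) - Ψ(θ̂_n, z_n)` of the step that follows the iterate `θ̂_n`. -/
def gradNoise (ρ : EuclideanSpace ℝ (Fin p) → Z → ℝ) (P : Measure Z) (γ a B₀ μ : ℝ)
    (θinit : EuclideanSpace ℝ (Fin p)) (z : ℕ → Ω → Z)
    (ξ : ℕ → Ω → EuclideanSpace ℝ (Fin p)) (n : ℕ) (ω : Ω) : EuclideanSpace ℝ (Fin p) :=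
  gradient (popLoss ρ P) (iterate ρ γ a B₀ μ θinit (fun i => z i ω) (fun i => ξ i ω) n) -
    Psi ρ (iterate ρ γ a B₀ μ θinit (fun i => z i ω) (fun i => ξ i ω) n) (z n ω)

/-- The conditional covariance matrix of a random vector. -/
def condCov (Q : Measure Ω) (m : MeasurableSpace Ω) (η : Ω → EuclideanSpace ℝ (Fin p)) (ω : Ω) :
    Matrix (Fin p) (Fin p) ℝ :=
  Matrix.of fun i j => (Q[fun ω' => outer (η ω') i j | m]) ω

/-- Conditional covariance expansion and fourth moment bound of the gradient noise. -/
structure GradNoiseCondition (ρ : EuclideanSpace ℝ (Fin p) → Z → ℝ) (P : Measure Z)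
    (θ₀ : EuclideanSpace ℝ (Fin p)) (γ a B₀ μ : ℝ) (θinit : EuclideanSpace ℝ (Fin p))
    (Q : Measure Ω) (z : ℕ → Ω → Z) (ξ : ℕ → Ω → EuclideanSpace ℝ (Fin p))
    (C₁ C₂ : ℝ) : Prop where
  cov : ∀ n, ∀ᵐ ω ∂Q,
    ‖condCov Q (past z ξ n) (gradNoise ρ P γ a B₀ μ θinit z ξ n) ω - matS ρ P θ₀‖ ≤
      C₁ * (‖iterate ρ γ a B₀ μ θinit (fun i => z i ω) (fun i => ξ i ω) n - θ₀‖ +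
        ‖iterate ρ γ a B₀ μ θinit (fun i => z i ω) (fun i => ξ i ω) n - θ₀‖ ^ 2)
  trace : ∀ n, ∀ᵐ ω ∂Q,
    |(condCov Q (past z ξ n) (gradNoise ρ P γ a B₀ μ θinit z ξ n) ω - matS ρ P θ₀).trace| ≤
      C₁ * (‖iterate ρ γ a B₀ μ θinit (fun i => z i ω) (fun i => ξ i ω) n - θ₀‖ +
        ‖iterate ρ γ a B₀ μ θinit (fun i => z i ω) (fun i => ξ i ω) n - θ₀‖ ^ 2)
  fourth : ∀ n, ∀ᵐ ω ∂Q,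
    (Q[fun ω' => ‖gradNoise ρ P γ a B₀ μ θinit z ξ n ω'‖ ^ 4 | past z ξ n]) ω ≤
      C₂ * (1 + ‖iterate ρ γ a B₀ μ θinit (fun i => z i ω) (fun i => ξ i ω) n - θ₀‖ ^ 4)

end Randomness

end PrivateSGD

end

noncomputable section

namespace PrivateSGD

/-! ### Matrices -/

section MatrixLemmas

variable {p : ℕ}

/-! The two claims have separate proofs.

Privacy is a single coupling. If two data sets differ in entry `k` only, the difference enters the
gradient step `k` and one summand each of `Â` and `Ŝ`. Shifting `ξ k`, `M₁` and `M₂` by suitably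
rescaled differences reproduces the same iterates and the same output
(`sigmaHat_eq_sigmaHat_shift`). Each shift has Euclidean length at most `μ`, matrices being measured
on their independent upper-triangular entries, so the joint shift has length at most `√3 μ`. It
depends only on the noises before step `k`, which are independent of the Gaussian vector being
shifted. Given these noises the problem is a Gaussian location problem. One scalar observation from
`N(0,1)` or `N(t,1)`, with extra randomness, simulates both of its sides (`map_gaussianSimulation`),
and averaging over the other noises gives `tradeoff_gaussianReal_le`. No composition theorem is
needed.

The rate starts from the drift of the recursion. The Hessians of the loss are positive semidefinite
and `A ≥ κ₁ > 0`, so `⟨∇L(θ₀ + v), v⟩ ≥ c ‖v‖ min(‖v‖, 1)` (`exists_drift`): quadratic near the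
minimizer, but only linear far away, because the gradients are bounded. The function `‖v‖²` would
not contract under so weak a drift at infinity; `V(v) = exp √(1 + ‖v‖²)` does, by `lyapunov_sub_le`,
and the Gaussian noise has the exponential moments that `V` requires. With `w n` the mean of `V - e`
at the iterate `n`, one step of size `η` gives `w (n+1) ≤ w n - c' η w n + b η² (w n + 1)`, hence `w
n = O(n^{-a})` (`exists_le_rpow_of_recursion`). As `‖v‖² ≤ V(v) - e`, the mean error of the iterates
is `O(n^{-a/2})`.

The averages in `Â` and `Ŝ` differ from `A` and `S̃` by the averaged error of the iterates, a
law-of-large-numbers error `O(n^{-1/2})` at `θ₀`, and matrix noise `O(n^{-1})`; the first rate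
dominates. The truncated sandwich is Lipschitz in its two arguments (`norm_sandwich_sub_le`), so
`Σ̂` inherits the rate. The prefactor in the theorem is positive and free of `n`, so the constant
absorbs it. -/

instance matrixBorelSpace : BorelSpace (Matrix (Fin p) (Fin p) ℝ) :=
  inferInstanceAs (BorelSpace (Fin p → Fin p → ℝ))

lemma measurable_matrix_iff {α : Type*} [MeasurableSpace α]
    {f : α → Matrix (Fin p) (Fin p) ℝ} :
    Measurable f ↔ ∀ i j, Measurable fun x => f x i j := by
  refine ⟨fun h i j => (measurable_pi_apply j).comp ((measurable_pi_apply i).comp h), fun h => ?_⟩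
  exact measurable_pi_lambda _ fun i => measurable_pi_lambda _ fun j => h i j

lemma norm_le_of_forall_mulVec {M : Matrix (Fin p) (Fin p) ℝ} {c : ℝ} (hc : 0 ≤ c)
    (h : ∀ x : EuclideanSpace ℝ (Fin p), ‖WithLp.toLp 2 (M *ᵥ x.ofLp)‖ ≤ c * ‖x‖) :
    ‖M‖ ≤ c := by
  rw [Matrix.l2_opNorm_def]
  exact ContinuousLinearMap.opNorm_le_bound _ hc h

lemma norm_toLp_mulVec_le (M : Matrix (Fin p) (Fin p) ℝ) (x : EuclideanSpace ℝ (Fin p)) :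
    ‖(WithLp.toLp 2 (M *ᵥ x.ofLp) : EuclideanSpace ℝ (Fin p))‖ ≤ ‖M‖ * ‖x‖ :=
  Matrix.l2_opNorm_mulVec M x

lemma outer_mulVec (v x : EuclideanSpace ℝ (Fin p)) :
    WithLp.toLp 2 (outer v *ᵥ x.ofLp) = (inner ℝ v x) • v := by
  ext i
  simp only [outer, Matrix.mulVec, dotProduct, Matrix.of_apply, PiLp.smul_apply, smul_eq_mul,
    PiLp.inner_apply, RCLike.inner_apply, conj_trivial, Finset.sum_mul]
  exact Finset.sum_congr rfl fun j _ => by ring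

lemma norm_outer_le (v : EuclideanSpace ℝ (Fin p)) : ‖outer v‖ ≤ ‖v‖ ^ 2 := by
  refine norm_le_of_forall_mulVec (by positivity) fun x => ?_
  rw [outer_mulVec, norm_smul]
  calc _ ≤ (‖v‖ * ‖x‖) * ‖v‖ := by gcongr; exact norm_inner_le_norm v x
    _ = _ := by ring

lemma norm_outer_sub_outer_le (u v : EuclideanSpace ℝ (Fin p)) :
    ‖outer u - outer v‖ ≤ (‖u‖ + ‖v‖) * ‖u - v‖ := by
  refine norm_le_of_forall_mulVec (by positivity) fun x => ?_
  rw [Matrix.sub_mulVec, WithLp.toLp_sub, outer_mulVec, outer_mulVec]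
  have : inner ℝ u x • u - inner ℝ v x • v = inner ℝ u x • (u - v) + inner ℝ (u - v) x • v := by
    rw [inner_sub_left]; module
  rw [this]
  refine (norm_add_le _ _).trans ?_
  rw [norm_smul, norm_smul]
  calc _ ≤ (‖u‖ * ‖x‖) * ‖u - v‖ + (‖u - v‖ * ‖x‖) * ‖v‖ := by
        gcongr <;> exact norm_inner_le_norm _ _
    _ = _ := by ring

lemma outer_isSymm (v : EuclideanSpace ℝ (Fin p)) : (outer v).IsSymm := by
  ext i j; simp [outer, mul_comm]

lemma isHermitian_iff_isSymm {M : Matrix (Fin p) (Fin p) ℝ} : M.IsHermitian ↔ M.IsSymm := by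
  rw [Matrix.IsHermitian, Matrix.conjTranspose_eq_transpose_of_trivial, Matrix.IsSymm]

lemma measurableSet_isHermitian :
    MeasurableSet {M : Matrix (Fin p) (Fin p) ℝ | M.IsHermitian} :=
  (isClosed_eq (by fun_prop) continuous_id).measurableSet

/-- The squared Frobenius distance of two outer products. -/
lemma sum_sq_outer_sub_outer_le {u v : EuclideanSpace ℝ (Fin p)} {B : ℝ}
    (hu : ‖u‖ ^ 2 ≤ B) (hv : ‖v‖ ^ 2 ≤ B) :
    ∑ i, ∑ j, ((outer u - outer v) i j) ^ 2 ≤ 2 * B ^ 2 := by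
  -- In the expanded Frobenius square the cross term has a minus sign, so it can be dropped.
  have h : ∑ i, ∑ j, ((outer u - outer v) i j) ^ 2 =
      (‖u‖ ^ 2) ^ 2 + (‖v‖ ^ 2) ^ 2 - 2 * (inner ℝ u v) ^ 2 := by
    rw [EuclideanSpace.real_norm_sq_eq, EuclideanSpace.real_norm_sq_eq, PiLp.inner_apply]
    rw [sq (∑ i, _), sq (∑ i, _), sq (∑ i, _), Finset.sum_mul_sum, Finset.sum_mul_sum,
      Finset.sum_mul_sum]
    simp only [Finset.mul_sum, ← Finset.sum_add_distrib, ← Finset.sum_sub_distrib, outer, Matrix.sub_apply, Matrix.of_apply, RCLike.inner_apply,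
      conj_trivial]
    exact Finset.sum_congr rfl fun i _ => Finset.sum_congr rfl fun j _ => by ring
  rw [h]
  nlinarith [sq_nonneg (inner ℝ u v), sq_nonneg ‖u‖, sq_nonneg ‖v‖]

/-- A crude bound, harmless because the dimension is fixed: it reduces integrability and laws of
large numbers for matrices to their scalar entries. -/
lemma norm_le_sum_abs (M : Matrix (Fin p) (Fin p) ℝ) : ‖M‖ ≤ ∑ i, ∑ j, |M i j| := by
  refine norm_le_of_forall_mulVec (by positivity) fun x => ?_
  rw [EuclideanSpace.norm_eq]
  refine (Real.sqrt_le_sqrt (Finset.sum_sq_le_sq_sum_of_nonneg (fun i _ => norm_nonneg _))).trans ?_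
  rw [Real.sqrt_sq (by positivity), Finset.sum_mul]
  refine Finset.sum_le_sum fun i _ => ?_
  simp only [Matrix.mulVec, dotProduct]
  refine (norm_sum_le _ _).trans ?_
  rw [Finset.sum_mul]
  refine Finset.sum_le_sum fun j _ => ?_
  rw [norm_mul, Real.norm_eq_abs]
  gcongr
  exact PiLp.norm_apply_le x j

lemma abs_dotProduct_mulVec_le (M : Matrix (Fin p) (Fin p) ℝ) (v : EuclideanSpace ℝ (Fin p)) :
    |v.ofLp ⬝ᵥ M *ᵥ v.ofLp| ≤ ‖M‖ * ‖v‖ ^ 2 := by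
  have h : v.ofLp ⬝ᵥ M *ᵥ v.ofLp =
      inner ℝ (WithLp.toLp 2 (M *ᵥ v.ofLp) : EuclideanSpace ℝ (Fin p)) v := by
    simp [PiLp.inner_apply, dotProduct]
  rw [h]
  refine (abs_real_inner_le_norm _ _).trans ?_
  calc _ ≤ (‖M‖ * ‖v‖) * ‖v‖ := by gcongr; exact norm_toLp_mulVec_le M v
    _ = _ := by ring

lemma spectrum_ge_of_le_lambdaMin {M : Matrix (Fin p) (Fin p) ℝ} {κ : ℝ}
    (h : κ ≤ lambdaMin M) : ∀ d ∈ spectrum ℝ M, κ ≤ d := fun _ hd =>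
  h.trans (csInf_le (spectrum.isCompact M).bddBelow hd)

open scoped MatrixOrder in
lemma mul_norm_sq_le_dotProduct_mulVec {M : Matrix (Fin p) (Fin p) ℝ} (hM : M.IsHermitian) {κ : ℝ}
    (h : ∀ d ∈ spectrum ℝ M, κ ≤ d) (v : EuclideanSpace ℝ (Fin p)) :
    κ * ‖v‖ ^ 2 ≤ v.ofLp ⬝ᵥ M *ᵥ v.ofLp := by
  have h1 : algebraMap ℝ _ κ ≤ M := (algebraMap_le_iff_le_spectrum hM.isSelfAdjoint).2 h
  have h2 := (Matrix.le_iff.1 h1).dotProduct_mulVec_nonneg v.ofLp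
  rw [Matrix.sub_mulVec, dotProduct_sub, Algebra.algebraMap_eq_smul_one, Matrix.smul_mulVec,
    Matrix.one_mulVec, dotProduct_smul, star_trivial] at h2
  rw [EuclideanSpace.real_norm_sq_eq]
  simp only [dotProduct, smul_eq_mul, ← sq] at h2 ⊢
  linarith

/-- Weyl's inequality at the lower end of the spectrum, by evaluating both quadratic forms at a unit
eigenvector of `M`. -/
lemma spectrum_ge_of_norm_sub_le {M N : Matrix (Fin p) (Fin p) ℝ} (hM : M.IsHermitian)
    (hN : N.IsHermitian) {κ : ℝ} (h : ∀ d ∈ spectrum ℝ N, κ ≤ d) :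
    ∀ d ∈ spectrum ℝ M, κ - ‖M - N‖ ≤ d := by
  intro d hd
  rw [hM.spectrum_real_eq_range_eigenvalues] at hd
  obtain ⟨i, rfl⟩ := hd
  set v := hM.eigenvectorBasis i
  have hv : ‖v‖ = 1 := hM.eigenvectorBasis.norm_eq_one i
  have h1 := mul_norm_sq_le_dotProduct_mulVec hN h v
  have h2 := abs_dotProduct_mulVec_le (M - N) v
  rw [hv, one_pow, mul_one, Matrix.sub_mulVec, dotProduct_sub] at h2
  rw [hv, one_pow, mul_one] at h1
  have h3 : hM.eigenvalues i = v.ofLp ⬝ᵥ M *ᵥ v.ofLp := by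
    rw [hM.eigenvalues_eq, star_trivial]; rfl
  rw [h3]
  linarith [neg_abs_le (v.ofLp ⬝ᵥ M *ᵥ v.ofLp - v.ofLp ⬝ᵥ N *ᵥ v.ofLp)]

/-! ### Eigenvalue truncation -/

/-- The continuous functional calculus supplies continuity in the matrix, multiplicativity and norm
bounds without tracking eigenvectors. -/
lemma truncate_eq_cfc (κ : ℝ) {M : Matrix (Fin p) (Fin p) ℝ} (hM : M.IsHermitian) :
    truncate κ M = cfc (fun x => max κ x) M := by
  rw [hM.cfc_eq, truncate, dif_pos hM, Matrix.IsHermitian.cfc]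
  rfl

/-- Truncation is continuous on the closed set of symmetric matrices and zero off it; it need not be
continuous overall. -/
lemma measurable_truncate (κ : ℝ) : Measurable (truncate κ (p := p)) := by
  classical
  set H := {M : Matrix (Fin p) (Fin p) ℝ | M.IsHermitian}
  have hc : ContinuousOn (truncate κ) H := by
    intro M hM
    -- Continuity of the functional calculus needs one compact set containing the spectra of all
    -- nearby matrices. The factor `‖1‖` is kept because it is not `1` when `p = 0`.
    have h := ContinuousWithinAt.cfc (s := Set.Icc (-(‖M‖ + 1) * ‖(1 : Matrix (Fin p) (Fin p) ℝ)‖)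
      ((‖M‖ + 1) * ‖(1 : Matrix (Fin p) (Fin p) ℝ)‖)) isCompact_Icc (fun x => max κ x)
      (a := id) (t := H) (x₀ := M) hM continuousWithinAt_id ?_
      (Filter.eventually_of_mem self_mem_nhdsWithin fun N hN => hN) (by fun_prop)
    · exact h.congr (fun N hN => truncate_eq_cfc κ hN) (truncate_eq_cfc κ hM)
    · have : ∀ᶠ N in 𝓝[H] M, ‖N‖ < ‖M‖ + 1 :=
        nhdsWithin_le_nhds (continuous_norm.continuousAt.eventually_lt continuousAt_const (by simp))
      filter_upwards [this] with N hN d hd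
      have := spectrum.norm_le_norm_mul_of_mem hd
      rw [Real.norm_eq_abs, abs_le] at this
      have h1 : ‖N‖ * ‖(1 : Matrix (Fin p) (Fin p) ℝ)‖ ≤
        (‖M‖ + 1) * ‖(1 : Matrix (Fin p) (Fin p) ℝ)‖ := by gcongr
      simp only [id] at this
      constructor <;> linarith
  have h0 : Set.EqOn (truncate κ) 0 Hᶜ := fun M hM => dif_neg hM
  have : truncate κ = H.piecewise (truncate κ (p := p)) 0 := by
    ext1 M
    by_cases hM : M ∈ H
    · rw [Set.piecewise_eq_of_mem _ _ _ hM]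
    · rw [Set.piecewise_eq_of_notMem _ _ _ hM]; exact h0 hM
  rw [this]
  exact (hc.measurable_piecewise continuousOn_const measurableSet_isHermitian)

/-- The spectrum of `M` lies above `κ - ‖M - N‖`, so truncation moves each eigenvalue by at most `‖M
- N‖`; the triangle inequality doubles this. -/
lemma norm_truncate_sub_le {M N : Matrix (Fin p) (Fin p) ℝ} (hM : M.IsHermitian)
    (hN : N.IsHermitian) {κ : ℝ} (h : ∀ d ∈ spectrum ℝ N, κ ≤ d) :
    ‖truncate κ M - N‖ ≤ 2 * ‖M - N‖ := by
  have h1 : ‖truncate κ M - M‖ ≤ ‖M - N‖ := by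
    have : truncate κ M - M = cfc (fun x => max κ x - x) M := by
      rw [cfc_sub (fun x => max κ x) (fun x => x) M (by fun_prop) (by fun_prop),
        cfc_id' ℝ M hM.isSelfAdjoint, truncate_eq_cfc κ hM]
    rw [this]
    refine norm_cfc_le (norm_nonneg _) fun d hd => ?_
    have := spectrum_ge_of_norm_sub_le hM hN h d hd
    rw [Real.norm_eq_abs, abs_of_nonneg (by simp), sub_le_iff_le_add]
    exact max_le (by linarith) (by linarith [norm_nonneg (M - N)])
  calc ‖truncate κ M - N‖ = ‖(truncate κ M - M) + (M - N)‖ := by rw [sub_add_sub_cancel]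
    _ ≤ _ := (norm_add_le _ _).trans (by linarith)

lemma truncate_eq_self {M : Matrix (Fin p) (Fin p) ℝ} (hM : M.IsHermitian) {κ : ℝ}
    (h : ∀ d ∈ spectrum ℝ M, κ ≤ d) : truncate κ M = M := by
  have := norm_truncate_sub_le hM hM h
  simpa [sub_eq_zero] using this

/-- The inverse is the functional calculus of `1 / max κ x`, a function bounded by `κ⁻¹`. -/
lemma truncate_inv {M : Matrix (Fin p) (Fin p) ℝ} (hM : M.IsHermitian) {κ : ℝ} (hκ : 0 < κ) :
    truncate κ M * (truncate κ M)⁻¹ = 1 ∧ ‖(truncate κ M)⁻¹‖ ≤ κ⁻¹ := by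
  have hpos : ∀ x : ℝ, 0 < max κ x := fun x => lt_max_of_lt_left hκ
  have hc : Continuous fun x : ℝ => (max κ x)⁻¹ :=
    (continuous_const.max continuous_id).inv₀ fun x => (hpos x).ne'
  have h1 : truncate κ M * cfc (fun x => (max κ x)⁻¹) M = 1 := by
    rw [truncate_eq_cfc κ hM, ← cfc_mul _ _ M (by fun_prop) hc.continuousOn]
    simp only [mul_inv_cancel₀ (hpos _).ne']
    exact cfc_const_one ℝ M hM.isSelfAdjoint
  rw [Matrix.inv_eq_right_inv h1]
  refine ⟨h1, norm_cfc_le (by positivity) fun d _ => ?_⟩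
  rw [Real.norm_eq_abs, abs_of_pos (inv_pos.2 (hpos d))]
  exact inv_anti₀ hκ (le_max_left _ _)

/-- The truncated sandwich depends on its two arguments in a Lipschitz way. -/
lemma norm_sandwich_sub_le {A S M N : Matrix (Fin p) (Fin p) ℝ} (hA : A.IsHermitian)
    (hS : S.IsHermitian) (hM : M.IsHermitian) (hN : N.IsHermitian) {κ₁ κ₂ : ℝ} (hκ₁ : 0 < κ₁)
    (h₁ : ∀ d ∈ spectrum ℝ A, κ₁ ≤ d) (h₂ : ∀ d ∈ spectrum ℝ S, κ₂ ≤ d) :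
    ‖(truncate κ₁ M)⁻¹ * truncate κ₂ N * (truncate κ₁ M)⁻¹ - A⁻¹ * S * A⁻¹‖ ≤
      (4 * κ₁⁻¹ ^ 3 * ‖S‖) * ‖M - A‖ + (2 * κ₁⁻¹ ^ 2) * ‖N - S‖ := by
  obtain ⟨hM1, hM2⟩ := truncate_inv hM hκ₁
  obtain ⟨hA1, hA2⟩ := truncate_inv hA hκ₁
  rw [truncate_eq_self hA h₁] at hA1 hA2
  have hd₁ := norm_truncate_sub_le hM hA h₁
  have hd₂ := norm_truncate_sub_le hN hS h₂
  set T := truncate κ₁ M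
  set U := truncate κ₂ N
  have hM1' : T⁻¹ * T = 1 := mul_eq_one_comm.1 hM1
  -- Resolvent identity, which makes inversion Lipschitz where both inverses are bounded by `κ₁⁻¹`.
  have e1 : T⁻¹ - A⁻¹ = -(T⁻¹ * (T - A) * A⁻¹) := by
    rw [mul_sub, sub_mul, hM1', mul_assoc, hA1, one_mul, mul_one, neg_sub]
  have hi : 0 < κ₁⁻¹ := inv_pos.2 hκ₁
  have e2 : ‖T⁻¹ - A⁻¹‖ ≤ κ₁⁻¹ * (2 * ‖M - A‖) * κ₁⁻¹ := by
    rw [e1, norm_neg]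
    refine (norm_mul_le _ _).trans ?_
    gcongr
    exact (norm_mul_le _ _).trans (by gcongr)
  have e3 : T⁻¹ * U * T⁻¹ - A⁻¹ * S * A⁻¹ =
      T⁻¹ * (U - S) * T⁻¹ + ((T⁻¹ - A⁻¹) * S * T⁻¹ + A⁻¹ * S * (T⁻¹ - A⁻¹)) := by
    noncomm_ring
  rw [e3]
  have f1 : ‖T⁻¹ * (U - S) * T⁻¹‖ ≤ κ₁⁻¹ * (2 * ‖N - S‖) * κ₁⁻¹ :=
    (norm_mul_le _ _).trans (by gcongr; exact (norm_mul_le _ _).trans (by gcongr))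
  have f2 : ‖(T⁻¹ - A⁻¹) * S * T⁻¹‖ ≤ κ₁⁻¹ * (2 * ‖M - A‖) * κ₁⁻¹ * ‖S‖ * κ₁⁻¹ :=
    (norm_mul_le _ _).trans (by gcongr; exact (norm_mul_le _ _).trans (by gcongr))
  have f3 : ‖A⁻¹ * S * (T⁻¹ - A⁻¹)‖ ≤ κ₁⁻¹ * ‖S‖ * (κ₁⁻¹ * (2 * ‖M - A‖) * κ₁⁻¹) :=
    (norm_mul_le _ _).trans (by gcongr; exact (norm_mul_le _ _).trans (by gcongr))
  refine (norm_add_le _ _).trans ((add_le_add f1 ((norm_add_le _ _).trans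
    (add_le_add f2 f3))).trans (le_of_eq ?_))
  ring

lemma measurable_matrix_inv : Measurable fun M : Matrix (Fin p) (Fin p) ℝ => M⁻¹ := by
  simp only [Matrix.inv_def, Ring.inverse_eq_inv']
  have hd : Measurable fun M : Matrix (Fin p) (Fin p) ℝ => M.det :=
    (continuous_id.matrix_det).measurable
  have ha : Measurable fun M : Matrix (Fin p) (Fin p) ℝ => M.adjugate :=
    (continuous_id.matrix_adjugate).measurable
  exact hd.inv.smul ha

end MatrixLemmas

/-! ### Calculus of the loss -/

section Calculus

variable {p : ℕ} {Z : Type*} {ρ : EuclideanSpace ℝ (Fin p) → Z → ℝ}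

lemma toEuclideanCLM_apply (M : Matrix (Fin p) (Fin p) ℝ) (v : EuclideanSpace ℝ (Fin p)) :
    Matrix.toEuclideanCLM (𝕜 := ℝ) M v = WithLp.toLp 2 (M *ᵥ v.ofLp) := rfl

/-- Linearity in coordinates. No differentiability is needed, since `hessRho` is itself defined from
this `fderiv`. -/
lemma hessRho_mulVec {θ : EuclideanSpace ℝ (Fin p)} {x : Z} (v : EuclideanSpace ℝ (Fin p)) :
    fderiv ℝ (fun t => Psi ρ t x) θ v = WithLp.toLp 2 (hessRho ρ θ x *ᵥ v.ofLp) := by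
  ext i
  conv_lhs => rw [← (EuclideanSpace.basisFun (Fin p) ℝ).sum_repr v]
  simp only [map_sum, map_smul, EuclideanSpace.basisFun_repr, EuclideanSpace.basisFun_apply,
    PiLp.smul_apply, WithLp.ofLp_sum, Finset.sum_apply, smul_eq_mul, hessRho, hessian,
    Matrix.mulVec, dotProduct, Matrix.of_apply, Psi]
  exact Finset.sum_congr rfl fun j _ => mul_comm _ _

lemma norm_hessRho_le {B₁ : ℝ} (hfactor : HessianFactorizes ρ B₁)
    (θ : EuclideanSpace ℝ (Fin p)) (x : Z) : ‖hessRho ρ θ x‖ ≤ B₁ := by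
  obtain ⟨m, hm⟩ := hfactor
  rw [(hm θ x).1]
  exact (norm_outer_le _).trans (hm θ x).2

lemma norm_fderiv_Psi_le {B₁ : ℝ} (hfactor : HessianFactorizes ρ B₁)
    (θ : EuclideanSpace ℝ (Fin p)) (x : Z) : ‖fderiv ℝ (fun t => Psi ρ t x) θ‖ ≤ B₁ := by
  have h := norm_hessRho_le hfactor θ x
  refine ContinuousLinearMap.opNorm_le_bound _ ((norm_nonneg _).trans h) fun v => ?_
  rw [hessRho_mulVec]
  exact (norm_toLp_mulVec_le _ _).trans (by gcongr)

lemma isSymm_hessRho {B₁ : ℝ} (hfactor : HessianFactorizes ρ B₁)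
    (θ : EuclideanSpace ℝ (Fin p)) (x : Z) : (hessRho ρ θ x).IsSymm := by
  obtain ⟨m, hm⟩ := hfactor
  rw [(hm θ x).1]
  exact outer_isSymm _

lemma inner_fderiv_Psi_nonneg {B₁ : ℝ} (hfactor : HessianFactorizes ρ B₁)
    (θ v : EuclideanSpace ℝ (Fin p)) (x : Z) :
    0 ≤ inner ℝ (fderiv ℝ (fun t => Psi ρ t x) θ v) v := by
  obtain ⟨m, hm⟩ := hfactor
  rw [hessRho_mulVec, (hm θ x).1, outer_mulVec, real_inner_smul_left]
  exact mul_self_nonneg _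

variable [MeasurableSpace Z] {P : Measure Z} {θ₀ : EuclideanSpace ℝ (Fin p)}

lemma norm_Psi_sub_le (hproblem : IsProblem ρ P θ₀) {B₁ : ℝ} (hfactor : HessianFactorizes ρ B₁)
    (θ θ' : EuclideanSpace ℝ (Fin p)) (x : Z) :
    ‖Psi ρ θ x - Psi ρ θ' x‖ ≤ B₁ * ‖θ - θ'‖ :=
  Convex.norm_image_sub_le_of_norm_fderiv_le (𝕜 := ℝ) (f := fun t => Psi ρ t x)
    (fun t _ => hproblem.differentiable_grad x t) (fun t _ => norm_fderiv_Psi_le hfactor t x)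
    convex_univ (Set.mem_univ _) (Set.mem_univ _)

/-- The gradient of the loss is monotone along rays, since the Hessian is positive. -/
lemma monotone_inner_Psi (hproblem : IsProblem ρ P θ₀) {B₁ : ℝ}
    (hfactor : HessianFactorizes ρ B₁) (θ v : EuclideanSpace ℝ (Fin p)) (x : Z) :
    Monotone fun t : ℝ => inner ℝ (Psi ρ (θ + t • v) x) v := by
  have hd : ∀ t : ℝ, HasDerivAt (fun t : ℝ => inner ℝ (Psi ρ (θ + t • v) x) v)
      (inner ℝ (fderiv ℝ (fun t => Psi ρ t x) (θ + t • v) v) v) t := by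
    intro t
    have h1 : HasDerivAt (fun t : ℝ => θ + t • v) v t := by
      simpa using ((hasDerivAt_id t).smul_const v).const_add θ
    have h2 := (hproblem.differentiable_grad x (θ + t • v)).hasFDerivAt.comp_hasDerivAt t h1
    simpa using h2.inner ℝ (hasDerivAt_const t v)
  refine monotone_of_deriv_nonneg (fun t => (hd t).differentiableAt) fun t => ?_
  rw [(hd t).deriv]
  exact inner_fderiv_Psi_nonneg hfactor _ _ _

lemma hasGradientAt_rho (hproblem : IsProblem ρ P θ₀) (θ : EuclideanSpace ℝ (Fin p)) (x : Z) :
    HasGradientAt (fun t => ρ t x) (Psi ρ θ x) θ :=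
  (hproblem.differentiable x θ).hasGradientAt

lemma tendsto_natCast_add_one_norm :
    Tendsto (fun n : ℕ => ‖((n : ℝ) + 1)‖) atTop atTop :=
  tendsto_norm_atTop_atTop.comp
    (tendsto_atTop_add_const_right _ 1 tendsto_natCast_atTop_atTop)

lemma measurable_euclidean_iff {α : Type*} [MeasurableSpace α]
    {f : α → EuclideanSpace ℝ (Fin p)} : Measurable f ↔ ∀ i, Measurable fun x => f x i := by
  refine ⟨fun h i => (measurable_pi_apply i).comp ((WithLp.measurable_ofLp 2 _).comp h),
    fun h => ?_⟩
  exact (WithLp.measurable_toLp 2 _).comp (measurable_pi_lambda _ h)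

/-- Each partial derivative is a pointwise limit of difference quotients of functions measurable in
`z`. -/
lemma measurable_Psi (hproblem : IsProblem ρ P θ₀) (θ : EuclideanSpace ℝ (Fin p)) :
    Measurable (Psi ρ θ) := by
  refine measurable_euclidean_iff.2 fun i => ?_
  refine measurable_of_tendsto_metrizable (f := fun (n : ℕ) x => ((n : ℝ) + 1) •
    (ρ (θ + ((n : ℝ) + 1)⁻¹ • EuclideanSpace.single i 1) x - ρ θ x))
    (fun n => ?_) ?_
  · have h1 := hproblem.measurable (θ + ((n : ℝ) + 1)⁻¹ • EuclideanSpace.single i 1)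
    have h2 := hproblem.measurable θ
    fun_prop
  refine tendsto_pi_nhds.2 fun x => ?_
  have h := (hasGradientAt_rho hproblem θ x).hasFDerivAt.lim
    (EuclideanSpace.single i 1) tendsto_natCast_add_one_norm
  simpa [InnerProductSpace.toDual_apply_apply, EuclideanSpace.inner_single_right] using h

lemma measurable_uncurry_Psi (hproblem : IsProblem ρ P θ₀) :
    Measurable fun q : EuclideanSpace ℝ (Fin p) × Z => Psi ρ q.1 q.2 :=
  measurable_uncurry_of_continuous_of_measurable
    (fun x => (hproblem.differentiable_grad x).continuous) (measurable_Psi hproblem)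

/-- The Hessian is not assumed continuous in `θ`, so the Carathéodory argument used for `Psi` is not
available. Difference quotients of the jointly measurable `Psi` are used instead. -/
lemma measurable_uncurry_hessRho (hproblem : IsProblem ρ P θ₀) :
    Measurable fun q : EuclideanSpace ℝ (Fin p) × Z => hessRho ρ q.1 q.2 := by
  refine measurable_matrix_iff.2 fun i j => ?_
  have hΨ := measurable_uncurry_Psi hproblem
  have h : Measurable fun q : EuclideanSpace ℝ (Fin p) × Z =>
      fderiv ℝ (fun t => Psi ρ t q.2) q.1 (EuclideanSpace.single j 1) := by
    refine measurable_of_tendsto_metrizable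
      (f := fun (n : ℕ) (q : EuclideanSpace ℝ (Fin p) × Z) => ((n : ℝ) + 1) •
      (Psi ρ (q.1 + ((n : ℝ) + 1)⁻¹ • EuclideanSpace.single j 1) q.2 - Psi ρ q.1 q.2))
      (fun n => ?_) ?_
    · have h1 : Measurable fun q : EuclideanSpace ℝ (Fin p) × Z =>
          Psi ρ (q.1 + ((n : ℝ) + 1)⁻¹ • EuclideanSpace.single j 1) q.2 :=
        Measurable.comp (g := fun q : EuclideanSpace ℝ (Fin p) × Z => Psi ρ q.1 q.2) hΨ
          (f := fun q : EuclideanSpace ℝ (Fin p) × Z => (q.1 + ((n : ℝ) + 1)⁻¹ • EuclideanSpace.single j 1, q.2))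
          (by fun_prop)
      fun_prop
    refine tendsto_pi_nhds.2 fun q => ?_
    exact (hproblem.differentiable_grad q.2 q.1).hasFDerivAt.lim _ tendsto_natCast_add_one_norm
  exact measurable_euclidean_iff.1 h i

lemma isHermitian_matS : (matS ρ P θ₀).IsHermitian := by
  rw [isHermitian_iff_isSymm]
  ext i j
  simp only [matS, Matrix.transpose_apply, Matrix.of_apply, (outer_isSymm _).apply]

lemma gradient_popLoss_eq_zero (hproblem : IsProblem ρ P θ₀) : gradient (popLoss ρ P) θ₀ = 0 := by
  have : IsLocalMin (popLoss ρ P) θ₀ := .of_forall hproblem.isMin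
  rw [gradient, this.fderiv_eq_zero, map_zero]

lemma measurable_hessRho (hproblem : IsProblem ρ P θ₀) (θ : EuclideanSpace ℝ (Fin p)) :
    Measurable fun x => hessRho ρ θ x :=
  Measurable.comp (g := fun q : EuclideanSpace ℝ (Fin p) × Z => hessRho ρ q.1 q.2)
    (measurable_uncurry_hessRho hproblem) (f := fun x => (θ, x)) measurable_prodMk_left

lemma abs_entry_le_norm (M : Matrix (Fin p) (Fin p) ℝ) (i j : Fin p) : |M i j| ≤ ‖M‖ := by
  have h := (PiLp.norm_apply_le _ i).trans (norm_toLp_mulVec_le M (EuclideanSpace.single j 1))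
  simpa using h

variable [IsProbabilityMeasure P]

lemma integrable_Psi (hproblem : IsProblem ρ P θ₀) {B₀ : ℝ} (hgrad : ∀ θ x, ‖Psi ρ θ x‖ ≤ B₀)
    (θ : EuclideanSpace ℝ (Fin p)) : Integrable (Psi ρ θ) P :=
  .of_bound (measurable_Psi hproblem θ).aestronglyMeasurable B₀ (.of_forall (hgrad θ))

/-- Differentiation under the integral, dominated by the constant `B₀`. -/
lemma gradient_popLoss (hproblem : IsProblem ρ P θ₀) {B₀ : ℝ} (hgrad : ∀ θ x, ‖Psi ρ θ x‖ ≤ B₀)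
    (θ : EuclideanSpace ℝ (Fin p)) : gradient (popLoss ρ P) θ = ∫ x, Psi ρ θ x ∂P := by
  have hm : Measurable fun x => InnerProductSpace.toDual ℝ _ (Psi ρ θ x) :=
    (InnerProductSpace.toDual ℝ _).continuous.measurable.comp (measurable_Psi hproblem θ)
  have h := hasFDerivAt_integral_of_dominated_of_fderiv_le (μ := P) (𝕜 := ℝ) (F := ρ)
    (F' := fun t x => InnerProductSpace.toDual ℝ _ (Psi ρ t x)) (x₀ := θ) (s := Set.univ)
    (bound := fun _ => B₀) univ_mem
    (.of_forall fun t => (hproblem.measurable t).aestronglyMeasurable)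
    (hproblem.integrable θ) hm.aestronglyMeasurable
    (.of_forall fun x t _ => by simpa using hgrad t x) (integrable_const _)
    (.of_forall fun x t _ => (hasGradientAt_rho hproblem t x).hasFDerivAt)
  have h2 : ∫ x, InnerProductSpace.toDual ℝ _ (Psi ρ θ x) ∂P =
      InnerProductSpace.toDual ℝ _ (∫ x, Psi ρ θ x ∂P) :=
    (InnerProductSpace.toDual ℝ (EuclideanSpace ℝ (Fin p))).toContinuousLinearEquiv.toContinuousLinearMap.integral_comp_comm
      (integrable_Psi hproblem hgrad θ)
  rw [h2] at h
  exact (hasGradientAt_iff_hasFDerivAt.2 h).gradient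

lemma inner_gradient_popLoss (hproblem : IsProblem ρ P θ₀) {B₀ : ℝ}
    (hgrad : ∀ θ x, ‖Psi ρ θ x‖ ≤ B₀) (θ v : EuclideanSpace ℝ (Fin p)) :
    inner ℝ (gradient (popLoss ρ P) θ) v = ∫ x, inner ℝ (Psi ρ θ x) v ∂P := by
  rw [gradient_popLoss hproblem hgrad, real_inner_comm,
    ← integral_inner (integrable_Psi hproblem hgrad θ) v]
  simp only [real_inner_comm]

lemma integrable_hessRho_apply (hproblem : IsProblem ρ P θ₀) {B₁ : ℝ}
    (hfactor : HessianFactorizes ρ B₁) (θ : EuclideanSpace ℝ (Fin p)) (i j : Fin p) :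
    Integrable (fun x => hessRho ρ θ x i j) P :=
  .of_bound (measurable_matrix_iff.1 (measurable_hessRho hproblem θ) i j).aestronglyMeasurable B₁
    (.of_forall fun x => (abs_entry_le_norm _ i j).trans (norm_hessRho_le hfactor θ x))

/-- The same domination one order higher, now by `B₁`. It identifies `A` with the mean Hessian. -/
lemma hasFDerivAt_gradient_popLoss (hproblem : IsProblem ρ P θ₀) {B₀ B₁ : ℝ}
    (hgrad : ∀ θ x, ‖Psi ρ θ x‖ ≤ B₀) (hfactor : HessianFactorizes ρ B₁)
    (θ : EuclideanSpace ℝ (Fin p)) :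
    HasFDerivAt (gradient (popLoss ρ P))
      (Matrix.toEuclideanCLM (𝕜 := ℝ) (Matrix.of fun i j => ∫ x, hessRho ρ θ x i j ∂P)) θ := by
  have heq : ∀ x, fderiv ℝ (fun t => Psi ρ t x) θ =
      Matrix.toEuclideanCLM (𝕜 := ℝ) (hessRho ρ θ x) := by
    intro x
    ext1 v
    rw [hessRho_mulVec]
    rfl
  have hcont : Continuous fun M : Matrix (Fin p) (Fin p) ℝ => Matrix.toEuclideanCLM (𝕜 := ℝ) M :=
    (Matrix.toEuclideanCLM (n := Fin p) (𝕜 := ℝ)).toAlgEquiv.toLinearMap.continuous_of_finiteDimensional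
  have hmeas : AEStronglyMeasurable (fun x => fderiv ℝ (fun t => Psi ρ t x) θ) P := by
    simp only [heq]
    exact (hcont.measurable.comp (measurable_hessRho hproblem θ)).aestronglyMeasurable
  have hint : Integrable (fun x => fderiv ℝ (fun t => Psi ρ t x) θ) P :=
    .of_bound hmeas B₁ (.of_forall fun x => norm_fderiv_Psi_le hfactor θ x)
  have h := hasFDerivAt_integral_of_dominated_of_fderiv_le (μ := P) (𝕜 := ℝ) (F := Psi ρ)
    (F' := fun t x => fderiv ℝ (fun t => Psi ρ t x) t) (x₀ := θ) (s := Set.univ)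
    (bound := fun _ => B₁) univ_mem
    (.of_forall fun t => (measurable_Psi hproblem t).aestronglyMeasurable)
    (integrable_Psi hproblem hgrad θ) hmeas
    (.of_forall fun x t _ => norm_fderiv_Psi_le hfactor t x) (integrable_const _)
    (.of_forall fun x t _ => (hproblem.differentiable_grad x t).hasFDerivAt)
  rw [show gradient (popLoss ρ P) = fun t => ∫ x, Psi ρ t x ∂P from
    funext fun t => gradient_popLoss hproblem hgrad t]
  refine h.congr_fderiv ?_
  refine ContinuousLinearMap.ext fun v => ?_
  ext i
  rw [ContinuousLinearMap.integral_apply hint]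
  have h3 : (∫ x, fderiv ℝ (fun t => Psi ρ t x) θ v ∂P) i =
      ∫ x, (fderiv ℝ (fun t => Psi ρ t x) θ v) i ∂P :=
    ((EuclideanSpace.proj (𝕜 := ℝ) i).integral_comp_comm
      (hint.apply_continuousLinearMap v)).symm
  rw [h3]
  simp only [hessRho_mulVec, Matrix.mulVec, dotProduct]
  rw [integral_finsetSum _ fun j _ => (integrable_hessRho_apply hproblem hfactor θ i j).mul_const _]
  simp only [integral_mul_const]
  rfl

lemma matA_eq (hproblem : IsProblem ρ P θ₀) {B₀ B₁ : ℝ}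
    (hgrad : ∀ θ x, ‖Psi ρ θ x‖ ≤ B₀) (hfactor : HessianFactorizes ρ B₁) :
    matA ρ P θ₀ = Matrix.of fun i j => ∫ x, hessRho ρ θ₀ x i j ∂P := by
  ext i j
  rw [matA, hessian, (hasFDerivAt_gradient_popLoss hproblem hgrad hfactor θ₀).fderiv]
  rw [Matrix.of_apply, toEuclideanCLM_apply]
  simp

lemma isHermitian_matA (hproblem : IsProblem ρ P θ₀) {B₀ B₁ : ℝ}
    (hgrad : ∀ θ x, ‖Psi ρ θ x‖ ≤ B₀) (hfactor : HessianFactorizes ρ B₁) :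
    (matA ρ P θ₀).IsHermitian := by
  rw [isHermitian_iff_isSymm, matA_eq hproblem hgrad hfactor]
  ext i j
  simp only [Matrix.transpose_apply, Matrix.of_apply, (isSymm_hessRho hfactor _ _).apply]

/-- The gradient of the population loss points away from the minimizer, linearly near it and with
at least constant length far away. -/
lemma exists_drift (hproblem : IsProblem ρ P θ₀) {B₀ B₁ κ₁ : ℝ}
    (hgrad : ∀ θ x, ‖Psi ρ θ x‖ ≤ B₀) (hfactor : HessianFactorizes ρ B₁) (hκ₁ : 0 < κ₁)
    (hκ₁A : κ₁ ≤ lambdaMin (matA ρ P θ₀)) :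
    ∃ c > 0, ∀ v : EuclideanSpace ℝ (Fin p),
      c * (‖v‖ * min ‖v‖ 1) ≤ inner ℝ (gradient (popLoss ρ P) (θ₀ + v)) v := by
  have hA := isHermitian_matA hproblem hgrad hfactor
  have hquad := mul_norm_sq_le_dotProduct_mulVec hA (spectrum_ge_of_le_lambdaMin hκ₁A)
  have hder := hasFDerivAt_gradient_popLoss hproblem hgrad hfactor θ₀
  rw [← matA_eq hproblem hgrad hfactor] at hder
  -- Near `θ₀` the linearization error is allowed to use up half of the quadratic form of `A`,
  -- leaving `κ₁ / 2`.
  have hlo := (hasFDerivAt_iff_isLittleO_nhds_zero.1 hder).def (half_pos hκ₁)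
  obtain ⟨r, hr, hball⟩ := Metric.eventually_nhds_iff_ball.1 hlo
  have hloc : ∀ v : EuclideanSpace ℝ (Fin p), ‖v‖ < r →
      κ₁ / 2 * ‖v‖ ^ 2 ≤ inner ℝ (gradient (popLoss ρ P) (θ₀ + v)) v := by
    intro v hv
    have h1 := hball v (by simpa using hv)
    rw [gradient_popLoss_eq_zero hproblem, sub_zero] at h1
    have h2 : inner ℝ (Matrix.toEuclideanCLM (𝕜 := ℝ) (matA ρ P θ₀) v) v =
        v.ofLp ⬝ᵥ matA ρ P θ₀ *ᵥ v.ofLp := by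
      rw [toEuclideanCLM_apply]
      simp [PiLp.inner_apply, dotProduct]
    have h3 := hquad v
    rw [← h2] at h3
    have h4 := abs_real_inner_le_norm
      (gradient (popLoss ρ P) (θ₀ + v) - Matrix.toEuclideanCLM (𝕜 := ℝ) (matA ρ P θ₀) v) v
    rw [inner_sub_left] at h4
    have h5 := (abs_le.1 h4).1
    nlinarith [norm_nonneg v]
  have hmono : ∀ v : EuclideanSpace ℝ (Fin p), Monotone fun t : ℝ =>
      inner ℝ (gradient (popLoss ρ P) (θ₀ + t • v)) v := by
    intro v s t hst
    simp only [inner_gradient_popLoss hproblem hgrad]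
    exact integral_mono ((integrable_Psi hproblem hgrad _).inner_const v)
      ((integrable_Psi hproblem hgrad _).inner_const v)
      fun x => monotone_inner_Psi hproblem hfactor θ₀ v x hst
  set s := min (r / 2) 1
  have hs : 0 < s := lt_min (half_pos hr) one_pos
  have hs1 : s ≤ 1 := min_le_right _ _
  have hsr : s < r := (min_le_left _ _).trans_lt (half_lt_self hr)
  refine ⟨κ₁ / 2 * s, by positivity, fun v => ?_⟩
  rcases le_or_gt ‖v‖ s with hv | hv
  · refine le_trans ?_ (hloc v (hv.trans_lt hsr))
    have h1 : ‖v‖ * min ‖v‖ 1 ≤ ‖v‖ ^ 2 := by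
      rw [sq]; gcongr; exact min_le_left _ _
    have h2 : s * (‖v‖ * min ‖v‖ 1) ≤ 1 * ‖v‖ ^ 2 := by gcongr
    nlinarith
  · have hv0 : 0 < ‖v‖ := hs.trans hv
    -- The segment from `θ₀` to `θ₀ + v` crosses the sphere of radius `s < r`, where the local bound
    -- holds; monotonicity along the ray carries it outward to `v`.
    have h1 := hmono v (show s / ‖v‖ ≤ 1 from (div_le_one hv0).2 hv.le)
    simp only [one_smul] at h1
    have hn : ‖(s / ‖v‖) • v‖ = s := by
      rw [norm_smul, Real.norm_of_nonneg (by positivity), div_mul_cancel₀ _ hv0.ne']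
    have h2 := hloc ((s / ‖v‖) • v) (by rwa [hn])
    rw [hn, real_inner_smul_right] at h2
    have h3 : κ₁ / 2 * s * ‖v‖ ≤ inner ℝ (gradient (popLoss ρ P) (θ₀ + (s / ‖v‖) • v)) v := by
      have h4 : κ₁ / 2 * s * ‖v‖ = (κ₁ / 2 * s ^ 2) / (s / ‖v‖) := by field_simp
      rw [h4, div_le_iff₀ (by positivity), mul_comm (inner ℝ _ v)]
      exact h2
    refine le_trans ?_ (h3.trans h1)
    have : ‖v‖ * min ‖v‖ 1 ≤ ‖v‖ * 1 := by gcongr; exact min_le_right _ _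
    have h5 : 0 < κ₁ / 2 * s := by positivity
    nlinarith

end Calculus

/-! ### Independence -/

section Independence

variable {Ω A B C D : Type*} [MeasurableSpace Ω] [MeasurableSpace A] [MeasurableSpace B]
  [MeasurableSpace C] [MeasurableSpace D] {Q : Measure Ω}
  {X : Ω → A} {Y : Ω → B} {W : Ω → C} {V : Ω → D}

/-- Overwriting the entries outside `S` by a constant keeps a subfamily in the form of a full
sequence, so that `iterate` can be evaluated on it without reindexing. -/
lemma measurable_masked {X : ℕ → Ω → A} (hm : ∀ i, Measurable (X i)) (S : Set ℕ)
    [DecidablePred (· ∈ S)] (c : A) : Measurable fun ω i => if i ∈ S then X i ω else c :=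
  measurable_pi_lambda _ fun i => by
    by_cases h : i ∈ S <;> simp only [h, if_true, if_false]
    exacts [hm i, measurable_const]

lemma indepFun_masked {X : ℕ → Ω → A} (hm : ∀ i, Measurable (X i)) (hX : iIndepFun X Q)
    (S : Set ℕ) [DecidablePred (· ∈ S)] {k : ℕ} (hk : k ∉ S) (c : A) :
    IndepFun (fun ω i => if i ∈ S then X i ω else c) (X k) Q := by
  have h := indep_iSup_of_disjoint (fun i => (hm i).comap_le) hX
    (Set.disjoint_singleton_right.2 hk)
  rw [IndepFun_iff_Indep]
  refine indep_of_indep_of_le_right (indep_of_indep_of_le_left h ?_) ?_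
  · rw [← measurable_iff_comap_le]
    refine @measurable_pi_lambda _ _ _ (_) _ _ fun i => ?_
    by_cases hi : i ∈ S
    · simp only [hi, if_true]
      exact Measurable.mono (comap_measurable (X i)) (le_iSup₂_of_le i hi le_rfl) le_rfl
    · simp only [hi, if_false]
      exact measurable_const
  · exact le_iSup₂_of_le k rfl le_rfl

variable [IsProbabilityMeasure Q]

/-- The joint law of the three is a product measure, and products of measures are associative. -/
lemma indepFun_assoc (hX : Measurable X) (hY : Measurable Y) (hW : Measurable W)
    (h₁ : IndepFun X Y Q) (h₂ : IndepFun (fun ω => (X ω, Y ω)) W Q) :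
    IndepFun X (fun ω => (Y ω, W ω)) Q := by
  have hXY : Measurable fun ω => (X ω, Y ω) := hX.prodMk hY
  have hYW : Measurable fun ω => (Y ω, W ω) := hY.prodMk hW
  have h₃ : IndepFun Y W Q := h₂.comp measurable_snd measurable_id
  have := Measure.isProbabilityMeasure_map (μ := Q) hX.aemeasurable
  have := Measure.isProbabilityMeasure_map (μ := Q) hY.aemeasurable
  have := Measure.isProbabilityMeasure_map (μ := Q) hW.aemeasurable
  rw [indepFun_iff_map_prod_eq_prod_map_map hX.aemeasurable hYW.aemeasurable,
    (indepFun_iff_map_prod_eq_prod_map_map hY.aemeasurable hW.aemeasurable).1 h₃,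
    ← Measure.prodAssoc_prod,
    ← (indepFun_iff_map_prod_eq_prod_map_map hX.aemeasurable hY.aemeasurable).1 h₁,
    ← (indepFun_iff_map_prod_eq_prod_map_map hXY.aemeasurable hW.aemeasurable).1 h₂,
    Measure.map_map (by fun_prop) (hXY.prodMk hW)]
  rfl

/-- The hypotheses make all four variables jointly independent, so they can be regrouped. It serves
to pass from observations against noises to past against present. -/
lemma indepFun_prod_prod (hX : Measurable X) (hY : Measurable Y) (hW : Measurable W)
    (hV : Measurable V) (h₁ : IndepFun X Y Q) (h₂ : IndepFun W V Q)
    (h : IndepFun (fun ω => (X ω, Y ω)) (fun ω => (W ω, V ω)) Q) :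
    IndepFun (fun ω => (X ω, W ω)) (fun ω => (Y ω, V ω)) Q := by
  have e₁ : IndepFun X (fun ω => (Y ω, (W ω, V ω))) Q :=
    indepFun_assoc hX hY (hW.prodMk hV) h₁ h
  have e₂ : IndepFun W (fun ω => (V ω, Y ω)) Q :=
    indepFun_assoc hW hV hY h₂ (h.symm.comp measurable_id measurable_snd)
  have e₃ : IndepFun (fun ω => ((V ω, Y ω), W ω)) X Q :=
    e₁.symm.comp (φ := fun q : B × (C × D) => ((q.2.2, q.1), q.2.1)) (by fun_prop) measurable_id
  exact (indepFun_assoc (hV.prodMk hY) hW hX e₂.symm e₃).symm.comp measurable_swap measurable_swap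

/-- Fubini for the product law. It takes the place of conditioning on the past: `X` is frozen and
the fresh variable `Y` is averaged out. -/
lemma integral_of_indepFun (hX : Measurable X) (hY : Measurable Y) (h : IndepFun X Y Q)
    {f : A × B → ℝ} (hf : Measurable f) (hint : Integrable (fun ω => f (X ω, Y ω)) Q) :
    Integrable (fun ω => ∫ y, f (X ω, y) ∂(Q.map Y)) Q ∧
    ∫ ω, f (X ω, Y ω) ∂Q = ∫ ω, ∫ y, f (X ω, y) ∂(Q.map Y) ∂Q := by
  have := Measure.isProbabilityMeasure_map (μ := Q) hX.aemeasurable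
  have := Measure.isProbabilityMeasure_map (μ := Q) hY.aemeasurable
  have hXY : Measurable fun ω => (X ω, Y ω) := hX.prodMk hY
  have hlaw := (indepFun_iff_map_prod_eq_prod_map_map hX.aemeasurable hY.aemeasurable).1 h
  have hint' : Integrable f ((Q.map X).prod (Q.map Y)) := by
    rw [← hlaw]
    exact (integrable_map_measure hf.aestronglyMeasurable hXY.aemeasurable).2 hint
  refine ⟨(integrable_map_measure hint'.integral_prod_left.aestronglyMeasurable
    hX.aemeasurable).1 hint'.integral_prod_left, ?_⟩
  rw [← integral_map hXY.aemeasurable hf.aestronglyMeasurable, hlaw, integral_prod _ hint',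
    integral_map hX.aemeasurable hint'.integral_prod_left.aestronglyMeasurable]

lemma integral_abs_le_sqrt {f : Ω → ℝ} {b : ℝ} (hb : 0 < b)
    (hf : Integrable (fun ω => f ω ^ 2) Q) (h : ∫ ω, f ω ^ 2 ∂Q ≤ b) :
    ∫ ω, |f ω| ∂Q ≤ √b := by
  have hs : 0 < √b := Real.sqrt_pos.2 hb
  -- Arithmetic-geometric mean inequality, tuned so that both terms are `√b / 2` when the second
  -- moment equals `b`.
  have hle : ∀ ω, |f ω| ≤ f ω ^ 2 / (2 * √b) + √b / 2 := by
    intro ω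
    rw [← sub_nonneg, ← sq_abs]
    have : |f ω| ^ 2 / (2 * √b) + √b / 2 - |f ω| = (|f ω| - √b) ^ 2 / (2 * √b) := by
      field_simp; ring
    rw [this]
    positivity
  calc ∫ ω, |f ω| ∂Q ≤ ∫ ω, (f ω ^ 2 / (2 * √b) + √b / 2) ∂Q :=
        integral_mono_of_nonneg (.of_forall fun _ => abs_nonneg _)
          ((hf.div_const _).add (integrable_const _)) (.of_forall hle)
    _ = (∫ ω, f ω ^ 2 ∂Q) / (2 * √b) + √b / 2 := by
        rw [integral_add (hf.div_const _) (integrable_const _), integral_div]; simp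
    _ ≤ b / (2 * √b) + √b / 2 := by gcongr
    _ = √b := by
        have : b / (2 * √b) = √b / 2 := by
          rw [div_eq_div_iff (by positivity) two_ne_zero]
          linear_combination -2 * Real.mul_self_sqrt hb.le
        rw [this, add_halves]

/-- The mean error of an empirical mean of bounded i.i.d. variables. -/
lemma integral_abs_mean_sub_le {P : Measure A} {Z : ℕ → Ω → A}
    (hZ : ∀ i, Measurable (Z i)) (hlaw : ∀ i, Q.map (Z i) = P) (hind : iIndepFun Z Q)
    {f : A → ℝ} (hf : Measurable f) {b : ℝ} (hb : 0 < b) (hfb : ∀ x, |f x| ≤ b) {n : ℕ}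
    (hn : 1 ≤ n) :
    ∫ ω, |(1 / (n : ℝ)) * ∑ i ∈ Finset.range n, f (Z i ω) - ∫ x, f x ∂P| ∂Q ≤
      b / √n := by
  have hn0 : (0 : ℝ) < n := by exact_mod_cast hn
  have hmem : ∀ i, MemLp (fun ω => f (Z i ω)) 2 Q := fun i =>
    MemLp.of_bound (hf.comp (hZ i)).aestronglyMeasurable b (.of_forall fun ω => hfb _)
  set Y : Ω → ℝ := fun ω => (1 / (n : ℝ)) * ∑ i ∈ Finset.range n, f (Z i ω) with hY
  have hmean : ∫ ω, Y ω ∂Q = ∫ x, f x ∂P := by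
    rw [hY, integral_const_mul, integral_finsetSum _ fun i _ => (hmem i).integrable one_le_two]
    have : ∀ i, ∫ ω, f (Z i ω) ∂Q = ∫ x, f x ∂P := fun i => by
      rw [← hlaw i, integral_map (hZ i).aemeasurable hf.aestronglyMeasurable]
    simp only [this, Finset.sum_const, Finset.card_range, nsmul_eq_mul]
    field_simp
  have hYmem : MemLp Y 2 Q := (memLp_finsetSum _ fun i _ => hmem i).const_mul _
  have hvar : Var[Y; Q] ≤ b ^ 2 / n := by
    rw [hY, variance_const_mul]
    have h1 : Var[fun ω => ∑ i ∈ Finset.range n, f (Z i ω); Q] =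
        ∑ i ∈ Finset.range n, Var[fun ω => f (Z i ω); Q] := by
      have := IndepFun.variance_sum (μ := Q) (s := Finset.range n)
        (X := fun i ω => f (Z i ω)) (fun i _ => hmem i)
        (fun i _ j _ hij => (hind.indepFun hij).comp hf hf)
      rw [← this]
      congr 1
      ext ω
      simp
    have h2 : ∀ i, Var[fun ω => f (Z i ω); Q] ≤ b ^ 2 := by
      intro i
      refine (variance_le_expectation_sq (hf.comp (hZ i)).aestronglyMeasurable).trans ?_
      calc _ ≤ ∫ _, b ^ 2 ∂Q := integral_mono_of_nonneg (.of_forall fun _ => sq_nonneg _)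
            (integrable_const _) (.of_forall fun ω => by
              simpa using sq_le_sq' (neg_le_of_abs_le (hfb _)) (le_of_abs_le (hfb (Z i ω))))
        _ = b ^ 2 := by simp
    rw [h1]
    calc _ ≤ (1 / (n : ℝ)) ^ 2 * ∑ i ∈ Finset.range n, b ^ 2 := by gcongr with i _; exact h2 i
      _ = _ := by simp; field_simp
  have hsq : ∫ ω, (Y ω - ∫ x, f x ∂P) ^ 2 ∂Q ≤ b ^ 2 / n := by
    rwa [variance_eq_integral hYmem.aestronglyMeasurable.aemeasurable, hmean] at hvar
  have := integral_abs_le_sqrt (by positivity) (hYmem.sub (memLp_const _)).integrable_sq hsq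
  rwa [Real.sqrt_div (by positivity), Real.sqrt_sq hb.le] at this

end Independence

/-! ### Real sequences -/

section Sequences

/-- The relative loss between consecutive steps is at most `1 / (n + 1)`, eventually negligible
against the contraction of order `n^{-a}`. -/
lemma rpow_neg_succ_ge {a : ℝ} (ha : a ∈ Set.Ioo (0 : ℝ) 1) (n : ℕ) :
    ((n : ℝ) + 1) ^ (-a) * (1 - ((n : ℝ) + 1)⁻¹) ≤ ((n : ℝ) + 1 + 1) ^ (-a) := by
  have h1 : (0 : ℝ) < (n : ℝ) + 1 := by positivity
  have h2 : (0 : ℝ) < (n : ℝ) + 1 + 1 := by positivity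
  have h3 : ((n : ℝ) + 1 + 1) ^ (-a) =
      ((n : ℝ) + 1) ^ (-a) * (((n : ℝ) + 1) / ((n : ℝ) + 1 + 1)) ^ a := by
    rw [Real.div_rpow h1.le h2.le, Real.rpow_neg h1.le, Real.rpow_neg h2.le]
    field_simp
  rw [h3]
  gcongr
  have hq : ((n : ℝ) + 1) / ((n : ℝ) + 1 + 1) ≤ 1 := (div_le_one h2).2 (by linarith)
  calc 1 - ((n : ℝ) + 1)⁻¹ ≤ ((n : ℝ) + 1) / ((n : ℝ) + 1 + 1) := by
        rw [le_div_iff₀ h2]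
        have : ((n : ℝ) + 1)⁻¹ * ((n : ℝ) + 1) = 1 := inv_mul_cancel₀ h1.ne'
        nlinarith [inv_pos.2 h1]
    _ = (((n : ℝ) + 1) / ((n : ℝ) + 1 + 1)) ^ (1 : ℝ) := (Real.rpow_one _).symm
    _ ≤ _ := Real.rpow_le_rpow_of_exponent_ge (by positivity) hq ha.2.le

/-- A stochastic approximation recursion with steps `γ (n+1)^{-a}` decays like its steps. -/
lemma exists_le_rpow_of_recursion {a γ c b : ℝ} (ha : a ∈ Set.Ioo (0 : ℝ) 1) (hγ : 0 < γ)
    (hc : 0 < c) (hb : 0 ≤ b) {w : ℕ → ℝ} (hw : ∀ n, 0 ≤ w n)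
    (hrec : ∀ n : ℕ, w (n + 1) ≤ w n - c * (γ * ((n : ℝ) + 1) ^ (-a)) * w n +
      b * (γ * ((n : ℝ) + 1) ^ (-a)) ^ 2 * (w n + 1)) :
    ∃ K > 0, ∀ n : ℕ, w n ≤ K * ((n : ℝ) + 1) ^ (-a) := by
  set u : ℕ → ℝ := fun n => ((n : ℝ) + 1) ^ (-a) with hu
  have hu0 : ∀ n, 0 < u n := fun n => by positivity
  set d := c * γ / 2 with hd
  have hd0 : 0 < d := by positivity
  have htop : Tendsto (fun n : ℕ => (n : ℝ) + 1) atTop atTop :=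
    tendsto_atTop_add_const_right _ 1 tendsto_natCast_atTop_atTop
  have hlim1 : Tendsto u atTop (𝓝 0) := (tendsto_rpow_neg_atTop ha.1).comp htop
  have hlim2 : Tendsto (fun n : ℕ => ((n : ℝ) + 1) ^ (-(1 - a))) atTop (𝓝 0) :=
    (tendsto_rpow_neg_atTop (by linarith [ha.2])).comp htop
  have hev1 : ∀ᶠ n in atTop, (b * γ ^ 2) * u n < d := by
    have := hlim1.const_mul (b * γ ^ 2)
    rw [mul_zero] at this
    exact this.eventually_lt_const hd0
  have hev2 : ∀ᶠ n in atTop, d * u n < 1 := by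
    have := hlim1.const_mul d
    rw [mul_zero] at this
    exact this.eventually_lt_const one_pos
  have hev3 := hlim2.eventually_lt_const (half_pos hd0)
  -- With `d` half of the contraction rate, three things hold from `N` on: the part of the noise
  -- term proportional to `w` costs at most the other half, the factor `1 - d u` is positive, and
  -- the loss `1 / (n + 1)` is below `d u / 2`.
  obtain ⟨N, hN⟩ := eventually_atTop.1 (hev1.and (hev2.and hev3))
  set b' := b * γ ^ 2 with hb'
  have hb'0 : 0 ≤ b' := by positivity
  -- The first summand pays for the noise in the induction step; the sum of ratios covers all
  -- indices up to `N`.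
  set K := 2 * b' / d + ∑ n ∈ Finset.range (N + 1), w n / u n + 1 with hK
  have hsum0 : 0 ≤ ∑ n ∈ Finset.range (N + 1), w n / u n :=
    Finset.sum_nonneg fun n _ => div_nonneg (hw n) (hu0 n).le
  have hK0 : 0 < K := by positivity
  have hKb : 2 * b' ≤ K * d := by
    have : 2 * b' / d * d = 2 * b' := div_mul_cancel₀ _ hd0.ne'
    rw [hK]
    nlinarith
  have hpre : ∀ n ≤ N, w n ≤ K * u n := by
    intro n hn
    rw [← div_le_iff₀ (hu0 n)]
    have := Finset.single_le_sum (f := fun n => w n / u n)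
      (fun i _ => div_nonneg (hw i) (hu0 i).le) (Finset.mem_range.2 (Nat.lt_succ_of_le hn))
    have h2 : 0 ≤ 2 * b' / d := by positivity
    linarith
  refine ⟨K, hK0, fun n => ?_⟩
  rcases le_or_gt n N with hn | hn
  · exact hpre n hn
  · induction n, hn.le using Nat.le_induction with
    | base => exact hpre N le_rfl
    | succ n hNn ih =>
      have hwn : w n ≤ K * u n := by
        rcases hNn.eq_or_lt with rfl | h
        · exact hpre _ le_rfl
        · exact ih h
      obtain ⟨h1, h2, h3⟩ := hN n hNn
      have hrn := hrec n
      have e1 : w (n + 1) ≤ (1 - d * u n) * w n + b' * u n ^ 2 := by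
        have : b * (γ * u n) ^ 2 * (w n + 1) = (b' * u n) * (u n * w n) + b' * u n ^ 2 := by
          rw [hb']; ring
        have h4 : (b' * u n) * (u n * w n) ≤ d * (u n * w n) :=
          mul_le_mul_of_nonneg_right h1.le (mul_nonneg (hu0 n).le (hw n))
        have h5 : c * (γ * u n) * w n = 2 * d * (u n * w n) := by rw [hd]; ring
        calc w (n + 1) ≤ w n - c * (γ * u n) * w n + b * (γ * u n) ^ 2 * (w n + 1) := hrn
          _ ≤ _ := by rw [this, h5]; linarith
      have e2 : (1 - d * u n) * w n ≤ (1 - d * u n) * (K * u n) :=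
        mul_le_mul_of_nonneg_left hwn (by linarith)
      have e3 : K * (u n * (1 - ((n : ℝ) + 1)⁻¹)) ≤ K * u (n + 1) := by
        gcongr
        have := rpow_neg_succ_ge ha n
        simpa [hu] using this
      have e4 : ((n : ℝ) + 1)⁻¹ ≤ d / 2 * u n := by
        have h1 : (0 : ℝ) < (n : ℝ) + 1 := by positivity
        have : ((n : ℝ) + 1)⁻¹ = ((n : ℝ) + 1) ^ (-(1 - a)) * u n := by
          rw [hu, ← Real.rpow_add h1, ← Real.rpow_neg_one]; ring_nf
        rw [this]
        exact mul_le_mul_of_nonneg_right h3.le (hu0 n).le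
      have e5 : K * u n * ((n : ℝ) + 1)⁻¹ ≤ K * u n * (d / 2 * u n) := by gcongr
      have e6 : b' * u n ^ 2 ≤ K * d / 2 * u n ^ 2 := by gcongr; linarith
      -- The contraction gains `K d u²`. One half pays for the noise (`e6`), the other for the
      -- decrease from `u n` to `u (n + 1)` (`e5`, `e3`).
      have : w (n + 1) ≤ K * u (n + 1) := by nlinarith
      simpa [hu] using this

/-- A discrete integral comparison: Bernoulli's inequality bounds each summand by an increment of
`n^{1-s} / (1 - s)`. -/
lemma sum_rpow_neg_le {s : ℝ} (hs : s ∈ Set.Ioo (0 : ℝ) 1) (n : ℕ) :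
    ∑ i ∈ Finset.range n, ((i : ℝ) + 1) ^ (-s) ≤ (1 - s)⁻¹ * (n : ℝ) ^ (1 - s) := by
  have hs1 : 0 < 1 - s := by linarith [hs.2]
  induction n with
  | zero => simp [Real.zero_rpow hs1.ne']
  | succ n ih =>
    rw [Finset.sum_range_succ]
    have h1 : (0 : ℝ) < (n : ℝ) + 1 := by positivity
    have h2 := rpow_one_add_le_one_add_mul_self (s := -((n : ℝ) + 1)⁻¹) (p := 1 - s)
      (by rw [neg_le_neg_iff]; exact inv_le_one_of_one_le₀ (by linarith [n.cast_nonneg (α := ℝ)]))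
      hs1.le (by linarith [hs.1])
    have h3 : (n : ℝ) ^ (1 - s) = ((n : ℝ) + 1) ^ (1 - s) * (1 + -((n : ℝ) + 1)⁻¹) ^ (1 - s) := by
      rw [← Real.mul_rpow h1.le]
      · congr 1; field_simp; ring
      · rw [← sub_eq_add_neg, sub_nonneg]
        exact inv_le_one_of_one_le₀ (by linarith [n.cast_nonneg (α := ℝ)])
    have h4 : ((n : ℝ) + 1) ^ (1 - s) * ((n : ℝ) + 1)⁻¹ = ((n : ℝ) + 1) ^ (-s) := by
      rw [← Real.rpow_neg_one ((n : ℝ) + 1), ← Real.rpow_add h1]; ring_nf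
    have h5 : (n : ℝ) ^ (1 - s) ≤
        ((n : ℝ) + 1) ^ (1 - s) - (1 - s) * ((n : ℝ) + 1) ^ (-s) := by
      rw [h3, ← h4]
      have := mul_le_mul_of_nonneg_left h2 (Real.rpow_nonneg h1.le (1 - s))
      linarith
    push_cast
    have h6 := mul_le_mul_of_nonneg_left h5 (inv_pos.2 hs1).le
    have h7 : (1 - s)⁻¹ * ((1 - s) * ((n : ℝ) + 1) ^ (-s)) = ((n : ℝ) + 1) ^ (-s) := by
      field_simp
    rw [mul_sub, h7] at h6
    linarith

end Sequences

/-! ### A Lyapunov function -/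

section Lyapunov

variable {E : Type*} [NormedAddCommGroup E]

/-- It grows like `‖v‖²` near the origin and exponentially at infinity. -/
def lyapunov (v : E) : ℝ := Real.exp √(1 + ‖v‖ ^ 2)

lemma one_le_sqrt_one_add_sq (v : E) : 1 ≤ √(1 + ‖v‖ ^ 2) :=
  Real.one_le_sqrt.2 (by nlinarith [sq_nonneg ‖v‖])

lemma norm_le_sqrt_one_add_sq (v : E) : ‖v‖ ≤ √(1 + ‖v‖ ^ 2) :=
  Real.le_sqrt_of_sq_le (by linarith)

lemma continuous_lyapunov : Continuous (lyapunov : E → ℝ) := by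
  unfold lyapunov
  fun_prop

lemma sqrt_one_add_sq_add_le (v d : E) : √(1 + ‖v + d‖ ^ 2) ≤ √(1 + ‖v‖ ^ 2) + ‖d‖ := by
  have h := norm_le_sqrt_one_add_sq v
  have hsq : √(1 + ‖v‖ ^ 2) ^ 2 = 1 + ‖v‖ ^ 2 := Real.sq_sqrt (by positivity)
  refine Real.sqrt_le_iff.2 ⟨by positivity, ?_⟩
  have h1 : ‖v + d‖ ^ 2 ≤ (‖v‖ + ‖d‖) ^ 2 := by gcongr; exact norm_add_le _ _
  nlinarith [mul_le_mul_of_nonneg_right h (norm_nonneg d)]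

lemma lyapunov_add_le_mul_exp (v d : E) : lyapunov (v + d) ≤ lyapunov v * Real.exp ‖d‖ := by
  rw [lyapunov, lyapunov, ← Real.exp_add]
  exact Real.exp_le_exp.2 (sqrt_one_add_sq_add_le v d)

/-- Second-order Taylor bound valid for both signs of `u`. -/
lemma exp_le_one_add_add_sq_mul_exp_abs (u : ℝ) :
    Real.exp u ≤ 1 + u + u ^ 2 * Real.exp |u| := by
  have h := Complex.norm_exp_sub_sum_le_norm_mul_exp (u : ℂ) 2
  simp only [Finset.sum_range_succ, Finset.sum_range_zero, pow_zero, Nat.factorial_zero,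
    Nat.cast_one, div_one, pow_one, Nat.factorial_one, zero_add] at h
  rw [← Complex.ofReal_exp, ← Complex.ofReal_one, ← Complex.ofReal_add, ← Complex.ofReal_sub,
    Complex.norm_real, Complex.norm_real, Real.norm_eq_abs, Real.norm_eq_abs, sq_abs] at h
  linarith [le_abs_self (Real.exp u - (1 + u))]

/-- A Taylor bound with explicit remainder, uniform in `v`: `√(1 + ‖v‖²)` is `1`-Lipschitz with
first-order term `⟨v, d⟩ / h`, and the exponential turns its increments into relative ones. The
linear term is the one that averages to drift plus centred noise. -/
lemma lyapunov_add_le [InnerProductSpace ℝ E] (v d : E) :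
    lyapunov (v + d) ≤ lyapunov v +
      lyapunov v / √(1 + ‖v‖ ^ 2) * inner ℝ v d +
      lyapunov v * (2 * ‖d‖ ^ 2 * Real.exp ‖d‖) := by
  set h := √(1 + ‖v‖ ^ 2) with hh
  set h' := √(1 + ‖v + d‖ ^ 2) with hh'
  have h1 : 1 ≤ h := one_le_sqrt_one_add_sq v
  have h0 : 0 < h := by linarith
  have hup : h' ≤ h + ‖d‖ := sqrt_one_add_sq_add_le v d
  have hlo : h ≤ h' + ‖d‖ := by
    have := sqrt_one_add_sq_add_le (v + d) (-d)
    rwa [add_neg_cancel_right, norm_neg] at this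
  have habs : |h' - h| ≤ ‖d‖ := abs_le.2 ⟨by linarith, by linarith⟩
  have hsq : h ^ 2 = 1 + ‖v‖ ^ 2 := Real.sq_sqrt (by positivity)
  have hsq' : h' ^ 2 = 1 + ‖v + d‖ ^ 2 := Real.sq_sqrt (by positivity)
  rw [norm_add_sq_real] at hsq'
  have hlin : h' - h ≤ inner ℝ v d / h + ‖d‖ ^ 2 := by
    -- From `2 h (h' - h) ≤ h'² - h² = 2 ⟨v, d⟩ + ‖d‖²`.
    have e : h' - h ≤ (inner ℝ v d + ‖d‖ ^ 2 / 2) / h := by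
      rw [le_div_iff₀ h0]
      nlinarith [sq_nonneg (h' - h)]
    refine e.trans ?_
    rw [add_div]
    gcongr
    rw [div_le_iff₀ h0]
    nlinarith [sq_nonneg ‖d‖]
  have hexp := exp_le_one_add_add_sq_mul_exp_abs (h' - h)
  have hlast : (h' - h) ^ 2 * Real.exp |h' - h| ≤ ‖d‖ ^ 2 * Real.exp ‖d‖ := by
    rw [← sq_abs (h' - h)]
    gcongr
  have hone : ‖d‖ ^ 2 ≤ ‖d‖ ^ 2 * Real.exp ‖d‖ :=
    le_mul_of_one_le_right (sq_nonneg _) (Real.one_le_exp (norm_nonneg d))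
  have hfin : Real.exp (h' - h) ≤ 1 + inner ℝ v d / h + 2 * ‖d‖ ^ 2 * Real.exp ‖d‖ := by linarith
  have hprod : lyapunov (v + d) = lyapunov v * Real.exp (h' - h) := by
    rw [lyapunov, lyapunov, ← Real.exp_add, ← hh, ← hh', add_sub_cancel]
  rw [hprod]
  calc _ ≤ lyapunov v * (1 + inner ℝ v d / h + 2 * ‖d‖ ^ 2 * Real.exp ‖d‖) :=
        mul_le_mul_of_nonneg_left hfin (Real.exp_pos _).le
    _ = _ := by ring

/-- This turns the weak drift into a linear contraction of `V - e`, where `e` is the minimum of `V`.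
Near the origin `V - e ≤ V (h - 1)` and `(h - 1) h ≤ ‖v‖²`; far away `h ≤ 2 ‖v‖`. -/
lemma lyapunov_sub_le (v : E) :
    (lyapunov v - Real.exp 1) / 2 ≤
      lyapunov v / √(1 + ‖v‖ ^ 2) * (‖v‖ * min ‖v‖ 1) := by
  set h := √(1 + ‖v‖ ^ 2) with hh
  have h1 : 1 ≤ h := one_le_sqrt_one_add_sq v
  have h0 : 0 < h := by linarith
  have hsq : h ^ 2 = 1 + ‖v‖ ^ 2 := Real.sq_sqrt (by positivity)
  have hl : 0 < lyapunov v := Real.exp_pos _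
  have he : 0 < Real.exp 1 := Real.exp_pos _
  rw [div_mul_eq_mul_div, le_div_iff₀ h0]
  rcases le_or_gt ‖v‖ 1 with hv | hv
  · rw [min_eq_left hv]
    have e1 : lyapunov v - Real.exp 1 ≤ lyapunov v * (h - 1) := by
      have e2 : Real.exp 1 = lyapunov v * Real.exp (1 - h) := by
        rw [lyapunov, ← Real.exp_add, ← hh]; ring_nf
      have e3 := Real.add_one_le_exp (1 - h)
      rw [e2]
      nlinarith
    have e4 : (h - 1) * h ≤ ‖v‖ * ‖v‖ := by nlinarith
    have e5 : 0 ≤ lyapunov v * (‖v‖ * ‖v‖) := by positivity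
    calc (lyapunov v - Real.exp 1) / 2 * h ≤ lyapunov v * (h - 1) / 2 * h := by gcongr
      _ = lyapunov v * ((h - 1) * h) / 2 := by ring
      _ ≤ lyapunov v * (‖v‖ * ‖v‖) / 2 := by gcongr
      _ ≤ _ := by linarith
  · rw [min_eq_right hv.le, mul_one]
    have e1 : h ≤ 2 * ‖v‖ := by
      refine Real.sqrt_le_iff.2 ⟨by positivity, by nlinarith⟩
    nlinarith

/-- With `x = h - 1`, the bound `exp x ≥ 1 + x + x² / 2` has right side exactly `1 + ‖v‖² / 2`, and
`e ≥ 2` removes the half. -/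
lemma norm_sq_le_lyapunov_sub (v : E) : ‖v‖ ^ 2 ≤ lyapunov v - Real.exp 1 := by
  set h := √(1 + ‖v‖ ^ 2) with hh
  have h1 : 1 ≤ h := one_le_sqrt_one_add_sq v
  have hsq : h ^ 2 = 1 + ‖v‖ ^ 2 := Real.sq_sqrt (by positivity)
  have e1 := Real.quadratic_le_exp_of_nonneg (sub_nonneg.2 h1)
  have e2 : lyapunov v = Real.exp 1 * Real.exp (h - 1) := by
    rw [lyapunov, ← Real.exp_add, add_sub_cancel]
  have e3 : (2 : ℝ) ≤ Real.exp 1 := by linarith [Real.add_one_le_exp (1 : ℝ)]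
  have e4 : 1 + ‖v‖ ^ 2 / 2 ≤ Real.exp (h - 1) := by nlinarith
  rw [e2]
  nlinarith [sq_nonneg ‖v‖]

end Lyapunov

/-! ### The iterates -/

section Iterates

variable {p : ℕ} {Z : Type*} {ρ : EuclideanSpace ℝ (Fin p) → Z → ℝ} {γ a B₀ μ : ℝ}
  {θinit : EuclideanSpace ℝ (Fin p)}

lemma iterate_congr {D D' : ℕ → Z} {x x' : ℕ → EuclideanSpace ℝ (Fin p)} {n : ℕ}
    (hD : ∀ i < n, D i = D' i) (hx : ∀ i < n, x i = x' i) :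
    iterate ρ γ a B₀ μ θinit D x n = iterate ρ γ a B₀ μ θinit D' x' n := by
  induction n with
  | zero => rfl
  | succ n ih =>
    rw [iterate, iterate, ih (fun i hi => hD i (hi.trans n.lt_succ_self))
      (fun i hi => hx i (hi.trans n.lt_succ_self)), hD n n.lt_succ_self, hx n n.lt_succ_self]

variable [MeasurableSpace Z] {P : Measure Z} {θ₀ : EuclideanSpace ℝ (Fin p)}

lemma measurable_Psi_comp {α : Type*} [MeasurableSpace α] (hproblem : IsProblem ρ P θ₀)
    {f : α → EuclideanSpace ℝ (Fin p)} {g : α → Z} (hf : Measurable f) (hg : Measurable g) :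
    Measurable fun q => Psi ρ (f q) (g q) :=
  Measurable.comp (g := fun q : EuclideanSpace ℝ (Fin p) × Z => Psi ρ q.1 q.2)
    (measurable_uncurry_Psi hproblem) (hf.prodMk hg)

lemma measurable_hessRho_comp {α : Type*} [MeasurableSpace α] (hproblem : IsProblem ρ P θ₀)
    {f : α → EuclideanSpace ℝ (Fin p)} {g : α → Z} (hf : Measurable f) (hg : Measurable g) :
    Measurable fun q => hessRho ρ (f q) (g q) :=
  Measurable.comp (g := fun q : EuclideanSpace ℝ (Fin p) × Z => hessRho ρ q.1 q.2)
    (measurable_uncurry_hessRho hproblem) (f := fun q => (f q, g q)) (hf.prodMk hg)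

lemma measurable_iterate {α : Type*} [MeasurableSpace α] (hproblem : IsProblem ρ P θ₀)
    {D : α → ℕ → Z} {x : α → ℕ → EuclideanSpace ℝ (Fin p)} (hD : Measurable D)
    (hx : Measurable x) (n : ℕ) :
    Measurable fun q => iterate ρ γ a B₀ μ θinit (D q) (x q) n := by
  induction n with
  | zero => exact measurable_const
  | succ n ih =>
    have h1 := measurable_Psi_comp hproblem ih ((measurable_pi_apply n).comp hD)
    have h2 : Measurable fun q => x q n := (measurable_pi_apply n).comp hx
    simp only [iterate]
    simp only [Function.comp_apply] at h1
    fun_prop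

variable {Ω : Type*} [MeasurableSpace Ω] {Q : Measure Ω}
  {z : ℕ → Ω → Z} {ξ : ℕ → Ω → EuclideanSpace ℝ (Fin p)}
  {M₁ M₂ : Ω → Matrix (Fin p) (Fin p) ℝ}

lemma measurable_iterate_sample (hproblem : IsProblem ρ P θ₀)
    (hsampling : IsSampling P Q z ξ M₁ M₂) (n : ℕ) :
    Measurable fun ω => iterate ρ γ a B₀ μ θinit (fun i => z i ω) (fun i => ξ i ω) n :=
  measurable_iterate hproblem (measurable_pi_lambda _ hsampling.z_measurable)
    (measurable_pi_lambda _ hsampling.ξ_measurable) n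

variable [IsProbabilityMeasure Q]

/-- An iterate is independent of the observation and the noise of the next step. -/
lemma indepFun_iterate (hproblem : IsProblem ρ P θ₀)
    (hsampling : IsSampling P Q z ξ M₁ M₂) (n : ℕ) :
    IndepFun (fun ω => iterate ρ γ a B₀ μ θinit (fun i => z i ω) (fun i => ξ i ω) n)
      (fun ω => (z n ω, ξ n ω)) Q := by
  -- Only supplies a default value in `Z` for the masked entries.
  obtain ⟨ω₀⟩ : Nonempty Ω := nonempty_of_isProbabilityMeasure Q
  have hz := hsampling.z_measurable
  have hξ := hsampling.ξ_measurable
  have h1 := indepFun_masked hz hsampling.z_indep (Set.Iio n) (k := n) (by simp) (z 0 ω₀)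
  have h2 := indepFun_masked hξ hsampling.ξ_indep (Set.Iio n) (k := n) (by simp) 0
  have hmz := measurable_masked hz (Set.Iio n) (z 0 ω₀)
  have hmξ := measurable_masked hξ (Set.Iio n) 0
  have h3 := indepFun_prod_prod hmz (hz n) hmξ (hξ n) h1 h2 (hsampling.indep_data.comp
    (φ := fun s : ℕ → Z => ((fun i => if i ∈ Set.Iio n then s i else z 0 ω₀), s n))
    (ψ := fun s : (ℕ → EuclideanSpace ℝ (Fin p)) × Matrix (Fin p) (Fin p) ℝ ×
      Matrix (Fin p) (Fin p) ℝ => ((fun i => if i ∈ Set.Iio n then s.1 i else 0), s.1 n))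
    ?_ ?_)
  · have h4 := h3.comp (measurable_iterate (γ := γ) (a := a) (B₀ := B₀) (μ := μ)
      (θinit := θinit) hproblem measurable_fst measurable_snd n) measurable_id
    refine h4.congr (.of_forall fun ω => ?_) (.of_forall fun ω => rfl)
    exact iterate_congr (fun i hi => by simp [hi]) (fun i hi => by simp [hi])
  · exact (measurable_masked measurable_pi_apply (Set.Iio n) _).prodMk (measurable_pi_apply n)
  · exact (measurable_masked (fun i => (measurable_pi_apply i).comp measurable_fst)
      (Set.Iio n) _).prodMk ((measurable_pi_apply n).comp measurable_fst)

end Iterates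

/-! ### The rate of the iterates -/

section Rate

variable {p : ℕ}

/-- Fernique's theorem gives a Gaussian-type moment; completing the square compares it with the
exponential one. -/
lemma integrable_exp_mul_norm_stdGaussian (c : ℝ) :
    Integrable (fun y => Real.exp (c * ‖y‖)) (stdGaussian (EuclideanSpace ℝ (Fin p))) := by
  obtain ⟨d, hd, hint⟩ :=
    IsGaussian.exists_integrable_exp_sq (stdGaussian (EuclideanSpace ℝ (Fin p)))
  refine (hint.const_mul (Real.exp (c ^ 2 / (4 * d)))).mono'
    (by fun_prop) (.of_forall fun y => ?_)
  rw [Real.norm_of_nonneg (Real.exp_pos _).le, ← Real.exp_add]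
  refine Real.exp_le_exp.2 ?_
  have : c ^ 2 / (4 * d) + d * ‖y‖ ^ 2 - c * ‖y‖ = (2 * d * ‖y‖ - c) ^ 2 / (4 * d) := by
    field_simp; ring
  rw [← sub_nonneg, this]
  positivity

lemma integrable_sq_mul_exp_stdGaussian {b s : ℝ} (hb : 0 ≤ b) (hs : 0 ≤ s) (c : ℝ) :
    Integrable (fun y => 2 * (b + s * ‖y‖) ^ 2 * Real.exp (c * (b + s * ‖y‖)))
      (stdGaussian (EuclideanSpace ℝ (Fin p))) := by
  refine ((integrable_exp_mul_norm_stdGaussian ((c + 1) * s)).const_mul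
    (4 * Real.exp ((c + 1) * b))).mono' (by fun_prop) (.of_forall fun y => ?_)
  have hR : 0 ≤ b + s * ‖y‖ := by positivity
  rw [Real.norm_of_nonneg (by positivity), mul_assoc (4 : ℝ), ← Real.exp_add]
  have h1 : (b + s * ‖y‖) ^ 2 ≤ 2 * Real.exp (b + s * ‖y‖) := by
    have := Real.quadratic_le_exp_of_nonneg hR
    nlinarith
  calc _ ≤ 2 * ((2 * Real.exp (b + s * ‖y‖)) * Real.exp (c * (b + s * ‖y‖))) := by
        rw [mul_assoc]; gcongr
    _ = 4 * Real.exp ((b + s * ‖y‖) + c * (b + s * ‖y‖)) := by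
        rw [Real.exp_add (b + s * ‖y‖)]; ring
    _ = _ := by ring_nf

variable {Z Ω : Type*} [MeasurableSpace Z] [MeasurableSpace Ω]
  {ρ : EuclideanSpace ℝ (Fin p) → Z → ℝ} {γ a B₀ B₁ μ κ₁ : ℝ}
  {P : Measure Z} [IsProbabilityMeasure P] {θ₀ θinit : EuclideanSpace ℝ (Fin p)}
  {Q : Measure Ω} [IsProbabilityMeasure Q]
  {z : ℕ → Ω → Z} {ξ : ℕ → Ω → EuclideanSpace ℝ (Fin p)}
  {M₁ M₂ : Ω → Matrix (Fin p) (Fin p) ℝ}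

/-- The expected Lyapunov function of a step of the recursion. -/
lemma integral_lyapunov_step_le (hμ : 0 < μ) (hB₀ : 0 < B₀)
    (hproblem : IsProblem ρ P θ₀) (hsampling : IsSampling P Q z ξ M₁ M₂)
    (hgrad : ∀ θ x, ‖Psi ρ θ x‖ ≤ B₀) {c : ℝ} (hc : 0 < c)
    (hdrift : ∀ v : EuclideanSpace ℝ (Fin p),
      c * (‖v‖ * min ‖v‖ 1) ≤ inner ℝ (gradient (popLoss ρ P) (θ₀ + v)) v)
    {ϑ : Ω → EuclideanSpace ℝ (Fin p)} (hϑ : Measurable ϑ) {n : ℕ}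
    (hind : IndepFun ϑ (fun ω => (z n ω, ξ n ω)) Q)
    (hint : Integrable (fun ω => lyapunov (ϑ ω - θ₀)) Q) {η : ℝ} (hη : 0 ≤ η) (hηγ : η ≤ γ) :
    Integrable (fun ω => lyapunov
      (ϑ ω - η • (Psi ρ (ϑ ω) (z n ω) + (2 * B₀ / μ) • ξ n ω) - θ₀)) Q ∧
    ∫ ω, lyapunov (ϑ ω - η • (Psi ρ (ϑ ω) (z n ω) + (2 * B₀ / μ) • ξ n ω) - θ₀) ∂Q ≤
      ∫ ω, lyapunov (ϑ ω - θ₀) ∂Q -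
        η * (c / 2 * ∫ ω, (lyapunov (ϑ ω - θ₀) - Real.exp 1) ∂Q) +
        η ^ 2 * ((∫ ω, lyapunov (ϑ ω - θ₀) ∂Q) *
          ∫ y, 2 * (B₀ + 2 * B₀ / μ * ‖y‖) ^ 2 * Real.exp (γ * (B₀ + 2 * B₀ / μ * ‖y‖))
            ∂(stdGaussian (EuclideanSpace ℝ (Fin p)))) := by
  set s := 2 * B₀ / μ with hs
  have hs0 : 0 ≤ s := by positivity
  have hz := hsampling.z_measurable n
  have hξ := hsampling.ξ_measurable n
  have hindz : IndepFun ϑ (z n) Q := hind.comp measurable_id measurable_fst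
  have hindξ : IndepFun ϑ (ξ n) Q := hind.comp measurable_id measurable_snd
  have hlyap : Measurable (lyapunov : EuclideanSpace ℝ (Fin p) → ℝ) :=
    continuous_lyapunov.measurable
  have hΨ := measurable_uncurry_Psi hproblem
  have hΨω : Measurable fun ω => Psi ρ (ϑ ω) (z n ω) :=
    Measurable.comp (g := fun q : EuclideanSpace ℝ (Fin p) × Z => Psi ρ q.1 q.2) hΨ
      (f := fun ω => (ϑ ω, z n ω)) (hϑ.prodMk hz)
  have hlpos : ∀ v : EuclideanSpace ℝ (Fin p), 0 < lyapunov v := fun v => Real.exp_pos _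
  set d : Ω → EuclideanSpace ℝ (Fin p) :=
    fun ω => -(η • (Psi ρ (ϑ ω) (z n ω) + s • ξ n ω)) with hd
  have hdm : Measurable d := by rw [hd]; fun_prop
  have hsplit : ∀ ω, ϑ ω - η • (Psi ρ (ϑ ω) (z n ω) + s • ξ n ω) - θ₀ = (ϑ ω - θ₀) + d ω := by
    intro ω; rw [hd]; module
  simp only [hsplit]
  have hdn : ∀ ω, ‖d ω‖ ≤ η * (B₀ + s * ‖ξ n ω‖) := by
    intro ω
    rw [hd, norm_neg, norm_smul, Real.norm_of_nonneg hη]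
    gcongr
    refine (norm_add_le _ _).trans (add_le_add (hgrad _ _) ?_)
    rw [norm_smul, Real.norm_of_nonneg hs0]
  -- The bound with `γ` is for the exponent only, so that the remainder integral is the same for all
  -- steps; the factor `η ^ 2` in front uses the sharper `hdn`.
  have hdn' : ∀ ω, ‖d ω‖ ≤ γ * (B₀ + s * ‖ξ n ω‖) := fun ω =>
    (hdn ω).trans (by gcongr)
  have hξint : ∀ {f : EuclideanSpace ℝ (Fin p) → ℝ}, Measurable f →
      Integrable f (stdGaussian (EuclideanSpace ℝ (Fin p))) → Integrable (fun ω => f (ξ n ω)) Q := by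
    intro f hf hfi
    rw [← hsampling.ξ_law n] at hfi
    exact (integrable_map_measure hf.aestronglyMeasurable hξ.aemeasurable).1 hfi
  have hprod : ∀ {f : EuclideanSpace ℝ (Fin p) → ℝ}, Measurable f →
      Integrable f (stdGaussian (EuclideanSpace ℝ (Fin p))) →
      Integrable (fun ω => lyapunov (ϑ ω - θ₀) * f (ξ n ω)) Q := by
    intro f hf hfi
    exact (hindξ.comp (φ := fun θ => lyapunov (θ - θ₀)) (by fun_prop) hf).integrable_mul hint
      (hξint hf hfi)
  have hnew : Integrable (fun ω => lyapunov ((ϑ ω - θ₀) + d ω)) Q := by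
    have hE : Integrable (fun y : EuclideanSpace ℝ (Fin p) => Real.exp (γ * (B₀ + s * ‖y‖)))
        (stdGaussian (EuclideanSpace ℝ (Fin p))) := by
      refine ((integrable_exp_mul_norm_stdGaussian (γ * s)).const_mul (Real.exp (γ * B₀))).congr
        (.of_forall fun y => ?_)
      simp only [← Real.exp_add]
      ring_nf
    refine (hprod (by fun_prop) hE).mono'
      (hlyap.comp ((hϑ.sub_const θ₀).add hdm)).aestronglyMeasurable (.of_forall fun ω => ?_)
    rw [Real.norm_of_nonneg (hlpos _).le]
    refine (lyapunov_add_le_mul_exp _ _).trans ?_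
    exact mul_le_mul_of_nonneg_left (Real.exp_le_exp.2 (hdn' ω)) (hlpos _).le
  refine ⟨hnew, ?_⟩
  set T : EuclideanSpace ℝ (Fin p) → ℝ :=
    fun y => 2 * (B₀ + s * ‖y‖) ^ 2 * Real.exp (γ * (B₀ + s * ‖y‖)) with hT
  have hTm : Measurable T := by rw [hT]; fun_prop
  have hTi : Integrable T (stdGaussian (EuclideanSpace ℝ (Fin p))) :=
    integrable_sq_mul_exp_stdGaussian hB₀.le hs0 γ
  set k : EuclideanSpace ℝ (Fin p) → ℝ :=
    fun θ => lyapunov (θ - θ₀) / √(1 + ‖θ - θ₀‖ ^ 2) with hk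
  have hkm : Measurable k := by rw [hk]; fun_prop
  have hk0 : ∀ θ, 0 ≤ k θ := fun θ => div_nonneg (hlpos _).le (Real.sqrt_nonneg _)
  have hkn : ∀ θ, k θ * ‖θ - θ₀‖ ≤ lyapunov (θ - θ₀) := by
    intro θ
    rw [hk, div_mul_eq_mul_div]
    refine div_le_of_le_mul₀ (Real.sqrt_nonneg _) (hlpos _).le ?_
    exact mul_le_mul_of_nonneg_left (norm_le_sqrt_one_add_sq _) (hlpos _).le
  -- the gradient term
  set f₁ : EuclideanSpace ℝ (Fin p) × Z → ℝ :=
    fun q => k q.1 * inner ℝ (q.1 - θ₀) (Psi ρ q.1 q.2) with hf₁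
  have hf₁m : Measurable f₁ := by
    rw [hf₁]
    exact (hkm.comp measurable_fst).mul ((measurable_fst.sub_const _).inner hΨ)
  have hf₁i : Integrable (fun ω => f₁ (ϑ ω, z n ω)) Q := by
    refine (hint.mul_const B₀).mono' (hf₁m.comp (hϑ.prodMk hz)).aestronglyMeasurable
      (.of_forall fun ω => ?_)
    rw [hf₁, norm_mul, Real.norm_of_nonneg (hk0 _)]
    calc k (ϑ ω) * ‖inner ℝ (ϑ ω - θ₀) (Psi ρ (ϑ ω) (z n ω))‖
        ≤ k (ϑ ω) * (‖ϑ ω - θ₀‖ * B₀) := by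
          gcongr
          · exact hk0 _
          · exact (norm_inner_le_norm _ _).trans (by gcongr; exact hgrad _ _)
      _ = k (ϑ ω) * ‖ϑ ω - θ₀‖ * B₀ := by ring
      _ ≤ _ := by gcongr; exact hkn _
  obtain ⟨hf₁i', hf₁e⟩ := integral_of_indepFun hϑ hz hindz hf₁m hf₁i
  have hf₁lo : c / 2 * ∫ ω, (lyapunov (ϑ ω - θ₀) - Real.exp 1) ∂Q ≤
      ∫ ω, f₁ (ϑ ω, z n ω) ∂Q := by
    rw [hf₁e, ← integral_const_mul]
    refine integral_mono ((hint.sub (integrable_const _)).const_mul _) hf₁i' fun ω => ?_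
    -- With the iterate frozen, averaging over the fresh observation turns `Psi` into the gradient
    -- of the population loss, to which the drift bound applies.
    have h1 : ∫ x, f₁ (ϑ ω, x) ∂(Q.map (z n)) =
        k (ϑ ω) * inner ℝ (gradient (popLoss ρ P) (θ₀ + (ϑ ω - θ₀))) (ϑ ω - θ₀) := by
      rw [hsampling.z_law, inner_gradient_popLoss hproblem hgrad, ← integral_const_mul]
      simp only [hf₁, add_sub_cancel, real_inner_comm]
    have h2 := mul_le_mul_of_nonneg_left (hdrift (ϑ ω - θ₀)) (hk0 (ϑ ω))
    have h3 := lyapunov_sub_le (ϑ ω - θ₀)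
    simp only [h1]
    refine le_trans ?_ h2
    calc c / 2 * (lyapunov (ϑ ω - θ₀) - Real.exp 1)
        = c * ((lyapunov (ϑ ω - θ₀) - Real.exp 1) / 2) := by ring
      _ ≤ c * (k (ϑ ω) * (‖ϑ ω - θ₀‖ * min ‖ϑ ω - θ₀‖ 1)) := by gcongr
      _ = _ := by ring
  -- the noise term
  set f₂ : EuclideanSpace ℝ (Fin p) × EuclideanSpace ℝ (Fin p) → ℝ :=
    fun q => k q.1 * inner ℝ (q.1 - θ₀) q.2 with hf₂
  have hf₂m : Measurable f₂ := by
    rw [hf₂]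
    exact (hkm.comp measurable_fst).mul ((measurable_fst.sub_const _).inner measurable_snd)
  have hidint : Integrable (fun y => y) (stdGaussian (EuclideanSpace ℝ (Fin p))) :=
    IsGaussian.integrable_id
  have hf₂i : Integrable (fun ω => f₂ (ϑ ω, ξ n ω)) Q := by
    refine (hprod measurable_norm hidint.norm).mono' (hf₂m.comp (hϑ.prodMk hξ)).aestronglyMeasurable
      (.of_forall fun ω => ?_)
    rw [hf₂, norm_mul, Real.norm_of_nonneg (hk0 _)]
    calc k (ϑ ω) * ‖inner ℝ (ϑ ω - θ₀) (ξ n ω)‖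
        ≤ k (ϑ ω) * (‖ϑ ω - θ₀‖ * ‖ξ n ω‖) := by
          gcongr
          · exact hk0 _
          · exact norm_inner_le_norm _ _
      _ = k (ϑ ω) * ‖ϑ ω - θ₀‖ * ‖ξ n ω‖ := by ring
      _ ≤ _ := by gcongr; exact hkn _
  have hf₂e : ∫ ω, f₂ (ϑ ω, ξ n ω) ∂Q = 0 := by
    rw [(integral_of_indepFun hϑ hξ hindξ hf₂m hf₂i).2]
    refine integral_eq_zero_of_ae (.of_forall fun ω => ?_)
    rw [hsampling.ξ_law]
    simp only [hf₂, integral_const_mul]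
    rw [integral_inner hidint, integral_id_stdGaussian, inner_zero_right, mul_zero]
    rfl
  have hf₃e : ∫ ω, lyapunov (ϑ ω - θ₀) * T (ξ n ω) ∂Q =
      (∫ ω, lyapunov (ϑ ω - θ₀) ∂Q) * ∫ y, T y ∂(stdGaussian (EuclideanSpace ℝ (Fin p))) := by
    rw [← hsampling.ξ_law n, integral_map hξ.aemeasurable hTm.aestronglyMeasurable]
    exact (hindξ.comp (φ := fun θ => lyapunov (θ - θ₀)) (by fun_prop)
      hTm).integral_fun_mul_eq_mul_integral hint.aestronglyMeasurable
      (hξint hTm hTi).aestronglyMeasurable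
  have hpt : ∀ ω, lyapunov ((ϑ ω - θ₀) + d ω) ≤
      lyapunov (ϑ ω - θ₀) - η * f₁ (ϑ ω, z n ω) - η * s * f₂ (ϑ ω, ξ n ω) +
        η ^ 2 * (lyapunov (ϑ ω - θ₀) * T (ξ n ω)) := by
    intro ω
    refine (lyapunov_add_le _ _).trans ?_
    have e1 : lyapunov (ϑ ω - θ₀) / √(1 + ‖ϑ ω - θ₀‖ ^ 2) * inner ℝ (ϑ ω - θ₀) (d ω) =
        - η * f₁ (ϑ ω, z n ω) - η * s * f₂ (ϑ ω, ξ n ω) := by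
      simp only [hd, hf₁, hf₂, hk, inner_neg_right, real_inner_smul_right, inner_add_right]
      ring
    have e2 : 2 * ‖d ω‖ ^ 2 * Real.exp ‖d ω‖ ≤ η ^ 2 * T (ξ n ω) := by
      calc _ ≤ 2 * (η * (B₀ + s * ‖ξ n ω‖)) ^ 2 * Real.exp (γ * (B₀ + s * ‖ξ n ω‖)) := by
            gcongr
            · exact hdn ω
            · exact hdn' ω
        _ = _ := by rw [hT]; ring
    rw [e1]
    have := mul_le_mul_of_nonneg_left e2 (hlpos (ϑ ω - θ₀)).le
    linarith
  have hi₁ : Integrable (fun ω => lyapunov (ϑ ω - θ₀) - η * f₁ (ϑ ω, z n ω)) Q :=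
    hint.sub (hf₁i.const_mul η)
  have hi₂ : Integrable (fun ω => lyapunov (ϑ ω - θ₀) - η * f₁ (ϑ ω, z n ω) -
      η * s * f₂ (ϑ ω, ξ n ω)) Q := hi₁.sub (hf₂i.const_mul (η * s))
  have hi₃ := (hprod hTm hTi).const_mul (η ^ 2)
  calc ∫ ω, lyapunov ((ϑ ω - θ₀) + d ω) ∂Q
      ≤ ∫ ω, (lyapunov (ϑ ω - θ₀) - η * f₁ (ϑ ω, z n ω) - η * s * f₂ (ϑ ω, ξ n ω) +
        η ^ 2 * (lyapunov (ϑ ω - θ₀) * T (ξ n ω))) ∂Q :=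
        integral_mono hnew (hi₂.add hi₃) hpt
    _ = ∫ ω, lyapunov (ϑ ω - θ₀) ∂Q - η * ∫ ω, f₁ (ϑ ω, z n ω) ∂Q +
        η ^ 2 * ((∫ ω, lyapunov (ϑ ω - θ₀) ∂Q) *
          ∫ y, T y ∂(stdGaussian (EuclideanSpace ℝ (Fin p)))) := by
        rw [← hf₃e, integral_add hi₂ hi₃, integral_sub hi₁ (hf₂i.const_mul (η * s)),
          integral_sub hint (hf₁i.const_mul η), integral_const_mul, integral_const_mul,
          integral_const_mul, hf₂e, mul_zero, sub_zero]
    _ ≤ _ := by gcongr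

/-- The iterates converge in mean at the rate `n^{-a/2}`. -/
lemma exists_integral_norm_iterate_sub_le (hμ : 0 < μ) (hγ : 0 < γ)
    (ha : a ∈ Set.Ioo (0 : ℝ) 1) (hB₀ : 0 < B₀)
    (hproblem : IsProblem ρ P θ₀) (hsampling : IsSampling P Q z ξ M₁ M₂)
    (hgrad : ∀ θ x, ‖Psi ρ θ x‖ ≤ B₀) (hfactor : HessianFactorizes ρ B₁) (hκ₁ : 0 < κ₁)
    (hκ₁A : κ₁ ≤ lambdaMin (matA ρ P θ₀)) :
    ∃ R > 0, ∀ n : ℕ,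
      Integrable (fun ω =>
        ‖iterate ρ γ a B₀ μ θinit (fun i => z i ω) (fun i => ξ i ω) n - θ₀‖) Q ∧
      ∫ ω, ‖iterate ρ γ a B₀ μ θinit (fun i => z i ω) (fun i => ξ i ω) n - θ₀‖ ∂Q ≤
        R * ((n : ℝ) + 1) ^ (-(a / 2)) := by
  obtain ⟨c, hc, hdrift⟩ := exists_drift hproblem hgrad hfactor hκ₁ hκ₁A
  set ϑ : ℕ → Ω → EuclideanSpace ℝ (Fin p) := fun n ω =>
    iterate ρ γ a B₀ μ θinit (fun i => z i ω) (fun i => ξ i ω) n with hϑ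
  have hϑm : ∀ n, Measurable (ϑ n) := measurable_iterate_sample hproblem hsampling
  have hη : ∀ n : ℕ, 0 ≤ γ * ((n : ℝ) + 1) ^ (-a) := fun n => by positivity
  have hηγ : ∀ n : ℕ, γ * ((n : ℝ) + 1) ^ (-a) ≤ γ := fun n =>
    mul_le_of_le_one_right hγ.le (Real.rpow_le_one_of_one_le_of_nonpos
      (by linarith [n.cast_nonneg (α := ℝ)]) (by linarith [ha.1]))
  have hsucc : ∀ n ω, ϑ (n + 1) ω = ϑ n ω - (γ * ((n : ℝ) + 1) ^ (-a)) •
      (Psi ρ (ϑ n ω) (z n ω) + (2 * B₀ / μ) • ξ n ω) := by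
    intro n ω
    simp only [hϑ, iterate]
    push_cast
    rfl
  set T := ∫ y, 2 * (B₀ + 2 * B₀ / μ * ‖y‖) ^ 2 * Real.exp (γ * (B₀ + 2 * B₀ / μ * ‖y‖))
    ∂(stdGaussian (EuclideanSpace ℝ (Fin p))) with hT
  have hT0 : 0 ≤ T := integral_nonneg fun y => by positivity
  have hstep := fun n hint => integral_lyapunov_step_le (γ := γ) hμ hB₀ hproblem hsampling hgrad hc
    hdrift (hϑm n) (indepFun_iterate hproblem hsampling n) hint (hη n) (hηγ n)
  simp only [← hsucc] at hstep
  have hint : ∀ n, Integrable (fun ω => lyapunov (ϑ n ω - θ₀)) Q := by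
    intro n
    induction n with
    | zero => simp only [hϑ, iterate]; exact integrable_const _
    | succ n ih => exact (hstep n ih).1
  -- Subtracting the minimum `e` of the Lyapunov function gives the recursion the target value `0`.
  set w : ℕ → ℝ := fun n => ∫ ω, (lyapunov (ϑ n ω - θ₀) - Real.exp 1) ∂Q with hw
  have hwe : ∀ n, ∫ ω, lyapunov (ϑ n ω - θ₀) ∂Q = w n + Real.exp 1 := by
    intro n
    simp only [hw]
    rw [integral_sub (hint n) (integrable_const _)]
    simp
  have hw0 : ∀ n, 0 ≤ w n := fun n =>
    integral_nonneg fun ω => (sq_nonneg _).trans (norm_sq_le_lyapunov_sub (ϑ n ω - θ₀))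
  have he1 : 1 ≤ Real.exp 1 := Real.one_le_exp zero_le_one
  obtain ⟨K, hK, hwK⟩ := exists_le_rpow_of_recursion (c := c / 2) (b := Real.exp 1 * T) ha hγ
    (by positivity) (by positivity) hw0 (fun n => by
      have h := (hstep n (hint n)).2
      simp only [hwe] at h
      set η := γ * ((n : ℝ) + 1) ^ (-a)
      have h1 : (w n + Real.exp 1) * T ≤ Real.exp 1 * T * (w n + 1) := by
        have := mul_le_mul_of_nonneg_right he1 (mul_nonneg hT0 (hw0 n))
        nlinarith
      have h2 := mul_le_mul_of_nonneg_left h1 (sq_nonneg η)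
      have h3 : ∫ ω, (lyapunov (ϑ n ω - θ₀) - Real.exp 1) ∂Q = w n := rfl
      rw [h3] at h
      linarith)
  have hsqint : ∀ n, Integrable (fun ω => ‖ϑ n ω - θ₀‖ ^ 2) Q := fun n =>
    ((hint n).sub (integrable_const (Real.exp 1))).mono'
      (((hϑm n).sub_const θ₀).norm.pow_const 2).aestronglyMeasurable
      (.of_forall fun ω => by
        rw [Real.norm_of_nonneg (sq_nonneg _)]; exact norm_sq_le_lyapunov_sub _)
  refine ⟨√K, Real.sqrt_pos.2 hK, fun n => ⟨?_, ?_⟩⟩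
  · refine ((hsqint n).add (integrable_const 1)).mono'
      ((hϑm n).sub_const θ₀).norm.aestronglyMeasurable (.of_forall fun ω => ?_)
    rw [norm_norm]
    simp only [Pi.add_apply]
    nlinarith [sq_nonneg (‖ϑ n ω - θ₀‖ - 1)]
  · have hn : (0 : ℝ) < (n : ℝ) + 1 := by positivity
    have h := integral_abs_le_sqrt (f := fun ω => ‖ϑ n ω - θ₀‖)
      (b := K * ((n : ℝ) + 1) ^ (-a)) (by positivity) (hsqint n)
      (le_trans (integral_mono (hsqint n) ((hint n).sub (integrable_const _))
        fun ω => norm_sq_le_lyapunov_sub _) (hwK n))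
    simp only [abs_norm] at h
    rw [Real.sqrt_mul hK.le, Real.sqrt_eq_rpow (_ ^ _), ← Real.rpow_mul hn.le] at h
    convert h using 3
    ring

end Rate

/-! ### The mean error of the estimator -/

section Estimator

variable {p : ℕ} {Z Ω : Type*}
  {ρ : EuclideanSpace ℝ (Fin p) → Z → ℝ} {γ a B₀ B₁ μ κ₁ κ₂ : ℝ}
  {θ₀ θinit : EuclideanSpace ℝ (Fin p)}

lemma isHermitian_Ahat (hfactor : HessianFactorizes ρ B₁) {n : ℕ} {D : ℕ → Z}
    {x : ℕ → EuclideanSpace ℝ (Fin p)} {M : Matrix (Fin p) (Fin p) ℝ} (hM : M.IsSymm) :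
    (Ahat ρ γ a B₀ B₁ μ θinit n D x M).IsHermitian := by
  rw [isHermitian_iff_isSymm]
  ext i j
  simp only [Ahat, Matrix.transpose_apply, Matrix.add_apply, Matrix.smul_apply, Matrix.sum_apply,
    hM.apply, (isSymm_hessRho hfactor _ _).apply]

lemma isHermitian_Shat {n : ℕ} {D : ℕ → Z}
    {x : ℕ → EuclideanSpace ℝ (Fin p)} {M : Matrix (Fin p) (Fin p) ℝ} (hM : M.IsSymm) :
    (Shat ρ γ a B₀ μ θinit n D x M).IsHermitian := by
  rw [isHermitian_iff_isSymm]
  ext i j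
  simp only [Shat, Matrix.transpose_apply, Matrix.add_apply, Matrix.smul_apply, Matrix.sum_apply,
    hM.apply, (outer_isSymm _).apply, (Matrix.isSymm_one (n := Fin p) (α := ℝ)).apply]

variable [MeasurableSpace Z] [MeasurableSpace Ω] {P : Measure Z} {Q : Measure Ω}

lemma continuous_outer : Continuous (outer : EuclideanSpace ℝ (Fin p) → _) := by
  refine continuous_matrix fun i j => ?_
  simp only [outer, Matrix.of_apply]
  fun_prop

lemma measurable_uncurry_outer_Psi (hproblem : IsProblem ρ P θ₀) :
    Measurable fun q : EuclideanSpace ℝ (Fin p) × Z => outer (Psi ρ q.1 q.2) :=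
  continuous_outer.measurable.comp (measurable_uncurry_Psi hproblem)

variable {α : Type*} [MeasurableSpace α] {D : α → ℕ → Z} {x : α → ℕ → EuclideanSpace ℝ (Fin p)}
  {M N : α → Matrix (Fin p) (Fin p) ℝ}

lemma measurable_sum_along_iterates (hproblem : IsProblem ρ P θ₀)
    {H : EuclideanSpace ℝ (Fin p) → Z → Matrix (Fin p) (Fin p) ℝ}
    (hH : Measurable fun q : EuclideanSpace ℝ (Fin p) × Z => H q.1 q.2)
    (hD : Measurable D) (hx : Measurable x) (n : ℕ) :
    Measurable fun q =>
      (1 / (n : ℝ)) • ∑ i ∈ Finset.range n, H (iterate ρ γ a B₀ μ θinit (D q) (x q) i) (D q i) := by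
  have hterm : ∀ i, Measurable fun q => H (iterate ρ γ a B₀ μ θinit (D q) (x q) i) (D q i) :=
    fun i => Measurable.comp (g := fun q : EuclideanSpace ℝ (Fin p) × Z => H q.1 q.2) hH
      ((measurable_iterate hproblem hD hx i).prodMk ((measurable_pi_apply i).comp hD))
  have hsum : Measurable fun q =>
      ∑ i ∈ Finset.range n, H (iterate ρ γ a B₀ μ θinit (D q) (x q) i) (D q i) :=
    Finset.measurable_fun_sum _ fun i _ => hterm i
  exact hsum.const_smul (1 / (n : ℝ))

lemma measurable_Ahat (hproblem : IsProblem ρ P θ₀) (hD : Measurable D) (hx : Measurable x)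
    (hM : Measurable M) (n : ℕ) :
    Measurable fun q => Ahat ρ γ a B₀ B₁ μ θinit n (D q) (x q) (M q) := by
  have h := measurable_sum_along_iterates (γ := γ) (a := a) (B₀ := B₀) (μ := μ) (θinit := θinit)
    hproblem (measurable_uncurry_hessRho hproblem) hD hx n
  exact h.add (hM.const_smul (2 * B₁ / (n * μ)))

lemma measurable_Shat (hproblem : IsProblem ρ P θ₀) (hD : Measurable D) (hx : Measurable x)
    (hM : Measurable M) (n : ℕ) :
    Measurable fun q => Shat ρ γ a B₀ μ θinit n (D q) (x q) (M q) := by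
  have h := measurable_sum_along_iterates (γ := γ) (a := a) (B₀ := B₀) (μ := μ) (θinit := θinit)
    (H := fun θ x => outer (Psi ρ θ x)) hproblem (measurable_uncurry_outer_Psi hproblem) hD hx n
  exact (h.add_const _).add (hM.const_smul (2 * B₀ ^ 2 / (n * μ)))

lemma measurable_sigmaHat (hproblem : IsProblem ρ P θ₀) (hD : Measurable D) (hx : Measurable x)
    (hM : Measurable M) (hN : Measurable N) (n : ℕ) :
    Measurable fun q => sigmaHat ρ γ a B₀ B₁ μ κ₁ κ₂ θinit n (D q) (x q) (M q) (N q) := by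
  have hmul : Continuous fun q : Matrix (Fin p) (Fin p) ℝ × Matrix (Fin p) (Fin p) ℝ =>
    q.1 * q.2 * q.1 := by fun_prop
  have hA := (measurable_matrix_inv.comp (measurable_truncate κ₁)).comp
    (measurable_Ahat (γ := γ) (a := a) (B₀ := B₀) (B₁ := B₁) (μ := μ) (θinit := θinit)
      hproblem hD hx hM n)
  have hS := (measurable_truncate κ₂).comp
    (measurable_Shat (γ := γ) (a := a) (B₀ := B₀) (μ := μ) (θinit := θinit) hproblem hD hx hN n)
  have h := hmul.measurable.comp (hA.prodMk hS)
  simp only [Function.comp_def] at h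
  simpa only [sigmaHat] using h

lemma isHermitian_matStilde : (matStilde ρ P θ₀ B₀ μ).IsHermitian := by
  have h := isHermitian_iff_isSymm.1 (isHermitian_matS (ρ := ρ) (P := P) (θ₀ := θ₀))
  rw [isHermitian_iff_isSymm]
  ext i j
  simp only [matStilde, Matrix.transpose_apply, Matrix.add_apply, Matrix.smul_apply,
    h.apply, (Matrix.isSymm_one (n := Fin p) (α := ℝ)).apply]

lemma IsSymmGaussian.integrable_norm {M : Ω → Matrix (Fin p) (Fin p) ℝ}
    (hM : IsSymmGaussian M Q) : Integrable (fun ω => ‖M ω‖) Q := by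
  have hentry : ∀ i j, Measurable fun ω => M ω i j := measurable_matrix_iff.1 hM.measurable
  have hle : ∀ i j, i ≤ j → Integrable (fun ω => M ω i j) Q := by
    intro i j hij
    have h : Integrable id (Q.map fun ω => M ω i j) := by
      rw [hM.law i j hij]
      exact IsGaussian.integrable_id
    exact (integrable_map_measure aestronglyMeasurable_id (hentry i j).aemeasurable).1 h
  have hall : ∀ i j, Integrable (fun ω => M ω i j) Q := by
    intro i j
    rcases le_total i j with h | h
    · exact hle i j h
    · simpa only [(hM.symm _).apply] using hle j i h
  refine (integrable_finsetSum Finset.univ fun i _ => integrable_finsetSum Finset.univ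
    fun j _ => (hall i j).abs).mono' ?_ (.of_forall fun ω => ?_)
  · exact (continuous_norm.measurable.comp hM.measurable).aestronglyMeasurable
  · rw [norm_norm]
    exact norm_le_sum_abs _

lemma rpow_neg_le_rpow_neg {s t : ℝ} (h : s ≤ t) {n : ℕ} (hn : 1 ≤ n) :
    (n : ℝ) ^ (-t) ≤ (n : ℝ) ^ (-s) :=
  Real.rpow_le_rpow_of_exponent_le (by exact_mod_cast hn) (by linarith)

variable [IsProbabilityMeasure Q]
  {z : ℕ → Ω → Z} {ξ : ℕ → Ω → EuclideanSpace ℝ (Fin p)}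
  {M₁ M₂ : Ω → Matrix (Fin p) (Fin p) ℝ}

/-- The mean along the iterates of a bounded matrix function that is Lipschitz in mean at `θ₀`
approaches its expectation at `θ₀`. -/
lemma exists_integral_norm_mean_sub_le (ha : a ∈ Set.Ioo (0 : ℝ) 1)
    (hproblem : IsProblem ρ P θ₀) (hsampling : IsSampling P Q z ξ M₁ M₂)
    {H : EuclideanSpace ℝ (Fin p) → Z → Matrix (Fin p) (Fin p) ℝ}
    (hH : Measurable fun q : EuclideanSpace ℝ (Fin p) × Z => H q.1 q.2)
    {b K R : ℝ} (hb : 0 < b) (hK : 0 < K) (hR : 0 < R) (hHb : ∀ θ x, ‖H θ x‖ ≤ b)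
    (hHlip : ∀ θ, ∫ x, ‖H θ x - H θ₀ x‖ ∂P ≤ K * ‖θ - θ₀‖)
    (hrate : ∀ n : ℕ,
      Integrable (fun ω =>
        ‖iterate ρ γ a B₀ μ θinit (fun i => z i ω) (fun i => ξ i ω) n - θ₀‖) Q ∧
      ∫ ω, ‖iterate ρ γ a B₀ μ θinit (fun i => z i ω) (fun i => ξ i ω) n - θ₀‖ ∂Q ≤
        R * ((n : ℝ) + 1) ^ (-(a / 2))) :
    ∃ C > 0, ∀ n : ℕ, 1 ≤ n →
      Integrable (fun ω => ‖(1 / (n : ℝ)) • ∑ i ∈ Finset.range n,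
        H (iterate ρ γ a B₀ μ θinit (fun i => z i ω) (fun i => ξ i ω) i) (z i ω) -
          Matrix.of fun i j => ∫ x, H θ₀ x i j ∂P‖) Q ∧
      ∫ ω, ‖(1 / (n : ℝ)) • ∑ i ∈ Finset.range n,
        H (iterate ρ γ a B₀ μ θinit (fun i => z i ω) (fun i => ξ i ω) i) (z i ω) -
          Matrix.of fun i j => ∫ x, H θ₀ x i j ∂P‖ ∂Q ≤ C * (n : ℝ) ^ (-(a / 2)) := by
  set ϑ : ℕ → Ω → EuclideanSpace ℝ (Fin p) := fun n ω =>
    iterate ρ γ a B₀ μ θinit (fun i => z i ω) (fun i => ξ i ω) n with hϑ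
  have hϑm : ∀ n, Measurable (ϑ n) := measurable_iterate_sample hproblem hsampling
  have hz := hsampling.z_measurable
  set Mbar : Matrix (Fin p) (Fin p) ℝ := Matrix.of fun i j => ∫ x, H θ₀ x i j ∂P with hMbar
  have hH₀ : ∀ j k, Measurable fun x => H θ₀ x j k := fun j k =>
    (measurable_matrix_iff.1 hH j k).comp (measurable_prodMk_left (x := θ₀))
  have hD : Measurable fun q : EuclideanSpace ℝ (Fin p) × Z => ‖H q.1 q.2 - H θ₀ q.2‖ := by
    refine continuous_norm.measurable.comp (hH.sub ?_)
    exact Measurable.comp (g := fun q : EuclideanSpace ℝ (Fin p) × Z => H q.1 q.2) hH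
      (f := fun q : EuclideanSpace ℝ (Fin p) × Z => (θ₀, q.2)) (by fun_prop)
  have hterm_int : ∀ i, Integrable (fun ω => ‖H (ϑ i ω) (z i ω) - H θ₀ (z i ω)‖) Q := fun i =>
    .of_bound (hD.comp ((hϑm i).prodMk (hz i))).aestronglyMeasurable (b + b)
      (.of_forall fun ω => by
        rw [norm_norm]
        exact (norm_sub_le _ _).trans (add_le_add (hHb _ _) (hHb _ _)))
  have hterm : ∀ i, ∫ ω, ‖H (ϑ i ω) (z i ω) - H θ₀ (z i ω)‖ ∂Q ≤
      K * (R * ((i : ℝ) + 1) ^ (-(a / 2))) := by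
    intro i
    have hind : IndepFun (ϑ i) (z i) Q :=
      (indepFun_iterate hproblem hsampling i).comp measurable_id measurable_fst
    obtain ⟨h1, h2⟩ := integral_of_indepFun (hϑm i) (hz i) hind hD (hterm_int i)
    simp only [hsampling.z_law] at h1 h2
    rw [h2]
    calc _ ≤ ∫ ω, K * ‖ϑ i ω - θ₀‖ ∂Q :=
          integral_mono h1 ((hrate i).1.const_mul K) fun ω => hHlip _
      _ = K * ∫ ω, ‖ϑ i ω - θ₀‖ ∂Q := integral_const_mul _ _
      _ ≤ _ := by gcongr; exact (hrate i).2
  refine ⟨K * R * (1 - a / 2)⁻¹ + p * (p * b) + 1, ?_, fun n hn => ?_⟩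
  · have : 0 < 1 - a / 2 := by linarith [ha.2]
    positivity
  have hn0 : (0 : ℝ) < n := by exact_mod_cast hn
  have hempi : ∀ j k, Integrable (fun ω =>
      |(1 / (n : ℝ)) * ∑ i ∈ Finset.range n, H θ₀ (z i ω) j k - ∫ x, H θ₀ x j k ∂P|) Q := by
    intro j k
    refine Integrable.abs (Integrable.sub (Integrable.const_mul (integrable_finsetSum _
      fun i _ => ?_) _) (integrable_const _))
    exact .of_bound ((hH₀ j k).comp (hz i)).aestronglyMeasurable b
      (.of_forall fun ω => (abs_entry_le_norm _ j k).trans (hHb _ _))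
  have hemp : ∀ j k, ∫ ω, |(1 / (n : ℝ)) * ∑ i ∈ Finset.range n, H θ₀ (z i ω) j k -
      ∫ x, H θ₀ x j k ∂P| ∂Q ≤ b * (n : ℝ) ^ (-(a / 2)) := by
    intro j k
    refine (integral_abs_mean_sub_le hz hsampling.z_law hsampling.z_indep (hH₀ j k) hb
      (fun x => (abs_entry_le_norm _ j k).trans (hHb _ _)) hn).trans ?_
    -- The empirical error `n^{-1/2}` is absorbed into `n^{-a/2}` because `a < 1`.
    rw [div_eq_mul_inv, Real.sqrt_eq_rpow, ← Real.rpow_neg hn0.le]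
    gcongr
    · exact_mod_cast hn
    · exact ha.2.le
  have hpt : ∀ ω, ‖(1 / (n : ℝ)) • ∑ i ∈ Finset.range n, H (ϑ i ω) (z i ω) - Mbar‖ ≤
      (1 / (n : ℝ)) * ∑ i ∈ Finset.range n, ‖H (ϑ i ω) (z i ω) - H θ₀ (z i ω)‖ +
        ∑ j, ∑ k, |(1 / (n : ℝ)) * ∑ i ∈ Finset.range n, H θ₀ (z i ω) j k -
          ∫ x, H θ₀ x j k ∂P| := by
    intro ω
    -- Two sources of error: evaluation at the iterates instead of `θ₀`, and the fluctuation of an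
    -- i.i.d. mean at `θ₀`.
    have e : (1 / (n : ℝ)) • ∑ i ∈ Finset.range n, H (ϑ i ω) (z i ω) - Mbar =
        (1 / (n : ℝ)) • ∑ i ∈ Finset.range n, (H (ϑ i ω) (z i ω) - H θ₀ (z i ω)) +
          ((1 / (n : ℝ)) • ∑ i ∈ Finset.range n, H θ₀ (z i ω) - Mbar) := by
      rw [Finset.sum_sub_distrib, smul_sub]; abel
    rw [e]
    refine (norm_add_le _ _).trans (add_le_add ?_ ?_)
    · rw [norm_smul, Real.norm_of_nonneg (by positivity)]
      gcongr
      exact norm_sum_le _ _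
    · refine (norm_le_sum_abs _).trans (le_of_eq ?_)
      simp [hMbar, Matrix.sum_apply]
  have hint₁ : Integrable (fun ω => (1 / (n : ℝ)) * ∑ i ∈ Finset.range n,
      ‖H (ϑ i ω) (z i ω) - H θ₀ (z i ω)‖) Q :=
    (integrable_finsetSum _ fun i _ => hterm_int i).const_mul _
  have hint₂ : Integrable (fun ω => ∑ j, ∑ k, |(1 / (n : ℝ)) * ∑ i ∈ Finset.range n,
      H θ₀ (z i ω) j k - ∫ x, H θ₀ x j k ∂P|) Q :=
    integrable_finsetSum _ fun j _ => integrable_finsetSum _ fun k _ => hempi j k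
  have hmeas : Measurable fun ω =>
      ‖(1 / (n : ℝ)) • ∑ i ∈ Finset.range n, H (ϑ i ω) (z i ω) - Mbar‖ := by
    refine continuous_norm.measurable.comp (Measurable.sub_const ?_ Mbar)
    exact measurable_sum_along_iterates hproblem hH (measurable_pi_lambda _ hz)
      (measurable_pi_lambda _ hsampling.ξ_measurable) n
  have hint : Integrable (fun ω =>
      ‖(1 / (n : ℝ)) • ∑ i ∈ Finset.range n, H (ϑ i ω) (z i ω) - Mbar‖) Q :=
    (hint₁.add hint₂).mono' hmeas.aestronglyMeasurable (.of_forall fun ω => by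
      rw [norm_norm]; exact hpt ω)
  refine ⟨hint, ?_⟩
  calc _ ≤ ∫ ω, ((1 / (n : ℝ)) * ∑ i ∈ Finset.range n, ‖H (ϑ i ω) (z i ω) - H θ₀ (z i ω)‖ +
        ∑ j, ∑ k, |(1 / (n : ℝ)) * ∑ i ∈ Finset.range n, H θ₀ (z i ω) j k -
          ∫ x, H θ₀ x j k ∂P|) ∂Q := integral_mono hint (hint₁.add hint₂) hpt
    _ = (1 / (n : ℝ)) * ∑ i ∈ Finset.range n, ∫ ω, ‖H (ϑ i ω) (z i ω) - H θ₀ (z i ω)‖ ∂Q +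
        ∑ j, ∑ k, ∫ ω, |(1 / (n : ℝ)) * ∑ i ∈ Finset.range n, H θ₀ (z i ω) j k -
          ∫ x, H θ₀ x j k ∂P| ∂Q := by
        rw [integral_add hint₁ hint₂, integral_const_mul,
          integral_finsetSum _ fun i _ => hterm_int i,
          integral_finsetSum _ fun j _ => integrable_finsetSum _ fun k _ => hempi j k]
        congr 1
        exact Finset.sum_congr rfl fun j _ => integral_finsetSum _ fun k _ => hempi j k
    _ ≤ (1 / (n : ℝ)) * ∑ i ∈ Finset.range n, K * (R * ((i : ℝ) + 1) ^ (-(a / 2))) +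
        ∑ _j : Fin p, ∑ _k : Fin p, b * (n : ℝ) ^ (-(a / 2)) := by
        gcongr with i _ j _ k _
        · exact hterm i
        · exact hemp j k
    _ ≤ (1 / (n : ℝ)) * (K * (R * ((1 - a / 2)⁻¹ * (n : ℝ) ^ (1 - a / 2)))) +
        p * (p * b) * (n : ℝ) ^ (-(a / 2)) := by
        rw [← Finset.mul_sum, ← Finset.mul_sum]
        gcongr
        · exact sum_rpow_neg_le ⟨by linarith [ha.1], by linarith [ha.2]⟩ n
        · simp only [Finset.sum_const, Finset.card_univ, Fintype.card_fin, nsmul_eq_mul]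
          exact le_of_eq (by ring)
    _ = (K * R * (1 - a / 2)⁻¹ + p * (p * b)) * (n : ℝ) ^ (-(a / 2)) := by
        have : (n : ℝ) ^ (1 - a / 2) = n * (n : ℝ) ^ (-(a / 2)) := by
          rw [sub_eq_add_neg, Real.rpow_add hn0, Real.rpow_one]
        rw [this]
        field_simp
    _ ≤ _ := mul_le_mul_of_nonneg_right (by linarith) (by positivity)

variable [IsProbabilityMeasure P]

/-- If `B₁ ≤ 0` all Hessians vanish, hence `A = 0`, against `κ₁ > 0`. Here `S ≠ 0` only supplies an
index, that is `p ≥ 1`. -/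
lemma pos_of_le_lambdaMin_matA (hproblem : IsProblem ρ P θ₀) (hgrad : ∀ θ x, ‖Psi ρ θ x‖ ≤ B₀)
    (hfactor : HessianFactorizes ρ B₁) (hS : matS ρ P θ₀ ≠ 0) (hκ₁ : 0 < κ₁)
    (hκ₁A : κ₁ ≤ lambdaMin (matA ρ P θ₀)) : 0 < B₁ := by
  obtain ⟨i, j, -⟩ : ∃ i j, matS ρ P θ₀ i j ≠ 0 := by
    by_contra! h
    exact hS (by ext i j; exact h i j)
  by_contra! hB
  have hzero : ∀ x, hessRho ρ θ₀ x = 0 := fun x =>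
    norm_le_zero_iff.1 ((norm_hessRho_le hfactor θ₀ x).trans hB)
  have h := mul_norm_sq_le_dotProduct_mulVec (isHermitian_matA hproblem hgrad hfactor)
    (spectrum_ge_of_le_lambdaMin hκ₁A) (EuclideanSpace.single i 1)
  have hA : matA ρ P θ₀ = 0 := by
    rw [matA_eq hproblem hgrad hfactor]
    ext i j
    simp [hzero]
  rw [hA] at h
  simp at h
  linarith

/-- The estimator converges in mean to the sandwich matrix at the rate `n^{-a/2}`. -/
lemma exists_integral_norm_sigmaHat_sub_le (hμ : 0 < μ) (hγ : 0 < γ)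
    (ha : a ∈ Set.Ioo (0 : ℝ) 1) (hB₀ : 0 < B₀) {K C₃ : ℝ} (hK : 0 < K)
    (hproblem : IsProblem ρ P θ₀) (hsampling : IsSampling P Q z ξ M₁ M₂)
    (hgrad : ∀ θ x, ‖Psi ρ θ x‖ ≤ B₀) (hfactor : HessianFactorizes ρ B₁)
    (hlip : HessianLipschitz ρ P θ₀ K C₃) (hκ₁ : 0 < κ₁)
    (hκ₁A : κ₁ ≤ lambdaMin (matA ρ P θ₀)) (hκ₂S : κ₂ ≤ lambdaMin (matStilde ρ P θ₀ B₀ μ))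
    (hS : matS ρ P θ₀ ≠ 0) :
    ∃ C > 0, ∀ n : ℕ, 1 ≤ n →
      Integrable (fun ω =>
        ‖sigmaHat ρ γ a B₀ B₁ μ κ₁ κ₂ θinit n (fun i => z i ω) (fun i => ξ i ω) (M₁ ω) (M₂ ω) -
          (matA ρ P θ₀)⁻¹ * matStilde ρ P θ₀ B₀ μ * (matA ρ P θ₀)⁻¹‖) Q ∧
      ∫ ω,
        ‖sigmaHat ρ γ a B₀ B₁ μ κ₁ κ₂ θinit n (fun i => z i ω) (fun i => ξ i ω) (M₁ ω) (M₂ ω) -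
          (matA ρ P θ₀)⁻¹ * matStilde ρ P θ₀ B₀ μ * (matA ρ P θ₀)⁻¹‖ ∂Q ≤
        C * (n : ℝ) ^ (-(a / 2)) := by
  have hB₁ := pos_of_le_lambdaMin_matA hproblem hgrad hfactor hS hκ₁ hκ₁A
  obtain ⟨R, hR, hrate⟩ := exists_integral_norm_iterate_sub_le (θinit := θinit) hμ hγ ha hB₀
    hproblem hsampling hgrad hfactor hκ₁ hκ₁A
  obtain ⟨CA, hCA, hA⟩ := exists_integral_norm_mean_sub_le ha hproblem hsampling
    (measurable_uncurry_hessRho hproblem) hB₁ hK hR (norm_hessRho_le hfactor) hlip.lipschitz hrate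
  -- The outer products are Lipschitz in `θ` with constant `2 B₀ B₁`: `B₀` bounds the gradients and
  -- `B₁` is their Lipschitz constant.
  obtain ⟨CS, hCS, hSm⟩ := exists_integral_norm_mean_sub_le
    (H := fun θ x => outer (Psi ρ θ x)) (b := B₀ ^ 2) (K := (B₀ + B₀) * B₁) ha hproblem hsampling
    (measurable_uncurry_outer_Psi hproblem) (by positivity) (by positivity) hR
    (fun θ x => (norm_outer_le _).trans (by gcongr; exact hgrad θ x))
    (fun θ => by
      calc _ ≤ ∫ _x, (B₀ + B₀) * B₁ * ‖θ - θ₀‖ ∂P :=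
            integral_mono_of_nonneg (.of_forall fun _ => norm_nonneg _) (integrable_const _)
              (.of_forall fun x => by
                refine (norm_outer_sub_outer_le _ _).trans ?_
                exact (mul_le_mul (add_le_add (hgrad _ _) (hgrad _ _))
                  (norm_Psi_sub_le hproblem hfactor _ _ _) (norm_nonneg _)
                  (by positivity)).trans_eq (mul_assoc _ _ _).symm)
        _ = _ := by simp) hrate
  have hMi₁ := hsampling.M₁_gaussian.integrable_norm
  have hMi₂ := hsampling.M₂_gaussian.integrable_norm
  set k₁ := 4 * κ₁⁻¹ ^ 3 * ‖matStilde ρ P θ₀ B₀ μ‖ with hk₁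
  set k₂ := 2 * κ₁⁻¹ ^ 2 with hk₂
  have hk₁0 : 0 ≤ k₁ := by positivity
  have hk₂0 : 0 ≤ k₂ := by positivity
  set m₁ := ∫ ω, ‖M₁ ω‖ ∂Q with hm₁
  set m₂ := ∫ ω, ‖M₂ ω‖ ∂Q with hm₂
  have hm₁0 : 0 ≤ m₁ := integral_nonneg fun _ => norm_nonneg _
  have hm₂0 : 0 ≤ m₂ := integral_nonneg fun _ => norm_nonneg _
  refine ⟨k₁ * (CA + 2 * B₁ / μ * m₁) + k₂ * (CS + 2 * B₀ ^ 2 / μ * m₂) + 1, by positivity,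
    fun n hn => ?_⟩
  have hn0 : (0 : ℝ) < n := by exact_mod_cast hn
  obtain ⟨hAi, hAe⟩ := hA n hn
  obtain ⟨hSi, hSe⟩ := hSm n hn
  rw [← matA_eq hproblem hgrad hfactor] at hAi hAe
  set eA : Ω → ℝ := fun ω => ‖(1 / (n : ℝ)) • ∑ i ∈ Finset.range n,
    hessRho ρ (iterate ρ γ a B₀ μ θinit (fun i => z i ω) (fun i => ξ i ω) i) (z i ω) -
      matA ρ P θ₀‖ with heA
  set eS : Ω → ℝ := fun ω => ‖(1 / (n : ℝ)) • ∑ i ∈ Finset.range n,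
    outer (Psi ρ (iterate ρ γ a B₀ μ θinit (fun i => z i ω) (fun i => ξ i ω) i) (z i ω)) -
      matS ρ P θ₀‖ with heS
  have hSi' : Integrable eS Q := hSi
  have hSe' : ∫ ω, eS ω ∂Q ≤ CS * (n : ℝ) ^ (-(a / 2)) := hSe
  have hpt : ∀ ω,
      ‖sigmaHat ρ γ a B₀ B₁ μ κ₁ κ₂ θinit n (fun i => z i ω) (fun i => ξ i ω) (M₁ ω) (M₂ ω) -
          (matA ρ P θ₀)⁻¹ * matStilde ρ P θ₀ B₀ μ * (matA ρ P θ₀)⁻¹‖ ≤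
        k₁ * (eA ω + 2 * B₁ / (n * μ) * ‖M₁ ω‖) + k₂ * (eS ω + 2 * B₀ ^ 2 / (n * μ) * ‖M₂ ω‖) := by
    intro ω
    refine (norm_sandwich_sub_le (isHermitian_matA hproblem hgrad hfactor) isHermitian_matStilde
      (isHermitian_Ahat hfactor (hsampling.M₁_gaussian.symm ω))
      (isHermitian_Shat (hsampling.M₂_gaussian.symm ω)) hκ₁ (spectrum_ge_of_le_lambdaMin hκ₁A)
      (spectrum_ge_of_le_lambdaMin hκ₂S)).trans ?_
    gcongr
    · rw [Ahat, add_sub_right_comm]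
      refine (norm_add_le _ _).trans (add_le_add le_rfl ?_)
      rw [norm_smul, Real.norm_of_nonneg (by positivity)]
    · have e : Shat ρ γ a B₀ μ θinit n (fun i => z i ω) (fun i => ξ i ω) (M₂ ω) -
          matStilde ρ P θ₀ B₀ μ = ((1 / (n : ℝ)) • ∑ i ∈ Finset.range n,
          outer (Psi ρ (iterate ρ γ a B₀ μ θinit (fun i => z i ω) (fun i => ξ i ω) i) (z i ω)) -
          matS ρ P θ₀) + (2 * B₀ ^ 2 / (n * μ)) • M₂ ω := by
        rw [Shat, matStilde]; abel
      rw [e]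
      refine (norm_add_le _ _).trans (add_le_add le_rfl ?_)
      rw [norm_smul, Real.norm_of_nonneg (by positivity)]
  have hi₁ : Integrable (fun ω => k₁ * (eA ω + 2 * B₁ / (n * μ) * ‖M₁ ω‖)) Q :=
    (hAi.add (hMi₁.const_mul _)).const_mul _
  have hi₂ : Integrable (fun ω => k₂ * (eS ω + 2 * B₀ ^ 2 / (n * μ) * ‖M₂ ω‖)) Q :=
    (hSi'.add (hMi₂.const_mul _)).const_mul _
  have hmeas : Measurable fun ω =>
      ‖sigmaHat ρ γ a B₀ B₁ μ κ₁ κ₂ θinit n (fun i => z i ω) (fun i => ξ i ω) (M₁ ω) (M₂ ω) -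
          (matA ρ P θ₀)⁻¹ * matStilde ρ P θ₀ B₀ μ * (matA ρ P θ₀)⁻¹‖ := by
    refine continuous_norm.measurable.comp (Measurable.sub_const ?_ _)
    exact measurable_sigmaHat hproblem (measurable_pi_lambda _ hsampling.z_measurable)
      (measurable_pi_lambda _ hsampling.ξ_measurable) hsampling.M₁_gaussian.measurable
      hsampling.M₂_gaussian.measurable n
  have hint := (hi₁.add hi₂).mono' hmeas.aestronglyMeasurable (.of_forall fun ω => by
      rw [norm_norm]; exact hpt ω)
  refine ⟨hint, (integral_mono hint (hi₁.add hi₂) hpt).trans ?_⟩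
  -- The privacy noise of the matrices is of order `n⁻¹`, below the rate of the iterates.
  have hninv : (n : ℝ)⁻¹ ≤ (n : ℝ) ^ (-(a / 2)) := by
    rw [← Real.rpow_neg_one]
    exact rpow_neg_le_rpow_neg (by linarith [ha.2]) hn
  have h1 : 2 * B₁ / (n * μ) * m₁ ≤ 2 * B₁ / μ * m₁ * (n : ℝ) ^ (-(a / 2)) := by
    calc _ = 2 * B₁ / μ * m₁ * (n : ℝ)⁻¹ := by field_simp
      _ ≤ _ := by gcongr
  have h2 : 2 * B₀ ^ 2 / (n * μ) * m₂ ≤ 2 * B₀ ^ 2 / μ * m₂ * (n : ℝ) ^ (-(a / 2)) := by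
    calc _ = 2 * B₀ ^ 2 / μ * m₂ * (n : ℝ)⁻¹ := by field_simp
      _ ≤ _ := by gcongr
  have hv : (0 : ℝ) < (n : ℝ) ^ (-(a / 2)) := by positivity
  calc _ = k₁ * (∫ ω, eA ω ∂Q + 2 * B₁ / (n * μ) * m₁) +
        k₂ * (∫ ω, eS ω ∂Q + 2 * B₀ ^ 2 / (n * μ) * m₂) := by
        rw [integral_add' hi₁ hi₂, integral_const_mul, integral_const_mul,
          integral_add hAi (hMi₁.const_mul _), integral_add hSi' (hMi₂.const_mul _),
          integral_const_mul, integral_const_mul]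
    _ ≤ k₁ * (CA * (n : ℝ) ^ (-(a / 2)) + 2 * B₁ / μ * m₁ * (n : ℝ) ^ (-(a / 2))) +
        k₂ * (CS * (n : ℝ) ^ (-(a / 2)) + 2 * B₀ ^ 2 / μ * m₂ * (n : ℝ) ^ (-(a / 2))) := by
        gcongr
    _ ≤ _ := by linarith

end Estimator

/-! ### Trade-off functions and Gaussian shifts -/

section Tradeoff

lemma integral_mem_Icc {X : Type*} [MeasurableSpace X] {P : Measure X} [IsProbabilityMeasure P]
    {φ : X → ℝ} (hφ : ∀ x, φ x ∈ Set.Icc (0 : ℝ) 1) : ∫ x, φ x ∂P ∈ Set.Icc (0 : ℝ) 1 := by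
  refine ⟨integral_nonneg fun x => (hφ x).1, ?_⟩
  calc _ ≤ ∫ _x, (1 : ℝ) ∂P := integral_mono_of_nonneg (.of_forall fun x => (hφ x).1)
        (integrable_const _) (.of_forall fun x => (hφ x).2)
    _ = 1 := by simp

/-- A trade-off function is dominated if every test of the second problem can be simulated in the
first one. -/
lemma tradeoff_le_tradeoff {X Y : Type*} [MeasurableSpace X] [MeasurableSpace Y]
    {P Q : Measure X} {P' Q' : Measure Y} [IsProbabilityMeasure Q] {a : ℝ} (ha : 0 ≤ a)
    (h : ∀ φ : Y → ℝ, Measurable φ → (∀ y, φ y ∈ Set.Icc (0 : ℝ) 1) →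
      ∃ φ' : X → ℝ, Measurable φ' ∧ (∀ x, φ' x ∈ Set.Icc (0 : ℝ) 1) ∧
        ∫ x, φ' x ∂P = ∫ y, φ y ∂P' ∧ ∫ x, φ' x ∂Q = ∫ y, φ y ∂Q') :
    tradeoff P Q a ≤ tradeoff P' Q' a := by
  refine le_csInf ⟨1, fun _ => 0, measurable_const, by simp, by simpa, by simp⟩ ?_
  rintro b ⟨φ, hφ, hφ1, hφa, rfl⟩
  obtain ⟨φ', hφ', hφ'1, e1, e2⟩ := h φ hφ hφ1
  -- The infimum of reals is meaningful only over a set bounded below; type II errors are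
  -- nonnegative.
  refine csInf_le ⟨0, ?_⟩ ⟨φ', hφ', hφ'1, by rwa [e1], by rw [e2]⟩
  rintro b ⟨ψ, hψ, hψ1, -, rfl⟩
  exact sub_nonneg.2 (integral_mem_Icc hψ1).2

variable {E : Type*} [NormedAddCommGroup E] [InnerProductSpace ℝ E]

/-- For `‖v‖ ≤ t` and independent `y ~ N(s, 1)`, `w ~ N(0, I)`, the vector
`gaussianSimulation t v (y, w)` is distributed as `N((s / t) v, I)`. -/
def gaussianSimulation (t : ℝ) (v : E) (q : ℝ × E) : E :=
  (q.1 / t) • v + (q.2 - ((t ^ 2 * (1 + √(1 - ‖v‖ ^ 2 / t ^ 2)))⁻¹ * inner ℝ v q.2) • v)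

variable [FiniteDimensional ℝ E] [MeasurableSpace E] [BorelSpace E]

lemma measurable_gaussianSimulation {α : Type*} [MeasurableSpace α] (t : ℝ) {v : α → E}
    {y : α → ℝ} {w : α → E} (hv : Measurable v) (hy : Measurable y) (hw : Measurable w) :
    Measurable fun x => gaussianSimulation t (v x) (y x, w x) := by
  have h : Measurable fun x => (inner ℝ (v x) (w x) : ℝ) := hv.inner hw
  unfold gaussianSimulation
  fun_prop

/-- The first summand has mean `(s / t) v` and covariance `v vᵀ / t²`. The second is `(I - c v vᵀ)
w`, where `I - c v vᵀ` is the square root of `I - v vᵀ / t²`, so the covariances add up to `I`.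
Writing `c = 1 / (t² (1 + √(1 - ‖v‖² / t²)))` avoids dividing by `‖v‖²` and covers `v = 0`. -/
lemma map_gaussianSimulation {t : ℝ} (ht : 0 < t) {v : E} (hv : ‖v‖ ≤ t) (s : ℝ) :
    ((gaussianReal s 1).prod (stdGaussian E)).map (gaussianSimulation t v) =
      (stdGaussian E).map (fun g => g + (s / t) • v) := by
  have hm : Measurable (gaussianSimulation t v) :=
    measurable_gaussianSimulation t measurable_const measurable_fst measurable_snd
  have := Measure.isProbabilityMeasure_map
    (μ := (gaussianReal s 1).prod (stdGaussian E)) hm.aemeasurable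
  have := Measure.isProbabilityMeasure_map (μ := stdGaussian E)
    (f := fun g => g + (s / t) • v) (by fun_prop)
  refine Measure.ext_of_charFun ?_
  ext u
  set w := √(1 - ‖v‖ ^ 2 / t ^ 2) with hw
  have hw0 : 0 ≤ w := Real.sqrt_nonneg _
  have hw2 : w ^ 2 = 1 - ‖v‖ ^ 2 / t ^ 2 := by
    refine Real.sq_sqrt (sub_nonneg.2 ((div_le_one (by positivity)).2 ?_))
    gcongr
  have hv2 : ‖v‖ ^ 2 = t ^ 2 * (1 - w ^ 2) := by rw [hw2]; field_simp; ring
  set c := (t ^ 2 * (1 + w))⁻¹ with hc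
  set β : ℝ := inner ℝ v u with hβ
  set u' := u - (c * β) • v with hu'
  -- This is `(I - c v vᵀ)² = I - v vᵀ / t²` as a quadratic form, the identity that makes the
  -- characteristic functions match.
  have hnorm : ‖u'‖ ^ 2 = ‖u‖ ^ 2 - (β / t) ^ 2 := by
    rw [hu', norm_sub_sq_real, norm_smul, mul_pow, Real.norm_eq_abs, sq_abs,
      real_inner_smul_right, real_inner_comm, ← hβ, hv2]
    have h1 : 1 + w ≠ 0 := by positivity
    rw [hc]
    field_simp
    ring
  have hinner : ∀ q : ℝ × E, inner ℝ (gaussianSimulation t v q) u =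
      q.1 * (β / t) + inner ℝ q.2 u' := by
    intro q
    rw [gaussianSimulation, ← hw, ← hc, hu', inner_add_left, inner_sub_left, inner_sub_right,
      real_inner_smul_left, real_inner_smul_left, real_inner_smul_right, ← hβ,
      real_inner_comm v q.2]
    ring
  rw [charFun_map_add_const, charFun_stdGaussian, charFun_apply, integral_map hm.aemeasurable
    (by fun_prop)]
  have hexp : ∀ q : ℝ × E, Complex.exp (((inner ℝ (gaussianSimulation t v q) u : ℝ) : ℂ) *
      Complex.I) = Complex.exp (((q.1 * (β / t) : ℝ) : ℂ) * Complex.I) *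
        Complex.exp (((inner ℝ q.2 u' : ℝ) : ℂ) * Complex.I) := by
    intro q
    rw [hinner, ← Complex.exp_add]
    push_cast
    ring_nf
  simp only [hexp]
  rw [integral_prod_mul (fun y : ℝ => Complex.exp (((y * (β / t) : ℝ) : ℂ) * Complex.I))
    (fun g : E => Complex.exp (((inner ℝ g u' : ℝ) : ℂ) * Complex.I))]
  have h1 : ∫ y, Complex.exp (((y * (β / t) : ℝ) : ℂ) * Complex.I) ∂(gaussianReal s 1) =
      charFun (gaussianReal s 1) (β / t) := by
    rw [charFun_apply_real]
    congr 1
    ext y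
    push_cast
    ring_nf
  have h2 : ∫ g, Complex.exp (((inner ℝ g u' : ℝ) : ℂ) * Complex.I) ∂(stdGaussian E) =
      charFun (stdGaussian E) u' := (charFun_apply _).symm
  rw [h1, h2, charFun_gaussianReal, charFun_stdGaussian, ← Complex.exp_add, ← Complex.exp_add,
    real_inner_smul_left, ← hβ]
  have hnormC : (‖u'‖ : ℂ) ^ 2 = ‖u‖ ^ 2 - (β / t) ^ 2 := by exact_mod_cast hnorm
  rw [hnormC]
  congr 1
  push_cast
  ring

/-- Testing a common mixture of Gaussian vectors against shifts of length at most `t` is at least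
as hard as testing `N(0, 1)` against `N(t, 1)`. -/
lemma tradeoff_gaussianReal_le {A X : Type*} [MeasurableSpace A] [MeasurableSpace X]
    (ν : Measure A) [IsProbabilityMeasure ν] {F : A × E → X} (hF : Measurable F)
    {v : A → E} (hv : Measurable v) {t : ℝ} (ht : 0 < t) (hvt : ∀ x, ‖v x‖ ≤ t) {a : ℝ}
    (ha : 0 ≤ a) :
    tradeoff (gaussianReal 0 1) (gaussianReal t 1) a ≤
      tradeoff ((ν.prod (stdGaussian E)).map F)
        ((ν.prod (stdGaussian E)).map fun q => F (q.1, q.2 + v q.1)) a := by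
  refine tradeoff_le_tradeoff ha fun φ hφ hφ1 => ?_
  have hφn : ∀ x, ‖φ x‖ ≤ 1 := fun x => by
    rw [Real.norm_of_nonneg (hφ1 x).1]; exact (hφ1 x).2
  set Ψ : (ℝ × A) × E → ℝ := fun q => φ (F (q.1.2, gaussianSimulation t (v q.1.2) (q.1.1, q.2)))
    with hΨ
  have hΨm : Measurable Ψ := by
    refine hφ.comp (hF.comp (Measurable.prodMk (by fun_prop) ?_))
    exact measurable_gaussianSimulation t (by fun_prop) (by fun_prop) (by fun_prop)
  set G : ℝ × A → ℝ := fun q => ∫ w, Ψ (q, w) ∂(stdGaussian E) with hG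
  have hGm : StronglyMeasurable G := hΨm.stronglyMeasurable.integral_prod_right'
  have hG1 : ∀ q, G q ∈ Set.Icc (0 : ℝ) 1 := fun q => integral_mem_Icc fun w => hφ1 _
  -- The simulated test: given `y`, draw the mixing variable and an independent Gaussian vector,
  -- simulate the shifted output, and average `φ`.
  set φ' : ℝ → ℝ := fun y => ∫ x, G (y, x) ∂ν with hφ'
  -- The same test serves both hypotheses: `s = 0` yields the unshifted law and `s = t` the fully
  -- shifted one.
  have hkey : ∀ s, ∫ y, φ' y ∂(gaussianReal s 1) =
      ∫ q, φ (F (q.1, q.2 + (s / t) • v q.1)) ∂(ν.prod (stdGaussian E)) := by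
    intro s
    have hmeasR : Measurable fun q : A × E => φ (F (q.1, q.2 + (s / t) • v q.1)) :=
      hφ.comp (hF.comp (by fun_prop))
    have hintR : Integrable (fun q : A × E => φ (F (q.1, q.2 + (s / t) • v q.1)))
        (ν.prod (stdGaussian E)) :=
      .of_bound hmeasR.aestronglyMeasurable 1 (.of_forall fun q => hφn _)
    rw [integral_prod _ hintR, hφ', integral_integral_swap (f := fun y x => G (y, x))
      (.of_bound hGm.aestronglyMeasurable 1 (.of_forall fun q => by
        exact (Real.norm_of_nonneg (hG1 _).1).trans_le (hG1 _).2))]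
    refine integral_congr_ae (.of_forall fun x => ?_)
    have hsim : Measurable fun q : ℝ × E => gaussianSimulation t (v x) q :=
      measurable_gaussianSimulation t measurable_const measurable_fst measurable_snd
    have hφx : Measurable fun g : E => φ (F (x, g)) := hφ.comp (hF.comp measurable_prodMk_left)
    have hintq : Integrable (fun q : ℝ × E => φ (F (x, gaussianSimulation t (v x) q)))
        ((gaussianReal s 1).prod (stdGaussian E)) :=
      .of_bound (hφx.comp hsim).aestronglyMeasurable 1 (.of_forall fun q => hφn _)
    calc ∫ y, G (y, x) ∂(gaussianReal s 1)
        = ∫ q, φ (F (x, gaussianSimulation t (v x) q))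
            ∂((gaussianReal s 1).prod (stdGaussian E)) := (integral_prod _ hintq).symm
      _ = ∫ g, φ (F (x, g)) ∂(((gaussianReal s 1).prod (stdGaussian E)).map
            (gaussianSimulation t (v x))) :=
          (integral_map hsim.aemeasurable hφx.aestronglyMeasurable).symm
      _ = ∫ g, φ (F (x, g + (s / t) • v x)) ∂(stdGaussian E) := by
          rw [map_gaussianSimulation ht (hvt x), integral_map (by fun_prop)
            hφx.aestronglyMeasurable]
  refine ⟨φ', hGm.integral_prod_right'.measurable, fun y => integral_mem_Icc fun x => hG1 _, ?_, ?_⟩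
  · rw [hkey, integral_map hF.aemeasurable hφ.aestronglyMeasurable]
    simp
  · have hF' : Measurable fun q : A × E => F (q.1, q.2 + v q.1) := hF.comp (by fun_prop)
    rw [hkey, integral_map hF'.aemeasurable hφ.aestronglyMeasurable]
    simp [ht.ne']

/-- In the `L²` product squared norms add, so the Gaussian characteristic functions multiply. It
lets the three noises be treated as one Gaussian vector, whose shift length is Euclidean. -/
lemma map_toLp_prodMk_eq_stdGaussian {Ω F : Type*} [MeasurableSpace Ω] {Q : Measure Ω}
    [IsProbabilityMeasure Q] [NormedAddCommGroup F] [InnerProductSpace ℝ F]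
    [FiniteDimensional ℝ F] [MeasurableSpace F] [BorelSpace F] {X : Ω → E} {Y : Ω → F}
    (hX : Measurable X) (hY : Measurable Y) (hind : IndepFun X Y Q)
    (hXlaw : Q.map X = stdGaussian E) (hYlaw : Q.map Y = stdGaussian F) :
    Q.map (fun ω => WithLp.toLp 2 (X ω, Y ω)) = stdGaussian (WithLp 2 (E × F)) := by
  have hm : Measurable fun ω => WithLp.toLp 2 (X ω, Y ω) :=
    (WithLp.measurable_toLp 2 _).comp (hX.prodMk hY)
  have := Measure.isProbabilityMeasure_map (μ := Q) hm.aemeasurable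
  refine Measure.ext_of_charFun ?_
  ext u
  rw [(indepFun_iff_charFun_prod hX.aemeasurable hY.aemeasurable).1 hind, hXlaw, hYlaw,
    charFun_stdGaussian, charFun_stdGaussian, charFun_stdGaussian, ← Complex.exp_add,
    ← Complex.ofReal_pow, ← Complex.ofReal_pow, ← Complex.ofReal_pow,
    WithLp.prod_norm_sq_eq_of_L2]
  congr 1
  push_cast
  ring_nf
  rfl

end Tradeoff

/-! ### Privacy of the estimator -/

section Symmetric

variable {p : ℕ}

/-- The positions of the upper triangle of a matrix, with the diagonal. -/
abbrev UpperIndex (p : ℕ) : Type := {ij : Fin p × Fin p // ij.1 ≤ ij.2}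

/-- The upper triangle of a matrix. -/
def upperPart (M : Matrix (Fin p) (Fin p) ℝ) : EuclideanSpace ℝ (UpperIndex p) :=
  WithLp.toLp 2 fun ij => M ij.1.1 ij.1.2

/-- The symmetric matrix with a given upper triangle. -/
def symmMatrix (u : EuclideanSpace ℝ (UpperIndex p)) : Matrix (Fin p) (Fin p) ℝ :=
  Matrix.of fun i j => if h : i ≤ j then u ⟨(i, j), h⟩ else u ⟨(j, i), (not_le.1 h).le⟩

lemma symmMatrix_upperPart {M : Matrix (Fin p) (Fin p) ℝ} (hM : M.IsSymm) :
    symmMatrix (upperPart M) = M := by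
  ext i j
  by_cases h : i ≤ j
  · simp [symmMatrix, upperPart, h]
  · simp [symmMatrix, upperPart, hM.apply]

lemma symmMatrix_add (u v : EuclideanSpace ℝ (UpperIndex p)) :
    symmMatrix (u + v) = symmMatrix u + symmMatrix v := by
  ext i j
  by_cases h : i ≤ j <;> simp [symmMatrix, h]

lemma measurable_upperPart : Measurable (upperPart (p := p)) :=
  (WithLp.measurable_toLp 2 _).comp (measurable_pi_lambda _ fun ij =>
    measurable_matrix_iff.1 measurable_id ij.1.1 ij.1.2)

lemma measurable_symmMatrix : Measurable (symmMatrix (p := p)) := by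
  have h : ∀ ij, Measurable fun u : EuclideanSpace ℝ (UpperIndex p) => u ij := fun ij =>
    (measurable_pi_apply ij).comp (WithLp.measurable_ofLp 2 _)
  refine measurable_matrix_iff.2 fun i j => ?_
  by_cases hij : i ≤ j
  · simpa [symmMatrix, hij] using h _
  · simpa [symmMatrix, hij] using h _

lemma norm_sq_upperPart_le (M : Matrix (Fin p) (Fin p) ℝ) :
    ‖upperPart M‖ ^ 2 ≤ ∑ i, ∑ j, M i j ^ 2 := by
  rw [EuclideanSpace.real_norm_sq_eq, ← Fintype.sum_prod_type',
    ← Fintype.sum_subtype_add_sum_subtype (fun ij : Fin p × Fin p => ij.1 ≤ ij.2)]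
  exact le_add_of_nonneg_right (Finset.sum_nonneg fun _ _ => sq_nonneg _)

/-- The sensitivity of one matrix release. The Frobenius bound even gives `μ² / 2`, but `μ²` per
noise is what `√3 μ` allows. -/
lemma norm_sq_upperPart_smul_outer_sub_outer_le {u v : EuclideanSpace ℝ (Fin p)} {B μ : ℝ}
    (hB : 0 < B) (hu : ‖u‖ ^ 2 ≤ B) (hv : ‖v‖ ^ 2 ≤ B) :
    ‖upperPart ((μ / (2 * B)) • (outer u - outer v))‖ ^ 2 ≤ μ ^ 2 := by
  refine (norm_sq_upperPart_le _).trans ?_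
  have h := sum_sq_outer_sub_outer_le hu hv
  simp only [Matrix.smul_apply, smul_eq_mul, mul_pow, ← Finset.mul_sum]
  calc _ ≤ (μ / (2 * B)) ^ 2 * (2 * B ^ 2) := by gcongr
    _ = μ ^ 2 / 2 := by field_simp
    _ ≤ μ ^ 2 := by linarith [sq_nonneg μ]

lemma IsSymmGaussian.map_upperPart {Ω : Type*} [MeasurableSpace Ω] {Q : Measure Ω}
    [IsProbabilityMeasure Q] {M : Ω → Matrix (Fin p) (Fin p) ℝ} (hM : IsSymmGaussian M Q) :
    Q.map (fun ω => upperPart (M ω)) = stdGaussian (EuclideanSpace ℝ (UpperIndex p)) := by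
  have hm : ∀ ij : UpperIndex p, Measurable fun ω => M ω ij.1.1 ij.1.2 := fun ij =>
    measurable_matrix_iff.1 hM.measurable _ _
  have h := (iIndepFun_iff_map_fun_eq_pi_map fun ij => (hm ij).aemeasurable).1 hM.indep
  have hlaw : (fun ij : UpperIndex p => Q.map fun ω => M ω ij.1.1 ij.1.2) =
      fun _ => gaussianReal 0 1 := funext fun ij => hM.law _ _ ij.2
  rw [hlaw] at h
  rw [← map_pi_eq_stdGaussian, ← h, Measure.map_map (WithLp.measurable_toLp 2 _)
    (measurable_pi_lambda _ hm)]
  rfl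

end Symmetric

/-! ### Coupling neighbouring data sets by a shift of the noise -/

section Privacy

variable {p : ℕ} {Z : Type*} {ρ : EuclideanSpace ℝ (Fin p) → Z → ℝ}
  {γ a B₀ B₁ μ κ₁ κ₂ : ℝ} {θinit : EuclideanSpace ℝ (Fin p)}

/-- Changing the observation of a step can be compensated by shifting the noise of that step. -/
lemma iterate_eq_iterate_update (hμ : 0 < μ) (hB₀ : 0 < B₀) {D D' : ℕ → Z} {k : ℕ}
    (hDD' : ∀ i, i ≠ k → D i = D' i) (x : ℕ → EuclideanSpace ℝ (Fin p)) (i : ℕ) :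
    iterate ρ γ a B₀ μ θinit D' x i = iterate ρ γ a B₀ μ θinit D
      (Function.update x k (x k + (μ / (2 * B₀)) •
        (Psi ρ (iterate ρ γ a B₀ μ θinit D x k) (D' k) -
          Psi ρ (iterate ρ γ a B₀ μ θinit D x k) (D k)))) i := by
  induction i with
  | zero => rfl
  | succ i ih =>
    rw [iterate, iterate, ← ih]
    by_cases hik : i = k
    · subst hik
      -- Up to the changed step both data sets produce the same path, so the shift may be computed
      -- from either.
      have h1 : iterate ρ γ a B₀ μ θinit D' x i = iterate ρ γ a B₀ μ θinit D x i :=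
        iterate_congr (fun j hj => (hDD' j hj.ne).symm) fun _ _ => rfl
      rw [h1, Function.update_self]
      have h2 : (2 * B₀ / μ) * (μ / (2 * B₀)) = 1 := by field_simp
      rw [smul_add (2 * B₀ / μ), smul_smul, h2, one_smul]
      congr 2
      abel
    · rw [hDD' i hik, Function.update_of_ne hik]

/-- The path `θ` is common to both sums: once the step noise is shifted, the iterates agree, and
only summand `k` can change. -/
lemma sum_along_iterates_eq {D D' : ℕ → Z} {k n : ℕ} (hk : k < n)
    (hDD' : ∀ i, i ≠ k → D i = D' i)
    (H : EuclideanSpace ℝ (Fin p) → Z → Matrix (Fin p) (Fin p) ℝ)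
    (θ : ℕ → EuclideanSpace ℝ (Fin p)) :
    ∑ i ∈ Finset.range n, H (θ i) (D' i) =
      ∑ i ∈ Finset.range n, H (θ i) (D i) + (H (θ k) (D' k) - H (θ k) (D k)) := by
  have hmem : k ∈ Finset.range n := Finset.mem_range.2 hk
  rw [← Finset.add_sum_erase _ _ hmem, ← Finset.add_sum_erase (a := k) _ (fun i => H (θ i) (D i))
    hmem, Finset.sum_congr rfl fun i hi => by rw [← hDD' i (Finset.ne_of_mem_erase hi)]]
  abel

/-- Changing one observation can be compensated by shifting the noises. -/
lemma sigmaHat_eq_sigmaHat_shift (hμ : 0 < μ) (hB₀ : 0 < B₀) (hB₁ : 0 < B₁) {D D' : ℕ → Z}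
    {k n : ℕ} (hk : k < n) (hDD' : ∀ i, i ≠ k → D i = D' i)
    (x : ℕ → EuclideanSpace ℝ (Fin p)) (M N : Matrix (Fin p) (Fin p) ℝ)
    {θ : EuclideanSpace ℝ (Fin p)} (hθ : θ = iterate ρ γ a B₀ μ θinit D x k) :
    sigmaHat ρ γ a B₀ B₁ μ κ₁ κ₂ θinit n D' x M N =
      sigmaHat ρ γ a B₀ B₁ μ κ₁ κ₂ θinit n D
        (Function.update x k (x k + (μ / (2 * B₀)) • (Psi ρ θ (D' k) - Psi ρ θ (D k))))
        (M + (μ / (2 * B₁)) • (hessRho ρ θ (D' k) - hessRho ρ θ (D k)))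
        (N + (μ / (2 * B₀ ^ 2)) • (outer (Psi ρ θ (D' k)) - outer (Psi ρ θ (D k)))) := by
  have hn : (0 : ℝ) < n := by exact_mod_cast (Nat.zero_le k).trans_lt hk
  have hit := iterate_eq_iterate_update (ρ := ρ) (γ := γ) (a := a) (θinit := θinit) hμ hB₀ hDD' x
  rw [← hθ] at hit
  have hitk : iterate ρ γ a B₀ μ θinit D
      (Function.update x k (x k + (μ / (2 * B₀)) • (Psi ρ θ (D' k) - Psi ρ θ (D k)))) k = θ := by
    rw [hθ]
    exact iterate_congr (fun _ _ => rfl) fun i hi => Function.update_of_ne hi.ne _ _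
  have hA : Ahat ρ γ a B₀ B₁ μ θinit n D' x M = Ahat ρ γ a B₀ B₁ μ θinit n D
      (Function.update x k (x k + (μ / (2 * B₀)) • (Psi ρ θ (D' k) - Psi ρ θ (D k))))
      (M + (μ / (2 * B₁)) • (hessRho ρ θ (D' k) - hessRho ρ θ (D k))) := by
    simp only [Ahat, hit]
    rw [sum_along_iterates_eq hk hDD' (hessRho ρ), hitk]
    have h : 2 * B₁ / (n * μ) * (μ / (2 * B₁)) = 1 / n := by field_simp
    rw [smul_add, smul_add, smul_smul, h]
    abel
  have hS : Shat ρ γ a B₀ μ θinit n D' x N = Shat ρ γ a B₀ μ θinit n D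
      (Function.update x k (x k + (μ / (2 * B₀)) • (Psi ρ θ (D' k) - Psi ρ θ (D k))))
      (N + (μ / (2 * B₀ ^ 2)) • (outer (Psi ρ θ (D' k)) - outer (Psi ρ θ (D k)))) := by
    simp only [Shat, hit]
    rw [sum_along_iterates_eq hk hDD' (fun t y => outer (Psi ρ t y)), hitk]
    have h : 2 * B₀ ^ 2 / (n * μ) * (μ / (2 * B₀ ^ 2)) = 1 / n := by field_simp
    rw [smul_add, smul_add, smul_smul, h]
    abel
  rw [sigmaHat, sigmaHat, hA, hS]

/-- Handles neighbours that differ only past the first `n` entries, where no shift is needed. -/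
lemma sigmaHat_congr {D D' : ℕ → Z} {n : ℕ} (hDD' : ∀ i < n, D i = D' i)
    (x : ℕ → EuclideanSpace ℝ (Fin p)) (M N : Matrix (Fin p) (Fin p) ℝ) :
    sigmaHat ρ γ a B₀ B₁ μ κ₁ κ₂ θinit n D' x M N =
      sigmaHat ρ γ a B₀ B₁ μ κ₁ κ₂ θinit n D x M N := by
  have h : ∀ i ∈ Finset.range n, iterate ρ γ a B₀ μ θinit D' x i =
      iterate ρ γ a B₀ μ θinit D x i ∧ D' i = D i := fun i hi =>
    ⟨iterate_congr (fun j hj => (hDD' j (hj.trans (Finset.mem_range.1 hi))).symm) fun _ _ => rfl,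
      (hDD' i (Finset.mem_range.1 hi)).symm⟩
  have hA : Ahat ρ γ a B₀ B₁ μ θinit n D' x M = Ahat ρ γ a B₀ B₁ μ θinit n D x M := by
    rw [Ahat, Ahat, Finset.sum_congr rfl fun i hi => by rw [(h i hi).1, (h i hi).2]]
  have hS : Shat ρ γ a B₀ μ θinit n D' x N = Shat ρ γ a B₀ μ θinit n D x N := by
    rw [Shat, Shat, Finset.sum_congr rfl fun i hi => by rw [(h i hi).1, (h i hi).2]]
  rw [sigmaHat, sigmaHat, hA, hS]

/-- The noises that carry the privacy of the `k`-th observation: those of the `k`-th step and of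
the two matrices. -/
abbrev NoiseSpace (p : ℕ) : Type :=
  WithLp 2 (EuclideanSpace ℝ (Fin p) ×
    WithLp 2 (EuclideanSpace ℝ (UpperIndex p) × EuclideanSpace ℝ (UpperIndex p)))

variable [MeasurableSpace Z] {P : Measure Z} {θ₀ : EuclideanSpace ℝ (Fin p)}
  {Ω : Type*} [MeasurableSpace Ω] {Q : Measure Ω} [IsProbabilityMeasure Q]
  {z : ℕ → Ω → Z} {ξ : ℕ → Ω → EuclideanSpace ℝ (Fin p)}
  {M₁ M₂ : Ω → Matrix (Fin p) (Fin p) ℝ}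

/-- The noises of the `k`-th step and of the matrices form a standard Gaussian vector independent
of the noises of the other steps. -/
lemma map_noise (hsampling : IsSampling P Q z ξ M₁ M₂) (k : ℕ) :
    Q.map (fun ω => ((fun i => if i ∈ ({k}ᶜ : Set ℕ) then ξ i ω else 0),
      (WithLp.toLp 2 (ξ k ω, WithLp.toLp 2 (upperPart (M₁ ω), upperPart (M₂ ω))) :
        NoiseSpace p))) =
      (Q.map fun ω i => if i ∈ ({k}ᶜ : Set ℕ) then ξ i ω else 0).prod
        (stdGaussian (NoiseSpace p)) := by
  have hξ := hsampling.ξ_measurable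
  have hm₁ : Measurable fun ω => upperPart (M₁ ω) :=
    measurable_upperPart.comp hsampling.M₁_gaussian.measurable
  have hm₂ : Measurable fun ω => upperPart (M₂ ω) :=
    measurable_upperPart.comp hsampling.M₂_gaussian.measurable
  have hmask := measurable_masked hξ ({k}ᶜ : Set ℕ) 0
  have hU : Measurable fun ω => WithLp.toLp 2 (upperPart (M₁ ω), upperPart (M₂ ω)) :=
    (WithLp.measurable_toLp 2 _).comp (hm₁.prodMk hm₂)
  have hUlaw := map_toLp_prodMk_eq_stdGaussian hm₁ hm₂
    (hsampling.indep_matrices.comp measurable_upperPart measurable_upperPart)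
    hsampling.M₁_gaussian.map_upperPart hsampling.M₂_gaussian.map_upperPart
  have hUm : Measurable fun q : Matrix (Fin p) (Fin p) ℝ × Matrix (Fin p) (Fin p) ℝ =>
      WithLp.toLp 2 (upperPart q.1, upperPart q.2) :=
    (WithLp.measurable_toLp 2 _).comp ((measurable_upperPart.comp measurable_fst).prodMk
      (measurable_upperPart.comp measurable_snd))
  have hind₁ : IndepFun (ξ k)
      (fun ω => WithLp.toLp 2 (upperPart (M₁ ω), upperPart (M₂ ω))) Q :=
    hsampling.indep_noise.comp (measurable_pi_apply k) hUm
  have hind₂ : IndepFun (fun ω => ((fun i => if i ∈ ({k}ᶜ : Set ℕ) then ξ i ω else 0), ξ k ω))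
      (fun ω => WithLp.toLp 2 (upperPart (M₁ ω), upperPart (M₂ ω))) Q :=
    hsampling.indep_noise.comp
      (φ := fun s => ((fun i => if i ∈ ({k}ᶜ : Set ℕ) then s i else 0), s k))
      ((measurable_masked measurable_pi_apply _ _).prodMk (measurable_pi_apply k)) hUm
  have hind₃ := indepFun_assoc hmask (hξ k) hU
    (indepFun_masked hξ hsampling.ξ_indep _ (by simp) 0) hind₂
  have hind₄ := hind₃.comp measurable_id (WithLp.measurable_toLp 2 (EuclideanSpace ℝ (Fin p) ×
    WithLp 2 (EuclideanSpace ℝ (UpperIndex p) × EuclideanSpace ℝ (UpperIndex p))))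
  have hG : Measurable fun ω =>
      (WithLp.toLp 2 (ξ k ω, WithLp.toLp 2 (upperPart (M₁ ω), upperPart (M₂ ω))) :
        NoiseSpace p) := (WithLp.measurable_toLp 2 _).comp ((hξ k).prodMk hU)
  have h := (indepFun_iff_map_prod_eq_prod_map_map hmask.aemeasurable hG.aemeasurable).1 hind₄
  rw [h, map_toLp_prodMk_eq_stdGaussian (hξ k) hU hind₁ (hsampling.ξ_law k) hUlaw]

/-- The private sandwich estimator is `√3 μ`-GDP. -/
lemma isGDP_sigmaHat (hμ : 0 < μ) (hB₀ : 0 < B₀) (hB₁ : 0 < B₁) (hproblem : IsProblem ρ P θ₀)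
    (hsampling : IsSampling P Q z ξ M₁ M₂) (hgrad : ∀ θ x, ‖Psi ρ θ x‖ ≤ B₀)
    (hfactor : HessianFactorizes ρ B₁) (n : ℕ) :
    IsGDP (√3 * μ) (fun D : ℕ → Z =>
      Q.map (fun ω =>
        sigmaHat ρ γ a B₀ B₁ μ κ₁ κ₂ θinit n D (fun i => ξ i ω) (M₁ ω) (M₂ ω))) := by
  have hξ := hsampling.ξ_measurable
  refine ⟨fun D => Measure.isProbabilityMeasure_map (measurable_sigmaHat hproblem
    measurable_const (measurable_pi_lambda _ hξ) hsampling.M₁_gaussian.measurable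
    hsampling.M₂_gaussian.measurable n).aemeasurable, ?_⟩
  rintro D D' ⟨k, hDD'⟩ b hb
  set ν := Q.map fun ω i => if i ∈ ({k}ᶜ : Set ℕ) then ξ i ω else 0 with hν
  have hmask := measurable_masked hξ ({k}ᶜ : Set ℕ) 0
  have : IsProbabilityMeasure ν := Measure.isProbabilityMeasure_map hmask.aemeasurable
  set out : (ℕ → Z) → (ℕ → EuclideanSpace ℝ (Fin p)) × NoiseSpace p →
      Matrix (Fin p) (Fin p) ℝ := fun D q =>
    sigmaHat ρ γ a B₀ B₁ μ κ₁ κ₂ θinit n D (Function.update q.1 k q.2.ofLp.1)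
      (symmMatrix q.2.ofLp.2.ofLp.1) (symmMatrix q.2.ofLp.2.ofLp.2) with hout
  have hofLp : Measurable fun q : (ℕ → EuclideanSpace ℝ (Fin p)) × NoiseSpace p => q.2.ofLp :=
    (WithLp.measurable_ofLp 2 _).comp measurable_snd
  have hofLp' : Measurable fun q : (ℕ → EuclideanSpace ℝ (Fin p)) × NoiseSpace p =>
      q.2.ofLp.2.ofLp := (WithLp.measurable_ofLp 2 _).comp (measurable_snd.comp hofLp)
  have houtm : ∀ D, Measurable (out D) := fun D =>
    measurable_sigmaHat hproblem measurable_const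
      (measurable_update'.comp (measurable_fst.prodMk (measurable_fst.comp hofLp)))
      (measurable_symmMatrix.comp (measurable_fst.comp hofLp'))
      (measurable_symmMatrix.comp (measurable_snd.comp hofLp')) n
  have hlaw : ∀ D, Q.map (fun ω =>
      sigmaHat ρ γ a B₀ B₁ μ κ₁ κ₂ θinit n D (fun i => ξ i ω) (M₁ ω) (M₂ ω)) =
      (ν.prod (stdGaussian (NoiseSpace p))).map (out D) := by
    intro D
    rw [hν, ← map_noise hsampling k, Measure.map_map (houtm D) ?_]
    · congr 1
      ext1 ω
      have hupd : Function.update (fun i => if i ∈ ({k}ᶜ : Set ℕ) then ξ i ω else 0) k (ξ k ω) =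
          fun i => ξ i ω := by
        ext1 i
        by_cases hi : i = k
        · subst hi; simp
        · simp [hi]
      simp only [Function.comp_apply, hout, hupd,
        symmMatrix_upperPart (hsampling.M₁_gaussian.symm ω),
        symmMatrix_upperPart (hsampling.M₂_gaussian.symm ω)]
    · exact hmask.prodMk ((WithLp.measurable_toLp 2 _).comp ((hξ k).prodMk
        ((WithLp.measurable_toLp 2 _).comp
          ((measurable_upperPart.comp hsampling.M₁_gaussian.measurable).prodMk
            (measurable_upperPart.comp hsampling.M₂_gaussian.measurable)))))
  have ht : 0 < √3 * μ := by positivity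
  -- The shift `v` must be a function of the other noises alone, so that it is independent of the
  -- Gaussian vector it is added to.
  suffices hv : ∃ v : (ℕ → EuclideanSpace ℝ (Fin p)) → NoiseSpace p, Measurable v ∧
      (∀ x, ‖v x‖ ≤ √3 * μ) ∧ ∀ q, out D' q = out D (q.1, q.2 + v q.1) by
    obtain ⟨v, hvm, hvt, hshift⟩ := hv
    simp only [hlaw]
    rw [show out D' = fun q => out D (q.1, q.2 + v q.1) from funext hshift]
    exact tradeoff_gaussianReal_le ν (houtm D) hvm ht hvt hb.1
  rcases le_or_gt n k with hnk | hkn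
  · refine ⟨0, measurable_const, fun x => by simpa using ht.le, fun q => ?_⟩
    simp only [Pi.zero_apply, add_zero, hout]
    exact sigmaHat_congr (fun i hi => hDD' i (hi.trans_le hnk).ne) _ _ _
  -- The iterate before step `k` reads only noises with index below `k`, so it can be computed from
  -- the masked sequence.
  · set θ : (ℕ → EuclideanSpace ℝ (Fin p)) → EuclideanSpace ℝ (Fin p) := fun x =>
      iterate ρ γ a B₀ μ θinit D x k with hθ
    have hθm : Measurable θ := measurable_iterate hproblem measurable_const measurable_id k
    have hΨm : ∀ y, Measurable fun x => Psi ρ (θ x) y := fun y =>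
      measurable_Psi_comp hproblem hθm measurable_const
    have hHm : ∀ y, Measurable fun x => hessRho ρ (θ x) y := fun y =>
      measurable_hessRho_comp hproblem hθm measurable_const
    have hOm : ∀ y, Measurable fun x => outer (Psi ρ (θ x) y) := fun y =>
      continuous_outer.measurable.comp (hΨm y)
    refine ⟨fun x => WithLp.toLp 2
      ((μ / (2 * B₀)) • (Psi ρ (θ x) (D' k) - Psi ρ (θ x) (D k)), WithLp.toLp 2
        (upperPart ((μ / (2 * B₁)) • (hessRho ρ (θ x) (D' k) - hessRho ρ (θ x) (D k))),
          upperPart ((μ / (2 * B₀ ^ 2)) •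
            (outer (Psi ρ (θ x) (D' k)) - outer (Psi ρ (θ x) (D k)))))), ?_, ?_, ?_⟩
    · refine (WithLp.measurable_toLp 2 _).comp (Measurable.prodMk
        (((hΨm (D' k)).sub (hΨm (D k))).const_smul (μ / (2 * B₀)))
        ((WithLp.measurable_toLp 2 _).comp (Measurable.prodMk ?_ ?_)))
      · exact measurable_upperPart.comp
          (((hHm (D' k)).sub (hHm (D k))).const_smul (μ / (2 * B₁)))
      · exact measurable_upperPart.comp
          (((hOm (D' k)).sub (hOm (D k))).const_smul (μ / (2 * B₀ ^ 2)))
    · intro x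
      -- The squared length of the joint shift is a sum of three squares, each at most `μ ^ 2`.
      refine abs_le_of_sq_le_sq' ?_ ht.le |>.2
      rw [WithLp.prod_norm_sq_eq_of_L2, WithLp.prod_norm_sq_eq_of_L2, mul_pow,
        Real.sq_sqrt (by norm_num)]
      have h1 : ‖(μ / (2 * B₀)) • (Psi ρ (θ x) (D' k) - Psi ρ (θ x) (D k))‖ ^ 2 ≤ μ ^ 2 := by
        gcongr
        rw [norm_smul, Real.norm_of_nonneg (by positivity)]
        calc _ ≤ μ / (2 * B₀) * (B₀ + B₀) := by
              gcongr
              exact (norm_sub_le _ _).trans (add_le_add (hgrad _ _) (hgrad _ _))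
          _ = μ := by field_simp; ring
      have h2 : ‖upperPart ((μ / (2 * B₁)) •
          (hessRho ρ (θ x) (D' k) - hessRho ρ (θ x) (D k)))‖ ^ 2 ≤ μ ^ 2 := by
        obtain ⟨m, hm⟩ := hfactor
        rw [(hm _ _).1, (hm _ _).1]
        exact norm_sq_upperPart_smul_outer_sub_outer_le hB₁ (hm _ _).2 (hm _ _).2
      have h3 : ‖upperPart ((μ / (2 * B₀ ^ 2)) •
          (outer (Psi ρ (θ x) (D' k)) - outer (Psi ρ (θ x) (D k))))‖ ^ 2 ≤ μ ^ 2 :=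
        norm_sq_upperPart_smul_outer_sub_outer_le (by positivity)
          (by gcongr; exact hgrad _ _) (by gcongr; exact hgrad _ _)
      refine (add_le_add h1 (add_le_add h2 h3)).trans ?_
      linarith
    · intro q
      have hθq : θ q.1 = iterate ρ γ a B₀ μ θinit D (Function.update q.1 k q.2.ofLp.1) k :=
        iterate_congr (fun _ _ => rfl) fun i hi => (Function.update_of_ne hi.ne _ _).symm
      simp only [hout]
      rw [sigmaHat_eq_sigmaHat_shift hμ hB₀ hB₁ hkn hDD' _ _ _ hθq]
      simp only [WithLp.ofLp_add, Prod.fst_add, Prod.snd_add, symmMatrix_add,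
        Function.update_self, Function.update_idem]
      rw [symmMatrix_upperPart, symmMatrix_upperPart]
      · exact ((outer_isSymm _).sub (outer_isSymm _)).smul _
      · exact ((isSymm_hessRho hfactor _ _).sub (isSymm_hessRho hfactor _ _)).smul _

end Privacy

/-- The quadratic form of `S` at `v` is the mean of `⟨Ψ, v⟩²`. It is needed for the prefactor of the
rate to be positive. -/
lemma lambdaMin_matS_nonneg {p : ℕ} {Z : Type*} [MeasurableSpace Z]
    {ρ : EuclideanSpace ℝ (Fin p) → Z → ℝ} {P : Measure Z} [IsProbabilityMeasure P]
    {θ₀ : EuclideanSpace ℝ (Fin p)} {B₀ : ℝ}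
    (hproblem : IsProblem ρ P θ₀) (hgrad : ∀ θ x, ‖Psi ρ θ x‖ ≤ B₀) :
    0 ≤ lambdaMin (matS ρ P θ₀) := by
  have hherm : (matS ρ P θ₀).IsHermitian := isHermitian_matS
  refine Real.sInf_nonneg fun d hd => ?_
  rw [hherm.spectrum_real_eq_range_eigenvalues] at hd
  obtain ⟨i, rfl⟩ := hd
  rw [hherm.eigenvalues_eq, star_trivial]
  set v := hherm.eigenvectorBasis i
  have hm := measurable_matrix_iff.1
    (continuous_outer.measurable.comp (measurable_Psi hproblem θ₀))
  have hint : ∀ j k, Integrable (fun x => outer (Psi ρ θ₀ x) j k) P := fun j k =>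
    .of_bound (hm j k).aestronglyMeasurable (B₀ ^ 2)
      (.of_forall fun x => (abs_entry_le_norm _ j k).trans ((norm_outer_le _).trans
        (by gcongr; exact hgrad _ _)))
  have h : v.ofLp ⬝ᵥ matS ρ P θ₀ *ᵥ v.ofLp =
      ∫ x, v.ofLp ⬝ᵥ outer (Psi ρ θ₀ x) *ᵥ v.ofLp ∂P := by
    simp only [dotProduct, Matrix.mulVec, matS, Matrix.of_apply]
    rw [integral_finsetSum _ fun j _ => (integrable_finsetSum _ fun k _ =>
      (hint j k).mul_const _).const_mul _]
    refine Finset.sum_congr rfl fun j _ => ?_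
    rw [integral_const_mul, integral_finsetSum _ fun k _ => (hint j k).mul_const _]
    simp only [integral_mul_const]
  change 0 ≤ v.ofLp ⬝ᵥ matS ρ P θ₀ *ᵥ v.ofLp
  rw [h]
  refine integral_nonneg fun x => ?_
  have hx : v.ofLp ⬝ᵥ outer (Psi ρ θ₀ x) *ᵥ v.ofLp = (inner ℝ (Psi ρ θ₀ x) v) ^ 2 := by
    have h1 := congrArg (fun y : EuclideanSpace ℝ (Fin p) => inner ℝ y v)
      (outer_mulVec (Psi ρ θ₀ x) v)
    simp only [real_inner_smul_left] at h1
    rw [sq, ← h1]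
    simp [PiLp.inner_apply, dotProduct]
  simp only [Pi.zero_apply, hx]
  positivity

end PrivateSGD

end

/-! ### Assembly of privacy, rate and convergence -/

open PrivateSGD in
theorem theorem3 {p : ℕ} {Z Ω : Type*} [MeasurableSpace Z] [MeasurableSpace Ω]
    (P : Measure Z) [IsProbabilityMeasure P] (Q : Measure Ω) [IsProbabilityMeasure Q]
    (ρ : EuclideanSpace ℝ (Fin p) → Z → ℝ) (Θ : Set (EuclideanSpace ℝ (Fin p)))
    (θ₀ θinit : EuclideanSpace ℝ (Fin p))
    (z : ℕ → Ω → Z) (ξ : ℕ → Ω → EuclideanSpace ℝ (Fin p))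
    (M₁ M₂ : Ω → Matrix (Fin p) (Fin p) ℝ)
    (μ γ a B₀ B₁ ζ lam C₁ C₂ C₃ K κ₁ κ₂ cp : ℝ)
    (hμ : 0 < μ) (hγ : 0 < γ) (ha : a ∈ Set.Ioo (1 / 2 : ℝ) 1) (hB₀ : 0 < B₀)
    (hζ : 0 < ζ) (hlam : 0 < lam) (hC₁ : 0 < C₁) (hC₂ : 0 < C₂) (hC₃ : 0 < C₃) (hK : 0 < K)
    (hcp : 0 < cp)
    (hproblem : IsProblem ρ P θ₀) (hθ₀ : θ₀ ∈ Θ)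
    (hsampling : IsSampling P Q z ξ M₁ M₂)
    -- bounded gradients
    (hgrad : ∀ θ x, ‖Psi ρ θ x‖ ≤ B₀)
    -- smoothness and strong convexity of the population loss
    (hconvex : SmoothStronglyConvex ρ P Θ ζ lam)
    -- gradient noise
    (hnoise : GradNoiseCondition ρ P θ₀ γ a B₀ μ θinit Q z ξ C₁ C₂)
    -- Hessian factorization and boundedness
    (hfactor : HessianFactorizes ρ B₁)
    -- Hessian Lipschitz condition
    (hlip : HessianLipschitz ρ P θ₀ K C₃)
    -- truncation levels
    (hκ₁ : 0 < κ₁) (hκ₁A : κ₁ ≤ lambdaMin (matA ρ P θ₀))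
    (hκ₂ : 0 ≤ κ₂) (hκ₂S : κ₂ ≤ lambdaMin (matStilde ρ P θ₀ B₀ μ))
    -- non-degeneracy
    (hS : matS ρ P θ₀ ≠ 0) :
    (∀ n : ℕ, 1 ≤ n → IsGDP (√3 * μ) (fun D : ℕ → Z =>
      Q.map (fun ω => sigmaHat ρ γ a B₀ B₁ μ κ₁ κ₂ θinit n D (fun i => ξ i ω) (M₁ ω) (M₂ ω)))) ∧
    (∃ C : ℝ, 0 < C ∧ ∀ n : ℕ, 1 ≤ n →
      Integrable (fun ω =>
        ‖sigmaHat ρ γ a B₀ B₁ μ κ₁ κ₂ θinit n (fun i => z i ω) (fun i => ξ i ω) (M₁ ω) (M₂ ω) -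
          (matA ρ P θ₀)⁻¹ * matStilde ρ P θ₀ B₀ μ * (matA ρ P θ₀)⁻¹‖) Q ∧
      ∫ ω,
        ‖sigmaHat ρ γ a B₀ B₁ μ κ₁ κ₂ θinit n (fun i => z i ω) (fun i => ξ i ω) (M₁ ω) (M₂ ω) -
          (matA ρ P θ₀)⁻¹ * matStilde ρ P θ₀ B₀ μ * (matA ρ P θ₀)⁻¹‖ ∂Q ≤
        C * (‖matS ρ P θ₀‖ * (√(γ * cp) * B₀ ^ 2 * K / μ) *
          (1 + lambdaMin (matS ρ P θ₀) + 4 * B₀ ^ 2 / μ ^ 2) *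
          ((n : ℝ) ^ (-a / 2) + √(γ * cp) * K / μ * (n : ℝ) ^ (-a)))) ∧
    Tendsto (fun n : ℕ => ∫ ω,
        ‖sigmaHat ρ γ a B₀ B₁ μ κ₁ κ₂ θinit n (fun i => z i ω) (fun i => ξ i ω) (M₁ ω) (M₂ ω) -
          (matA ρ P θ₀)⁻¹ * matStilde ρ P θ₀ B₀ μ * (matA ρ P θ₀)⁻¹‖ ∂Q) atTop (𝓝 0) := by
  obtain ⟨C, hC, hrate⟩ := exists_integral_norm_sigmaHat_sub_le hμ hγ
    (⟨by linarith [ha.1], ha.2⟩ : a ∈ Set.Ioo (0 : ℝ) 1) hB₀ hK hproblem hsampling hgrad hfactor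
    hlip hκ₁ hκ₁A hκ₂S hS (θinit := θinit)
  have hB₁ : 0 < B₁ := pos_of_le_lambdaMin_matA hproblem hgrad hfactor hS hκ₁ hκ₁A
  have hlmin := lambdaMin_matS_nonneg hproblem hgrad
  have hSpos : 0 < ‖matS ρ P θ₀‖ := norm_pos_iff.2 hS
  refine ⟨fun n _ => isGDP_sigmaHat hμ hB₀ hB₁ hproblem hsampling hgrad hfactor n, ?_, ?_⟩
  · set F := ‖matS ρ P θ₀‖ * (√(γ * cp) * B₀ ^ 2 * K / μ) *
      (1 + lambdaMin (matS ρ P θ₀) + 4 * B₀ ^ 2 / μ ^ 2) with hF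
    have hFpos : 0 < F := by
      have : 0 < √(γ * cp) := Real.sqrt_pos.2 (mul_pos hγ hcp)
      positivity
    -- `F` is positive and does not depend on `n`, so it cancels; the remaining `n^{-a}` term is
    -- nonnegative and only enlarges the bound.
    refine ⟨C / F, div_pos hC hFpos, fun n hn => ⟨(hrate n hn).1, (hrate n hn).2.trans ?_⟩⟩
    rw [← mul_assoc, div_mul_cancel₀ _ hFpos.ne', neg_div]
    exact mul_le_mul_of_nonneg_left (le_add_of_nonneg_right (by positivity)) hC.le
  · have hlim : Tendsto (fun n : ℕ => C * (n : ℝ) ^ (-(a / 2))) atTop (𝓝 0) := by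
      simpa using ((tendsto_rpow_neg_atTop (by linarith [ha.1] : 0 < a / 2)).comp
        tendsto_natCast_atTop_atTop).const_mul C
    exact squeeze_zero' (.of_forall fun n => integral_nonneg fun ω => norm_nonneg _)
      (eventually_atTop.2 ⟨1, fun n hn => (hrate n hn).2⟩) hlim
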